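/- Let $K$ be an algebraically closed field of characteristic $p$ and let $G = E\ltimes D$ be a finite group which is the semidirect product of a $p'$-group $E$ (i.e. $p\nmid |E|$) acting on a normal $p$-subgroup $D$ (i.e. $|D|$ is a power of $p$; if $p=0$ this means $D=1$). Put $\Lambda := KG$. *Conventions.* For a finite-dimensional algebra $\Lambda$ let $\mathcal K_\Lambda := \mathsf K^{\rm b}(\operatorname{proj}\Lambda)$ be the homotopy category of bounded complexes of finitely generated projective right $\Lambda$-modules. For objects $T, U$ write $T\ge U$ if $\operatorname{Hom}_{\mathcal K_\Lambda}(T,U[i])=0$ for all $i>0$. An object $T$ is *silting* if $T\ge T$ and the smallest thick subcategory of $\mathcal K_\Lambda$ containing $T$ is $\mathcal K_\Lambda$. Let $\operatorname{silt}\Lambda$ be the set of isomorphism classes of basic silting objects, and $\operatorname{2silt}\Lambda := \{T\in\operatorname{silt}\Lambda \mid \Lambda\ge T\ge\Lambda[1]\}$. For an indecomposable summand $P$ of an object $T$, write $T\cong X\oplus M$, where $X$ collects all copies of $P$, so that $P\notin\operatorname{add}M$. The left mutation $\mu^-_P(T)$ is $Y\oplus M$, where $Y$ is the cone of a minimal left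 $\operatorname{add}M$-approximation $X\to M'$; dually, the right mutation $\mu_P^+(T)$ is $Y\oplus M$, where $Y\to M'\to X\to Y[1]$ is a distinguished triangle with $M'\to X$ a minimal right $\operatorname{add}M$-approximation. For an indecomposable projective $\Lambda$-module $P$ put $$\mathcal T_P^- := \{T\in\operatorname{2silt}\Lambda \mid \mu_P^-(\Lambda)\ge T\ge\Lambda[1]\},\qquad \mathcal T_P^+ := \{T\in\operatorname{2silt}\Lambda \mid \Lambda\ge T\ge\mu_{P[1]}^+(\Lambda[1])\}.$$ **Theorem.** The element $e := \frac1{|E|}\sum_{g\in E} g$ is a primitive idempotent of $\Lambda=KG$, fixed by the $K$-linear anti-automorphism of $KG$ given by $g\mapsto g^{-1}$ $(g\in G)$. Moreover, there is an order-reversing bijection (with respect to $\ge$, in both directions) between $\mathcal T^-_{e\Lambda}$ and $\mathcal T^+_{e\Lambda}$, and $$|\operatorname{2silt}\Lambda| = 2\cdot|\mathcal T^-_{e\Lambda}|$$ as (possibly infinite) cardinal numbers. -/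

import Mathlib

open CategoryTheory CategoryTheory.Limits CategoryTheory.Pretriangulated Cardinal

/-! ## Silting theory in a triangulated category -/

namespace Silting

universe v u w

section Triangulated

variable {𝒯 : Type u} [Category.{v} 𝒯] [HasZeroObject 𝒯] [HasShift 𝒯 ℤ] [Preadditive 𝒯]
  [∀ n : ℤ, (shiftFunctor 𝒯 n).Additive] [Pretriangulated 𝒯]

/-- The relation `T ≥ U`: `Hom(T, U[i]) = 0` for every integer `i > 0`. -/
def SiltGE (T U : 𝒯) : Prop :=
  ∀ i : ℤ, 0 < i → ∀ f : T ⟶ U⟦i⟧, f = 0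

set_option linter.unusedSectionVars false in
theorem SiltGE.of_iso {T T' U U' : 𝒯} (h : SiltGE T U) (a : T ≅ T') (b : U ≅ U') :
    SiltGE T' U' := by
  intro i hi f
  have h0 := h i hi (a.hom ≫ f ≫ (shiftFunctor 𝒯 i).map b.inv)
  have h1 : f ≫ (shiftFunctor 𝒯 i).map b.inv = 0 := by
    rw [← cancel_epi a.hom, h0, comp_zero]
  rw [← cancel_mono ((shiftFunctor 𝒯 i).map b.inv), h1, zero_comp]

set_option linter.unusedSectionVars false in
theorem siltGE_iff_of_iso {T T' U U' : 𝒯} (a : T ≅ T') (b : U ≅ U') :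
    SiltGE T U ↔ SiltGE T' U' :=
  ⟨fun h => h.of_iso a b, fun h => h.of_iso a.symm b.symm⟩

/-- `T` is silting: `Hom(T, T[i]) = 0` for all `i > 0`, and the smallest thick subcategory
containing `T` is everything. -/
structure IsSilting (T : 𝒯) : Prop where
  self_ge : SiltGE T T
  thick_eq_top : (ObjectProperty.singleton T).IsClassicalTriangulatedGenerator

/-- `T` is basic: no nonzero object occurs twice in a direct sum decomposition of `T`. -/
def IsBasic (T : 𝒯) : Prop :=
  ∀ X Y : 𝒯, Nonempty (T ≅ (X ⊞ X) ⊞ Y) → IsZero X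

/-- `InAdd M X`: the object `X` lies in `add M`, that is, it is a direct summand of a finite
direct sum of copies of `M`. -/
def InAdd (M X : 𝒯) : Prop :=
  ∃ (n : ℕ) (Y : 𝒯), Nonempty (X ⊞ Y ≅ ⨁ fun _ : Fin n => M)

/-- `f : X ⟶ M'` is a minimal left `add M`-approximation of `X`. -/
structure IsMinLeftApprox (M : 𝒯) {X M' : 𝒯} (f : X ⟶ M') : Prop where
  mem : InAdd M M'
  factors : ∀ N : 𝒯, InAdd M N → ∀ g : X ⟶ N, ∃ h : M' ⟶ N, f ≫ h = g
  minimal : ∀ h : M' ⟶ M', f ≫ h = f → IsIso h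

/-- `f : M' ⟶ X` is a minimal right `add M`-approximation of `X`. -/
structure IsMinRightApprox (M : 𝒯) {X M' : 𝒯} (f : M' ⟶ X) : Prop where
  mem : InAdd M M'
  factors : ∀ N : 𝒯, InAdd M N → ∀ g : N ⟶ X, ∃ h : N ⟶ M', h ≫ f = g
  minimal : ∀ h : M' ⟶ M', h ≫ f = f → IsIso h

/-- `U` is a left mutation of `X ⊕ M` with respect to `X`: `U ≅ Y ⊕ M`, where `Y` is the mapping
cone of a minimal left `add M`-approximation `X ⟶ M'`. -/
def IsLeftMutation (X M U : 𝒯) : Prop :=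
  ∃ (M' Y : 𝒯) (f : X ⟶ M') (g : M' ⟶ Y) (h : Y ⟶ X⟦(1 : ℤ)⟧),
    Triangle.mk f g h ∈ distTriang 𝒯 ∧ IsMinLeftApprox M f ∧ Nonempty (U ≅ Y ⊞ M)

/-- `U` is a right mutation of `X ⊕ M` with respect to `X`: `U ≅ Y ⊕ M`, where `Y` is the
cocone of a minimal right `add M`-approximation `M' ⟶ X`. -/
def IsRightMutation (X M U : 𝒯) : Prop :=
  ∃ (M' Y : 𝒯) (k : Y ⟶ M') (f : M' ⟶ X) (h : X ⟶ Y⟦(1 : ℤ)⟧),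
    Triangle.mk k f h ∈ distTriang 𝒯 ∧ IsMinRightApprox M f ∧ Nonempty (U ≅ Y ⊞ M)

/-- `T ≅ X ⊕ M`, where `X` collects all the copies of the (indecomposable) object `P` in `T`.
When `P` occurs exactly once in `T` (for instance as a summand of a basic `T`) this just says
that `X ≅ P` and that `M` is a complement of `P` in `T`. -/
def IsSplittingAt (P T X M : 𝒯) : Prop :=
  Nonempty (T ≅ X ⊞ M) ∧ InAdd P X ∧ ¬ InAdd M P

/-- `U` is `μ_P⁻(T)`, the left mutation of `T` at its indecomposable summand `P`. -/
def IsLeftMutationAt (P T U : 𝒯) : Prop :=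
  ∃ X M : 𝒯, IsSplittingAt P T X M ∧ IsLeftMutation X M U

/-- `U` is `μ_P⁺(T)`, the right mutation of `T` at its indecomposable summand `P`. -/
def IsRightMutationAt (P T U : 𝒯) : Prop :=
  ∃ X M : 𝒯, IsSplittingAt P T X M ∧ IsRightMutation X M U

variable (𝒯) in
/-- The basic silting objects of `𝒯`. -/
def BasicSilting : Type u := {T : 𝒯 // IsSilting T ∧ IsBasic T}

variable (𝒯) in
/-- Isomorphism of basic silting objects. -/
instance basicSiltingSetoid : Setoid (BasicSilting 𝒯) where
  r T U := Nonempty (T.1 ≅ U.1)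
  iseqv :=
    { refl := fun _ => ⟨Iso.refl _⟩
      symm := fun ⟨a⟩ => ⟨a.symm⟩
      trans := fun ⟨a⟩ ⟨b⟩ => ⟨a.trans b⟩ }

variable (𝒯) in
/-- `silt 𝒯`: the set of isomorphism classes of basic silting objects. -/
def Silt : Type u := Quotient (basicSiltingSetoid 𝒯)

namespace Silt

/-- `q ≤ r` in `silt 𝒯` means `Hom(r, q[i]) = 0` for all `i > 0`. -/
instance : LE (Silt 𝒯) where
  le := Quotient.lift₂ (fun T U => SiltGE U.1 T.1) (by
    rintro T U T' U' ⟨a⟩ ⟨b⟩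
    exact propext (siltGE_iff_of_iso b a))

/-- `q.LEObj A`: the relation `A ≥ q`, for an object `A` of `𝒯`. -/
def LEObj (q : Silt 𝒯) (A : 𝒯) : Prop :=
  Quotient.lift (fun T : BasicSilting 𝒯 => SiltGE A T.1) (by
    rintro T T' ⟨a⟩
    exact propext (siltGE_iff_of_iso (Iso.refl A) a)) q

/-- `q.GEObj A`: the relation `q ≥ A`, for an object `A` of `𝒯`. -/
def GEObj (q : Silt 𝒯) (A : 𝒯) : Prop :=
  Quotient.lift (fun T : BasicSilting 𝒯 => SiltGE T.1 A) (by
    rintro T T' ⟨a⟩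
    exact propext (siltGE_iff_of_iso a (Iso.refl A))) q

end Silt

/-- The set of `T` in `silt 𝒯` with `A ≥ T ≥ A[1]`. -/
def twoSilt (A : 𝒯) : Set (Silt 𝒯) :=
  {q | q.LEObj A ∧ q.GEObj (A⟦(1 : ℤ)⟧)}

/-- The set of those `T` in `twoSilt A` with `μ_P⁻(A) ≥ T ≥ A[1]`. -/
def siltMinus (A P : 𝒯) : Set (Silt 𝒯) :=
  {q | q ∈ twoSilt A ∧ ∃ U : 𝒯, IsLeftMutationAt P A U ∧ q.LEObj U}

/-- The set of those `T` in `twoSilt A` with `A ≥ T ≥ μ_{P[1]}⁺(A[1])`. -/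
def siltPlus (A P : 𝒯) : Set (Silt 𝒯) :=
  {q | q ∈ twoSilt A ∧
    ∃ U : 𝒯, IsRightMutationAt (P⟦(1 : ℤ)⟧) (A⟦(1 : ℤ)⟧) U ∧ q.GEObj U}

end Triangulated

/-! ## The bounded homotopy category of an additive category -/

section Bounded

variable (C : Type u) [Category.{v} C] [Preadditive C]

/-- Boundedness of a complex, as a property of objects of the homotopy category. -/
def bounded : ObjectProperty (HomotopyCategory C (ComplexShape.up ℤ)) := fun K =>
  ∃ a b : ℤ, CochainComplex.IsStrictlyGE K.as a ∧ CochainComplex.IsStrictlyLE K.as b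

theorem bounded_quotient_obj_iff (K : CochainComplex C ℤ) :
    bounded C ((HomotopyCategory.quotient _ _).obj K) ↔
      ∃ a b : ℤ, K.IsStrictlyGE a ∧ K.IsStrictlyLE b := Iff.rfl

variable [HasZeroObject C] [HasBinaryBiproducts C]

open ZeroObject

instance : (bounded C).ContainsZero where
  exists_zero :=
    ⟨(HomotopyCategory.quotient _ _).obj 0, Functor.map_isZero _ (isZero_zero _),
      (bounded_quotient_obj_iff C _).2 ⟨0, 0, inferInstance, inferInstance⟩⟩

instance : (bounded C).IsStableUnderShift ℤ where
  isStableUnderShiftBy n :=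
    { le_shift K hK := by
        obtain ⟨K : CochainComplex _ _, rfl⟩ := K.quotient_obj_surjective
        obtain ⟨a, b, ha, hb⟩ := (bounded_quotient_obj_iff C K).1 hK
        rw [ObjectProperty.prop_shift_iff, HomotopyCategory.shift_quotient_obj,
          bounded_quotient_obj_iff]
        exact ⟨a - n, b - n, K.isStrictlyGE_shift a n (a - n) (by lia),
          K.isStrictlyLE_shift b n (b - n) (by lia)⟩ }

set_option linter.unusedSectionVars false in
theorem bounded_mappingCone {K L : CochainComplex C ℤ} (f : K ⟶ L)
    (hK : ∃ a b : ℤ, K.IsStrictlyGE a ∧ K.IsStrictlyLE b)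
    (hL : ∃ a b : ℤ, L.IsStrictlyGE a ∧ L.IsStrictlyLE b) :
    ∃ a b : ℤ, (CochainComplex.mappingCone f).IsStrictlyGE a ∧
      (CochainComplex.mappingCone f).IsStrictlyLE b := by
  obtain ⟨a, b, ha, hb⟩ := hK
  obtain ⟨c, d, hc, hd⟩ := hL
  refine ⟨min (a - 1) c, max b d, ?_, ?_⟩
  · rw [CochainComplex.isStrictlyGE_iff]
    intro i hi
    rw [CochainComplex.mappingCone.isZero_X_iff]
    exact ⟨K.isZero_of_isStrictlyGE a _ (by lia), L.isZero_of_isStrictlyGE c _ (by lia)⟩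
  · rw [CochainComplex.isStrictlyLE_iff]
    intro i hi
    rw [CochainComplex.mappingCone.isZero_X_iff]
    exact ⟨K.isZero_of_isStrictlyLE b _ (by lia), L.isZero_of_isStrictlyLE d _ (by lia)⟩

instance : (bounded C).IsTriangulatedClosed₃ where
  ext₃' T hT h₁ h₂ := by
    obtain ⟨f : T.obj₁.as ⟶ T.obj₂.as, hf⟩ :=
      (HomotopyCategory.quotient _ _).map_surjective T.mor₁
    refine ⟨_, (bounded_quotient_obj_iff C _).2 (bounded_mappingCone C f h₁ h₂),
      ⟨Triangle.π₃.mapIso (isoTriangleOfIso₁₂ T _ hT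
        (HomotopyCategory.mappingCone_triangleh_distinguished f)
        (Iso.refl _) (Iso.refl _) ?_)⟩⟩
    exact (Category.comp_id _).trans (hf.symm.trans (Category.id_comp _).symm)

instance : (bounded C).IsTriangulated where
  toIsTriangulatedClosed₂ := .of_isTriangulatedClosed₃

/-- `K^b(C)`: the homotopy category of bounded cochain complexes in `C`. -/
abbrev Kb := (bounded C).FullSubcategory

/-- An object of `C`, seen as a complex concentrated in degree `0`. -/
noncomputable def stalk (X : C) : Kb C :=
  ⟨(HomotopyCategory.quotient C (ComplexShape.up ℤ)).obj
      ((CochainComplex.singleFunctor C 0).obj X),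
    (bounded_quotient_obj_iff C _).2 ⟨0, 0, inferInstance, inferInstance⟩⟩

end Bounded

/-! ## Finitely generated projective right modules -/

section Modules

variable (Λ : Type w) [Ring Λ]

/-- Finitely generated projective right `Λ`-modules (right modules are `Λᵐᵒᵖ`-modules). -/
def isFGProj : ObjectProperty (ModuleCat.{w} Λᵐᵒᵖ) := fun M =>
  Module.Finite Λᵐᵒᵖ M ∧ Module.Projective Λᵐᵒᵖ M

instance : (isFGProj Λ).IsClosedUnderIsomorphisms where
  of_iso {X Y} e := by
    rintro ⟨h₁, h₂⟩
    exact ⟨Module.Finite.equiv e.toLinearEquiv, Module.Projective.of_equiv e.toLinearEquiv⟩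

instance : (isFGProj Λ).ContainsZero where
  exists_zero := ⟨ModuleCat.of Λᵐᵒᵖ PUnit.{w + 1}, ModuleCat.isZero_of_subsingleton _,
    inferInstanceAs (Module.Finite Λᵐᵒᵖ PUnit.{w + 1}),
    inferInstanceAs (Module.Projective Λᵐᵒᵖ PUnit.{w + 1})⟩

instance : (isFGProj Λ).IsClosedUnderBinaryProducts where
  limitsOfShape_le := by
    rintro X ⟨p⟩
    obtain ⟨h₁, h₁'⟩ := p.prop_diag_obj (.mk .left)
    obtain ⟨h₂, h₂'⟩ := p.prop_diag_obj (.mk .right)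
    let A := p.diag.obj (.mk .left)
    let B := p.diag.obj (.mk .right)
    have hAB : isFGProj Λ (ModuleCat.of Λᵐᵒᵖ (A × B)) :=
      ⟨inferInstanceAs (Module.Finite Λᵐᵒᵖ (A × B)),
        inferInstanceAs (Module.Projective Λᵐᵒᵖ (A × B))⟩
    refine (isFGProj Λ).prop_of_iso ?_ hAB
    exact (ModuleCat.biprodIsoProd A B).symm ≪≫ biprod.isoProd A B ≪≫
      IsLimit.conePointUniqueUpToIso (prodIsProd _ _)
        ((IsLimit.postcomposeHomEquiv (diagramIsoPair p.diag) _).2 p.isLimit)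

instance : (isFGProj Λ).IsClosedUnderFiniteProducts := .mk'

/-- `proj Λ`: the category of finitely generated projective right `Λ`-modules. -/
abbrev ProjCat := (isFGProj Λ).FullSubcategory

instance : HasBinaryBiproducts (ProjCat Λ) := HasBinaryBiproducts.of_hasBinaryProducts

/-- The right module `Λ` is free of rank one. -/
def regularEquiv : Λᵐᵒᵖ ≃ₗ[Λᵐᵒᵖ] Λ where
  toFun := MulOpposite.unop
  invFun := MulOpposite.op
  map_add' _ _ := rfl
  map_smul' _ _ := rfl
  left_inv _ := rfl
  right_inv _ := rfl

theorem isFGProj_regular : isFGProj Λ (ModuleCat.of Λᵐᵒᵖ Λ) :=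
  ⟨Module.Finite.equiv (regularEquiv Λ), Module.Projective.of_equiv (regularEquiv Λ)⟩

/-- `Λ` as a right module over itself. -/
def regularModule : ProjCat Λ := ⟨ModuleCat.of Λᵐᵒᵖ Λ, isFGProj_regular Λ⟩

variable {Λ}

/-- The right ideal `eΛ`. -/
def rightIdeal (e : Λ) : Submodule Λᵐᵒᵖ Λ := Submodule.span Λᵐᵒᵖ {e}

theorem mem_rightIdeal {e x : Λ} : x ∈ rightIdeal e ↔ ∃ y : Λ, x = e * y := by
  rw [rightIdeal, Submodule.mem_span_singleton]
  constructor
  · rintro ⟨a, rfl⟩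
    exact ⟨a.unop, rfl⟩
  · rintro ⟨y, rfl⟩
    exact ⟨MulOpposite.op y, rfl⟩

/-- Left multiplication by `e`, as a map of right modules from `Λ` onto `eΛ`. -/
def toRightIdeal (e : Λ) : Λ →ₗ[Λᵐᵒᵖ] rightIdeal e where
  toFun x := ⟨e * x, mem_rightIdeal.2 ⟨x, rfl⟩⟩
  map_add' x y := Subtype.ext (mul_add e x y)
  map_smul' a x := Subtype.ext (mul_assoc e x a.unop).symm

theorem isFGProj_rightIdeal {e : Λ} (he : IsIdempotentElem e) :
    isFGProj Λ (ModuleCat.of Λᵐᵒᵖ (rightIdeal e)) := by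
  refine ⟨?_, ?_⟩
  · change Module.Finite Λᵐᵒᵖ (rightIdeal e)
    unfold rightIdeal
    infer_instance
  · change Module.Projective Λᵐᵒᵖ (rightIdeal e)
    have : Module.Projective Λᵐᵒᵖ Λ := (isFGProj_regular Λ).2
    refine Module.Projective.of_split (rightIdeal e).subtype (toRightIdeal e) ?_
    ext ⟨x, hx⟩
    obtain ⟨y, rfl⟩ := mem_rightIdeal.1 hx
    change e * (e * y) = e * y
    rw [← mul_assoc, he.eq]

/-- The projective right module `eΛ`, for an idempotent `e`. -/
def idempotentModule (e : Λ) (he : IsIdempotentElem e) : ProjCat Λ :=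
  ⟨ModuleCat.of Λᵐᵒᵖ (rightIdeal e), isFGProj_rightIdeal he⟩

/-- A primitive idempotent: a nonzero idempotent that is not the sum of two nonzero orthogonal
idempotents. -/
structure IsPrimitiveIdempotent (e : Λ) : Prop where
  isIdempotentElem : IsIdempotentElem e
  ne_zero : e ≠ 0
  eq_zero_or_eq_zero : ∀ a b : Λ, IsIdempotentElem a → IsIdempotentElem b →
    a * b = 0 → b * a = 0 → e = a + b → a = 0 ∨ b = 0

variable (Λ)

/-- `𝒦_Λ = K^b(proj Λ)`, the perfect derived category. -/
abbrev PerfCat := Kb (ProjCat Λ)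

/-- `2silt Λ`. -/
noncomputable def twoSiltAlg : Set (Silt (PerfCat Λ)) :=
  twoSilt (stalk (ProjCat Λ) (regularModule Λ))

variable {Λ}

/-- `𝒯⁻_P` for a finitely generated projective right module `P`. -/
noncomputable def TMinus (P : ProjCat Λ) : Set (Silt (PerfCat Λ)) :=
  siltMinus (stalk (ProjCat Λ) (regularModule Λ)) (stalk (ProjCat Λ) P)

/-- `𝒯⁺_P` for a finitely generated projective right module `P`. -/
noncomputable def TPlus (P : ProjCat Λ) : Set (Silt (PerfCat Λ)) :=
  siltPlus (stalk (ProjCat Λ) (regularModule Λ)) (stalk (ProjCat Λ) P)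

end Modules

/-- The element `(1/|E|) ∑_{g ∈ E} g` of the group algebra `KG`. -/
noncomputable def subgroupAverage (K : Type u) [Field K] {G : Type v} [Group G]
    (E : Subgroup G) : MonoidAlgebra K G :=
  (Nat.card E : K)⁻¹ • ∑ᶠ g : E, MonoidAlgebra.single (g : G) (1 : K)

end Silting

open CategoryTheory CategoryTheory.Limits CategoryTheory.Pretriangulated Cardinal

namespace Silting

universe v u w v' u'

set_option linter.unusedSectionVars false

/-! ### Direct summands and `add M`, expressed by identities between morphisms -/

section Additive

variable {C : Type u} [Category.{v} C] [Preadditive C]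

/-! Write A for Λ and P for eΛ. A two-term silting object T is the cone of a map V ⟶ Q in add A that
is radical with respect to P (`exists_isPresentation`). The left mutation of A at P lies above T
exactly when P is not a summand of Q (`IsPresentation.exists_isLeftMutationAt_iff`). Rigidity of T
keeps P from occurring in both V and Q (`IsPresentation.not_splits_or_not_splits`). Generation keeps
it from being absent from both, since T would then be orthogonal to the simple top of P
(`IsPresentation.splits_or_splits`). Hence P occurs in exactly one of the two terms.

The involution g ↦ g⁻¹ turns Hom(-, Λ) into a contravariant self-duality F of the perfect derived
category with FA ≅ A and FP ≅ P. Composed with [1], it reverses the order on silting objects,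
preserves the two-term ones, exchanges 𝒯⁻ and 𝒯⁺, and replaces the presentation V ⟶ Q by FQ ⟶ FV. So
T lies in 𝒯⁺ exactly when P is not a summand of V, and the two-term silting objects are the disjoint
union of two sets of the same cardinality (`nonempty_orderIso_and_mk_twoSilt`).

Besides being fixed by the involution, e is used only through `IsLocalIdempotent`: with ε the
augmentation, ε(e) = 1 and exe is nilpotent whenever ε(x) = 0. This makes End(eΛ) local, makes eΛ
occur only once in Λ, and gives it the simple top Λ/ker ε. For the group algebra, corner elements
exe are rewritten as e times an E-averaged element of KD (`isLocalIdempotent_subgroupAverage`),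
which reduces the nilpotency to the fact that the augmentation ideal of a p-group algebra in
characteristic p is nil (`isNilpotent_of_isPGroup`). -/

theorem nonempty_iso_biprod_iff [HasBinaryBiproducts C] {T X M : C} :
    Nonempty (T ≅ X ⊞ M) ↔ ∃ (i₁ : X ⟶ T) (p₁ : T ⟶ X) (i₂ : M ⟶ T) (p₂ : T ⟶ M),
      i₁ ≫ p₁ = 𝟙 X ∧ i₂ ≫ p₂ = 𝟙 M ∧ p₁ ≫ i₁ + p₂ ≫ i₂ = 𝟙 T := by
  constructor
  · rintro ⟨e⟩
    refine ⟨biprod.inl ≫ e.inv, e.hom ≫ biprod.fst, biprod.inr ≫ e.inv, e.hom ≫ biprod.snd,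
      by simp, by simp, ?_⟩
    have h : e.hom ≫ (biprod.fst ≫ biprod.inl + biprod.snd ≫ biprod.inr) ≫ e.inv = 𝟙 T := by
      simp
    simpa only [Preadditive.add_comp, Preadditive.comp_add, Category.assoc] using h
  · rintro ⟨i₁, p₁, i₂, p₂, h₁, h₂, h⟩
    -- Sandwiching the decomposition of the identity between `i₁` and `p₂` makes the cross term
    -- equal to twice itself.
    have h₁₂ : i₁ ≫ p₂ = 0 := by
      have := i₁ ≫= h =≫ p₂
      simpa [reassoc_of% h₁, h₂] using this
    have h₂₁ : i₂ ≫ p₁ = 0 := by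
      have := i₂ ≫= h =≫ p₁
      simpa [reassoc_of% h₂, h₁] using this
    exact ⟨{ hom := biprod.lift p₁ p₂
             inv := biprod.desc i₁ i₂
             hom_inv_id := by simpa using h
             inv_hom_id := by
              ext <;> simp [h₁, h₂, h₁₂, h₂₁] }⟩

end Additive

section Summands

variable {𝒯 : Type u} [Category.{v} 𝒯] [HasZeroObject 𝒯] [HasShift 𝒯 ℤ] [Preadditive 𝒯]
  [∀ n : ℤ, (shiftFunctor 𝒯 n).Additive] [Pretriangulated 𝒯]

/-- Complete the split monomorphism to a triangle: the connecting map is killed by the split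
monomorphism `i[1]`, hence is zero, and a triangle with zero connecting map is a biproduct. -/
theorem exists_complement {X Q : 𝒯} (i : X ⟶ Q) (r : Q ⟶ X) (h : i ≫ r = 𝟙 X) :
    ∃ Y : 𝒯, Nonempty (Q ≅ X ⊞ Y) := by
  obtain ⟨Y, g, k, hT⟩ := distinguished_cocone_triangle i
  have hk : k = 0 := by
    have h0 : k ≫ i⟦(1 : ℤ)⟧' = 0 := comp_distTriang_mor_zero₃₁ _ hT
    have h1 : i⟦(1 : ℤ)⟧' ≫ r⟦(1 : ℤ)⟧' = 𝟙 _ := by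
      rw [← Functor.map_comp, h, CategoryTheory.Functor.map_id]
    calc k = k ≫ i⟦(1 : ℤ)⟧' ≫ r⟦(1 : ℤ)⟧' := by rw [h1, Category.comp_id]
      _ = 0 := by rw [reassoc_of% h0, zero_comp]
  obtain ⟨e, -, -⟩ := exists_iso_binaryBiproduct_of_distTriang _ hT hk
  exact ⟨Y, ⟨e⟩⟩

/-- Membership in `add M`, as a decomposition of the identity. -/
theorem inAdd_iff {M X : 𝒯} : InAdd M X ↔
    ∃ (n : ℕ) (a : Fin n → (X ⟶ M)) (b : Fin n → (M ⟶ X)), ∑ i, a i ≫ b i = 𝟙 X := by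
  constructor
  · rintro ⟨n, Y, ⟨e⟩⟩
    refine ⟨n, fun i => biprod.inl ≫ e.hom ≫ biproduct.π _ i,
      fun i => biproduct.ι (fun _ : Fin n => M) i ≫ e.inv ≫ biprod.fst, ?_⟩
    have h := (biprod.inl ≫ e.hom) ≫= (biproduct.total (f := fun _ : Fin n => M))
      =≫ (e.inv ≫ biprod.fst)
    rw [Preadditive.sum_comp, Preadditive.comp_sum] at h
    simpa only [Category.assoc, Category.id_comp, e.hom_inv_id_assoc, biprod.inl_fst] using h
  · rintro ⟨n, a, b, h⟩
    obtain ⟨Y, ⟨e⟩⟩ := exists_complement (biproduct.lift a : X ⟶ ⨁ fun _ : Fin n => M)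
      (biproduct.desc b) (by rw [biproduct.lift_desc, h])
    exact ⟨n, Y, ⟨e.symm⟩⟩

theorem inAdd_of_sum {ι : Type*} (s : Finset ι) {M X : 𝒯} (a : ι → (X ⟶ M)) (b : ι → (M ⟶ X))
    (h : ∑ i ∈ s, a i ≫ b i = 𝟙 X) : InAdd M X := by
  rw [inAdd_iff]
  refine ⟨s.card, fun i => a (s.equivFin.symm i), fun i => b (s.equivFin.symm i), ?_⟩
  rw [← h, ← Finset.sum_coe_sort s]
  exact Equiv.sum_comp s.equivFin.symm (fun i : s => a i ≫ b i)

theorem InAdd.of_retract {M X Y : 𝒯} (h : InAdd M Y) (i : X ⟶ Y) (r : Y ⟶ X) (hir : i ≫ r = 𝟙 X) :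
    InAdd M X := by
  obtain ⟨n, a, b, hab⟩ := inAdd_iff.1 h
  refine inAdd_iff.2 ⟨n, fun j => i ≫ a j, fun j => b j ≫ r, ?_⟩
  have := i ≫= hab =≫ r
  simpa [Preadditive.comp_sum, Preadditive.sum_comp, hir] using this

theorem inAdd_self (M : 𝒯) : InAdd M M :=
  inAdd_iff.2 ⟨1, fun _ => 𝟙 M, fun _ => 𝟙 M, by simp⟩

theorem inAdd_of_retract {X Y : 𝒯} (i : X ⟶ Y) (r : Y ⟶ X) (hir : i ≫ r = 𝟙 X) : InAdd Y X :=
  (inAdd_self Y).of_retract i r hir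

theorem InAdd.trans {M N X : 𝒯} (h : InAdd M N) (h' : InAdd N X) : InAdd M X := by
  obtain ⟨n, a, b, hab⟩ := inAdd_iff.1 h
  obtain ⟨m, c, d, hcd⟩ := inAdd_iff.1 h'
  refine inAdd_of_sum Finset.univ (fun j : Fin m × Fin n => c j.1 ≫ a j.2)
    (fun j => b j.2 ≫ d j.1) ?_
  rw [Fintype.sum_prod_type, ← hcd]
  refine Finset.sum_congr rfl fun i _ => ?_
  have := c i ≫= hab =≫ d i
  simpa [Preadditive.comp_sum, Preadditive.sum_comp] using this

theorem InAdd.of_iso {M N X Y : 𝒯} (h : InAdd M X) (e : M ≅ N) (e' : X ≅ Y) : InAdd N Y :=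
  ((inAdd_of_retract e.hom e.inv (by simp)).trans h).trans
    (inAdd_of_retract e'.inv e'.hom (by simp))

end Summands

/-! ### Vanishing of Hom(W, X[n]) and its propagation along triangles -/

section HomVanish

variable {𝒯 : Type u} [Category.{v} 𝒯] [HasZeroObject 𝒯] [HasShift 𝒯 ℤ] [Preadditive 𝒯]
  [∀ n : ℤ, (shiftFunctor 𝒯 n).Additive] [Pretriangulated 𝒯]

/-- `Hom(W, X[n]) = 0`. -/
def HomVanish (W X : 𝒯) (n : ℤ) : Prop := ∀ f : W ⟶ X⟦n⟧, f = 0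

set_option linter.unusedSectionVars false in
theorem HomVanish.of_iso {W W' X X' : 𝒯} {n : ℤ} (h : HomVanish W X n) (a : W ≅ W') (b : X ≅ X') :
    HomVanish W' X' n := by
  intro f
  have h0 := h (a.hom ≫ f ≫ (shiftFunctor 𝒯 n).map b.inv)
  have h1 : f ≫ (shiftFunctor 𝒯 n).map b.inv = 0 := by
    rw [← cancel_epi a.hom, h0, comp_zero]
  rw [← cancel_mono ((shiftFunctor 𝒯 n).map b.inv), h1, zero_comp]

set_option linter.unusedSectionVars false in
theorem homVanish_zero {W X : 𝒯} : HomVanish W X 0 ↔ ∀ f : W ⟶ X, f = 0 := by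
  let e := (shiftFunctorZero 𝒯 ℤ).app X
  constructor
  · intro h f
    have := h (f ≫ e.inv)
    simpa using this =≫ e.hom
  · intro h f
    have := h (f ≫ e.hom)
    simpa using this =≫ e.inv

set_option linter.unusedSectionVars false in
theorem homVanish_shift_right {W X : 𝒯} {m n k : ℤ} (hk : m + n = k) :
    HomVanish W (X⟦m⟧) n ↔ HomVanish W X k := by
  let e := (shiftFunctorAdd' 𝒯 m n k hk).app X
  constructor
  · intro h f
    have := h (f ≫ e.hom)
    simpa using this =≫ e.inv
  · intro h f
    have := h (f ≫ e.inv)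
    simpa using this =≫ e.hom

set_option linter.unusedSectionVars false in
theorem homVanish_shift_both {W X : 𝒯} {m n : ℤ} :
    HomVanish (W⟦m⟧) (X⟦m⟧) n ↔ HomVanish W X n := by
  rw [homVanish_shift_right rfl, ← homVanish_shift_right (add_comm n m)]
  constructor
  · intro h f
    exact (Functor.map_eq_zero_iff (shiftFunctor 𝒯 m)).1 (h (f⟦m⟧'))
  · intro h f
    obtain ⟨g, rfl⟩ := (shiftFunctor 𝒯 m).map_surjective f
    rw [h g, Functor.map_zero]

theorem homVanish_shift_left {W X : 𝒯} {m n k : ℤ} (hk : m + k = n) :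
    HomVanish (W⟦m⟧) X n ↔ HomVanish W X k := by
  have e : X ≅ (X⟦-m⟧)⟦m⟧ := ((shiftFunctorCompIsoId 𝒯 (-m) m (by simp)).app X).symm
  have h : HomVanish (W⟦m⟧) X n ↔ HomVanish (W⟦m⟧) ((X⟦-m⟧)⟦m⟧) n :=
    ⟨fun h => h.of_iso (Iso.refl _) e, fun h => h.of_iso (Iso.refl _) e.symm⟩
  rw [h, homVanish_shift_both, homVanish_shift_right (show -m + n = k by lia)]

theorem HomVanish.inAdd_left {A W X : 𝒯} {n : ℤ} (h : HomVanish A X n) (hW : InAdd A W) :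
    HomVanish W X n := by
  obtain ⟨m, a, b, hab⟩ := inAdd_iff.1 hW
  intro f
  have := hab =≫ f
  rw [Category.id_comp, Preadditive.sum_comp] at this
  rw [← this]
  exact Finset.sum_eq_zero fun i _ => by rw [Category.assoc, h (b i ≫ f), comp_zero]

theorem HomVanish.inAdd_right {A W X : 𝒯} {n : ℤ} (h : HomVanish W A n) (hX : InAdd A X) :
    HomVanish W X n := by
  obtain ⟨m, a, b, hab⟩ := inAdd_iff.1 hX
  intro f
  have := f ≫= congrArg (fun g => g⟦n⟧') hab
  rw [CategoryTheory.Functor.map_id, Category.comp_id, Functor.map_sum, Preadditive.comp_sum] at this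
  rw [← this]
  exact Finset.sum_eq_zero fun i _ => by
    rw [Functor.map_comp, ← Category.assoc, h (f ≫ (a i)⟦n⟧'), zero_comp]

theorem SiltGE.inAdd_left {A W X : 𝒯} (h : SiltGE A X) (hW : InAdd A W) : SiltGE W X :=
  fun i hi => HomVanish.inAdd_left (h i hi) hW

theorem SiltGE.inAdd_right {A W X : 𝒯} (h : SiltGE W A) (hX : InAdd A X) : SiltGE W X :=
  fun i hi => HomVanish.inAdd_right (h i hi) hX

/-- The morphisms of the n-fold shifted triangle carry the sign (-1)ⁿ, which is absorbed into the
lift `y`. -/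
theorem coyoneda_shift_exact₂ {X Y Z : 𝒯} {f : X ⟶ Y} {g : Y ⟶ Z}
    {h : Z ⟶ X⟦(1 : ℤ)⟧} (hT : Triangle.mk f g h ∈ distTriang 𝒯) {W : 𝒯} (n : ℤ) (x : W ⟶ Y⟦n⟧) (hx : x ≫ g⟦n⟧' = 0) :
    ∃ y : W ⟶ X⟦n⟧, x = y ≫ f⟦n⟧' := by
  obtain ⟨(y : W ⟶ X⟦n⟧), hy⟩ := Triangle.coyoneda_exact₂ _
    (Triangle.shift_distinguished _ hT n) x (by
      change x ≫ (n.negOnePow • g⟦n⟧') = 0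
      rw [Linear.comp_units_smul, hx, smul_zero])
  refine ⟨n.negOnePow • y, ?_⟩
  rw [hy]
  change y ≫ (n.negOnePow • f⟦n⟧') = (n.negOnePow • y : W ⟶ X⟦n⟧) ≫ f⟦n⟧'
  rw [Linear.comp_units_smul, Linear.units_smul_comp]

/-- This and the next four lemmas are pieces of the long exact sequences for Hom(W, -) and Hom(-,
W); the subscript names the vertex of the triangle at which vanishing is deduced. -/
theorem homVanish_cov₂ {X Y Z : 𝒯} {f : X ⟶ Y} {g : Y ⟶ Z}
    {h : Z ⟶ X⟦(1 : ℤ)⟧} (hT : Triangle.mk f g h ∈ distTriang 𝒯) {W : 𝒯} {n : ℤ} (h₁ : HomVanish W X n) (h₃ : HomVanish W Z n) :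
    HomVanish W Y n := by
  intro x
  obtain ⟨y, rfl⟩ := coyoneda_shift_exact₂ hT n x (h₃ _)
  rw [h₁ y, zero_comp]

theorem homVanish_cov₃ {X Y Z : 𝒯} {f : X ⟶ Y} {g : Y ⟶ Z}
    {h : Z ⟶ X⟦(1 : ℤ)⟧} (hT : Triangle.mk f g h ∈ distTriang 𝒯) {W : 𝒯} {n m : ℤ} (hm : n + 1 = m) (h₁ : HomVanish W X m)
    (h₂ : HomVanish W Y n) : HomVanish W Z n :=
  homVanish_cov₂ (rot_of_distTriang _ hT) h₂ ((homVanish_shift_right (by lia)).2 h₁)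

theorem homVanish_contra₂ {X Y Z : 𝒯} {f : X ⟶ Y} {g : Y ⟶ Z}
    {h : Z ⟶ X⟦(1 : ℤ)⟧} (hT : Triangle.mk f g h ∈ distTriang 𝒯) {W : 𝒯} {n : ℤ} (h₁ : HomVanish X W n) (h₃ : HomVanish Z W n) :
    HomVanish Y W n := by
  intro x
  obtain ⟨y, rfl⟩ := Triangle.yoneda_exact₂ _ hT x (h₁ _)
  exact (congrArg _ (h₃ y)).trans comp_zero

theorem homVanish_contra₃ {X Y Z : 𝒯} {f : X ⟶ Y} {g : Y ⟶ Z}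
    {h : Z ⟶ X⟦(1 : ℤ)⟧} (hT : Triangle.mk f g h ∈ distTriang 𝒯) {W : 𝒯} {n m : ℤ} (hm : m + 1 = n) (h₁ : HomVanish X W m)
    (h₂ : HomVanish Y W n) : HomVanish Z W n :=
  homVanish_contra₂ (rot_of_distTriang _ hT) h₂ ((homVanish_shift_left (by lia)).2 h₁)

theorem homVanish_contra₁ {X Y Z : 𝒯} {f : X ⟶ Y} {g : Y ⟶ Z}
    {h : Z ⟶ X⟦(1 : ℤ)⟧} (hT : Triangle.mk f g h ∈ distTriang 𝒯) {W : 𝒯} {n m : ℤ} (hm : n + 1 = m) (h₂ : HomVanish Y W n)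
    (h₃ : HomVanish Z W m) : HomVanish X W n := by
  rw [← homVanish_shift_left (show (1 : ℤ) + n = m by lia)]
  exact homVanish_contra₂ (rot_of_distTriang _ (rot_of_distTriang _ hT)) h₃
    ((homVanish_shift_left (show (1 : ℤ) + n = m by lia)).2 h₂)

end HomVanish

/-! ### Objects with local endomorphism ring -/

section LocalEnd

variable {C : Type u} [Category.{v} C] [Preadditive C]

/-- The endomorphism ring of `P` is local. -/
structure IsLocalEnd (P : C) : Prop where
  id_ne_zero : 𝟙 P ≠ 0
  isIso_or_isIso : ∀ x y : P ⟶ P, x + y = 𝟙 P → IsIso x ∨ IsIso y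

/-- Some composition `P ⟶ Q ⟶ P` is an isomorphism, so that `P` is a direct summand of `Q`. -/
def Splits (P Q : C) : Prop := ∃ (a : P ⟶ Q) (b : Q ⟶ P), IsIso (a ≫ b)

theorem IsLocalEnd.of_isIso_add {P : C} (hP : IsLocalEnd P) {x y : P ⟶ P} (h : IsIso (x + y)) :
    IsIso x ∨ IsIso y := by
  have h1 : x ≫ inv (x + y) + y ≫ inv (x + y) = 𝟙 P := by
    rw [← Preadditive.add_comp, IsIso.hom_inv_id]
  rcases hP.isIso_or_isIso _ _ h1 with h2 | h2
  · exact Or.inl (IsIso.of_isIso_comp_right x (inv (x + y)))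
  · exact Or.inr (IsIso.of_isIso_comp_right y (inv (x + y)))

theorem IsLocalEnd.not_isIso_zero {P : C} (hP : IsLocalEnd P) : ¬ IsIso (0 : P ⟶ P) := fun h =>
  hP.id_ne_zero (by rw [← IsIso.hom_inv_id (0 : P ⟶ P), zero_comp])

theorem IsLocalEnd.isIso_id_sub {P : C} (hP : IsLocalEnd P) {x : P ⟶ P} (h : ¬ IsIso x) :
    IsIso (𝟙 P - x) :=
  (hP.isIso_or_isIso x (𝟙 P - x) (by abel)).resolve_left h

/-- If θ inverts 1 - bc, then 1 + cθb inverts 1 - cb. This moves invertibility from the local object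
to any object it maps to and from. -/
theorem isIso_id_sub_comp {P Q : C} (c : Q ⟶ P) (b : P ⟶ Q) (h : IsIso (𝟙 P - b ≫ c)) :
    IsIso (𝟙 Q - c ≫ b) := by
  obtain ⟨θ, h₁, h₂⟩ := h
  simp only [Preadditive.sub_comp, Preadditive.comp_sub, Category.id_comp, Category.comp_id,
    Category.assoc] at h₁ h₂
  have h₁' : b ≫ c ≫ θ = θ - 𝟙 P := by rw [← h₁]; abel
  have h₂' : θ ≫ b ≫ c = θ - 𝟙 P := by rw [← h₂]; abel
  refine ⟨𝟙 Q + c ≫ θ ≫ b, ?_, ?_⟩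
  · have : b ≫ c ≫ θ ≫ b = θ ≫ b - b := by
      have := h₁' =≫ b
      simpa [Preadditive.sub_comp] using this
    simp only [Preadditive.sub_comp, Preadditive.comp_add, Category.id_comp, Category.comp_id,
      Category.assoc, this, Preadditive.comp_sub]
    abel
  · have : θ ≫ b ≫ c ≫ b = θ ≫ b - b := by
      have := h₂' =≫ b
      simpa [Preadditive.sub_comp] using this
    simp only [Preadditive.add_comp, Preadditive.comp_sub, Category.id_comp, Category.comp_id,
      Category.assoc, this]
    abel

/-- Endomorphisms of `Q` that factor through copies of `P` lie in the radical unless `P` splits off.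
The terms are removed one at a time: each composite `P ⟶ Q ⟶ P` is a non-isomorphism, so 1 minus it
is invertible. -/
theorem IsLocalEnd.isIso_id_sub_sum {P Q : C} (hP : IsLocalEnd P) (hQ : ¬ Splits P Q)
    {ι : Type*} (s : Finset ι) (c : ι → (Q ⟶ P)) (b : ι → (P ⟶ Q)) :
    IsIso (𝟙 Q - ∑ i ∈ s, c i ≫ b i) := by
  classical
  induction s using Finset.induction_on with
  | empty => simpa using (inferInstance : IsIso (𝟙 Q))
  | insert j s hj ih =>
    set u := 𝟙 Q - ∑ i ∈ s, c i ≫ b i with hu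
    have h1 : 𝟙 Q - ∑ i ∈ insert j s, c i ≫ b i = u ≫ (𝟙 Q - (inv u ≫ c j) ≫ b j) := by
      rw [Finset.sum_insert hj, Preadditive.comp_sub]
      simp only [Category.comp_id, Category.assoc, IsIso.hom_inv_id_assoc]
      rw [sub_add_eq_sub_sub_swap, ← hu]
    have h2 : IsIso (𝟙 Q - (inv u ≫ c j) ≫ b j) :=
      isIso_id_sub_comp _ _ (hP.isIso_id_sub fun h => hQ ⟨_, _, h⟩)
    rw [h1]
    infer_instance

end LocalEnd

section

variable {𝒯 : Type u} [Category.{v} 𝒯] [HasZeroObject 𝒯] [HasShift 𝒯 ℤ] [Preadditive 𝒯]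
  [∀ n : ℤ, (shiftFunctor 𝒯 n).Additive] [Pretriangulated 𝒯]

theorem Splits.inAdd {P Q : 𝒯} (h : Splits P Q) : InAdd Q P := by
  obtain ⟨a, b, h⟩ := h
  exact inAdd_of_retract a (b ≫ inv (a ≫ b)) (by rw [← Category.assoc, IsIso.hom_inv_id])

/-- An object of `add (P ⊕ M)` that does not have `P` as a direct summand lies in `add M`. -/
theorem IsLocalEnd.inAdd_of_not_splits {P M A Q : 𝒯} (hP : IsLocalEnd P)
    (hA : Nonempty (A ≅ P ⊞ M)) (hQA : InAdd A Q) (hQ : ¬ Splits P Q) : InAdd M Q := by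
  obtain ⟨i₁, p₁, i₂, p₂, -, -, h⟩ := nonempty_iso_biprod_iff.1 hA
  obtain ⟨n, a, b, hab⟩ := inAdd_iff.1 hQA
  -- Each passage through `A` splits into a part through `P` and a part through `M`. The first part
  -- is radical, so the second is an automorphism of `Q` factoring through copies of `M`.
  have key : ∑ i, (a i ≫ p₂) ≫ (i₂ ≫ b i) = 𝟙 Q - ∑ i, (a i ≫ p₁) ≫ (i₁ ≫ b i) := by
    rw [← hab, eq_sub_iff_add_eq, ← Finset.sum_add_distrib]
    refine Finset.sum_congr rfl fun i _ => ?_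
    have := a i ≫= h =≫ b i
    simp only [Preadditive.add_comp, Preadditive.comp_add, Category.id_comp, Category.assoc]
      at this ⊢
    rw [← this, add_comm]
  have hiso : IsIso (∑ i, (a i ≫ p₂) ≫ (i₂ ≫ b i)) := by
    rw [key]
    exact hP.isIso_id_sub_sum hQ _ _ _
  refine inAdd_iff.2 ⟨n, fun i => inv (∑ i, (a i ≫ p₂) ≫ (i₂ ≫ b i)) ≫ a i ≫ p₂,
    fun i => i₂ ≫ b i, ?_⟩
  rw [← IsIso.inv_hom_id (∑ i, (a i ≫ p₂) ≫ (i₂ ≫ b i)), Preadditive.comp_sum]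
  simp only [Category.assoc]

end

/-! ### Radical two-term presentations -/

section Presentation

variable {𝒯 : Type u} [Category.{v} 𝒯] [HasZeroObject 𝒯] [HasShift 𝒯 ℤ] [Preadditive 𝒯]
  [∀ n : ℤ, (shiftFunctor 𝒯 n).Additive] [Pretriangulated 𝒯]

/-- A triangle `V ⟶ Q ⟶ T ⟶ V[1]` with `V` and `Q` in `add A`, and such that no composition
`P ⟶ V ⟶ Q ⟶ P` is an isomorphism. -/
structure IsPresentation (A P : 𝒯) {V Q T : 𝒯} (d : V ⟶ Q) (q : Q ⟶ T)
    (δ : T ⟶ V⟦(1 : ℤ)⟧) : Prop where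
  mem_distTriang : Triangle.mk d q δ ∈ distTriang 𝒯
  left_mem : InAdd A V
  right_mem : InAdd A Q
  radical : ∀ (a : P ⟶ V) (b : Q ⟶ P), ¬ IsIso (a ≫ d ≫ b)

/-- If `a ≫ d ≫ b` were invertible, u = 1 - b(adb)⁻¹ad would satisfy uq = q, hence be an isomorphism
by minimality; but ub = 0, so b = 0. -/
theorem IsMinRightApprox.not_isIso {A P V Q T : 𝒯} (hP : IsLocalEnd P) {d : V ⟶ Q} {q : Q ⟶ T}
    (hdq : d ≫ q = 0) (hq : IsMinRightApprox A q) (a : P ⟶ V) (b : Q ⟶ P) :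
    ¬ IsIso (a ≫ d ≫ b) := by
  intro h
  have hu := hq.minimal (𝟙 Q - b ≫ inv (a ≫ d ≫ b) ≫ a ≫ d) (by
    simp [Preadditive.sub_comp, hdq])
  have h0 : (𝟙 Q - b ≫ inv (a ≫ d ≫ b) ≫ a ≫ d) ≫ b = 0 := by
    simp [Preadditive.sub_comp]
  have hb : b = 0 := by
    rw [← cancel_epi (𝟙 Q - b ≫ inv (a ≫ d ≫ b) ≫ a ≫ d), h0, comp_zero]
  exact hP.not_isIso_zero (by simpa [hb] using h)

/-- The objects `V` with `Hom(V, Z[N]) = 0` for `N` large, uniformly in the objects `Z` with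
`Hom(A, Z[i]) = 0` for `i > 0`. -/
def eventuallyOrthogonal (A : 𝒯) : ObjectProperty 𝒯 := fun V =>
  ∃ N₀ : ℤ, ∀ N : ℤ, N₀ ≤ N → ∀ Z : 𝒯, SiltGE A Z → HomVanish V Z N

set_option linter.unusedSectionVars false in
theorem eventuallyOrthogonal_self (A : 𝒯) : eventuallyOrthogonal A A :=
  ⟨1, fun N hN _ hZ => hZ N (by lia)⟩

instance (A : 𝒯) : (eventuallyOrthogonal A).IsStableUnderRetracts where
  of_retract := by
    rintro X Y h ⟨N₀, hN⟩
    exact ⟨N₀, fun N hN' Z hZ => (hN N hN' Z hZ).inAdd_left (inAdd_of_retract h.i h.r h.retract)⟩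

instance (A : 𝒯) : (eventuallyOrthogonal A).IsClosedUnderIsomorphisms where
  of_iso := by
    rintro X Y e ⟨N₀, hN⟩
    exact ⟨N₀, fun N hN' Z hZ => (hN N hN' Z hZ).of_iso e (Iso.refl _)⟩

open ZeroObject in
instance (A : 𝒯) : (eventuallyOrthogonal A).IsTriangulated where
  exists_zero := ⟨0, isZero_zero _, 0, fun _ _ _ _ f => (isZero_zero 𝒯).eq_of_src f 0⟩
  isStableUnderShiftBy n :=
    { le_shift := by
        rintro X ⟨N₀, hN⟩
        exact ⟨N₀ + n, fun N hN' Z hZ =>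
          (homVanish_shift_left (show n + (N - n) = N by lia)).2 (hN (N - n) (by lia) Z hZ)⟩ }
  toIsTriangulatedClosed₂ := .mk' fun T hT h₁ h₃ => by
    obtain ⟨N₁, h₁⟩ := h₁
    obtain ⟨N₃, h₃⟩ := h₃
    exact ⟨max N₁ N₃, fun N hN Z hZ => homVanish_contra₂ hT (h₁ N (by lia) Z hZ)
      (h₃ N (by lia) Z hZ)⟩

/-- For i = 1 the approximation makes Hom(A, Q) ⟶ Hom(A, Z) surjective, so every map A ⟶ Z₁[1]
vanishes; for i > 1 the long exact sequence suffices. This allows approximations to be iterated. -/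
theorem SiltGE.cocone {A Z₁ Q Z : 𝒯} (hA : SiltGE A A) {d : Z₁ ⟶ Q} {q : Q ⟶ Z}
    {δ : Z ⟶ Z₁⟦(1 : ℤ)⟧} (hT : Triangle.mk d q δ ∈ distTriang 𝒯) (hq : IsMinRightApprox A q)
    (hZ : SiltGE A Z) : SiltGE A Z₁ := by
  intro i hi
  have hQ : HomVanish A Q i := (hA.inAdd_right hq.mem) i hi
  rcases eq_or_ne i 1 with rfl | hi1
  · intro x
    obtain ⟨y, rfl⟩ := Triangle.coyoneda_exact₁ _ hT x (hQ _)
    change A ⟶ Z at y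
    obtain ⟨k, rfl⟩ := hq.factors A (inAdd_self A) y
    have : q ≫ δ = 0 := comp_distTriang_mor_zero₂₃ _ hT
    change (k ≫ q) ≫ δ = 0
    rw [Category.assoc, this, comp_zero]
  · have h1 : HomVanish A Z (i - 1) := hZ _ (by lia)
    have h2 : HomVanish A (Z⟦(-1 : ℤ)⟧) i := (homVanish_shift_right (by lia)).2 h1
    exact homVanish_cov₂ (inv_rot_of_distTriang _ hT) h2 hQ

/-- Dimension shifting: for N > 0, Hom(V, Q[N]) = 0 embeds Hom(V, Z[N]) into Hom(V, Z₁[N+1]), where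
Z₁ is the cocone of an approximation Q ⟶ Z. Generation by `A` makes these groups vanish for large N,
uniformly in Z, which is needed because Z changes at each step. With N = 1 and Z₁ the cocone of an
approximation of V itself, that approximation splits. -/
theorem inAdd_of_siltGE {A : 𝒯} (hA : SiltGE A A)
    (happ : ∀ T : 𝒯, ∃ (Q : 𝒯) (q : Q ⟶ T), IsMinRightApprox A q)
    (hgen : (ObjectProperty.singleton A).IsClassicalTriangulatedGenerator)
    {V : 𝒯} (h₁ : SiltGE A V) (h₂ : SiltGE V A) : InAdd A V := by
  have hV : eventuallyOrthogonal A V := by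
    have h := (ObjectProperty.triangEnvelope_le_iff (P := ObjectProperty.singleton A)
      (Q := eventuallyOrthogonal A)).2 (by
        rw [ObjectProperty.singleton_le_iff]
        exact eventuallyOrthogonal_self A)
    rw [(ObjectProperty.isClassicalTriangulatedGenerator_iff _).1 hgen] at h
    exact h V trivial
  obtain ⟨N₀, hN₀⟩ := hV
  -- Descending induction on N: `k` bounds the distance from N up to the range where vanishing is
  -- known.
  have key : ∀ (k : ℕ) (N : ℤ), 1 ≤ N → N₀ ≤ N + k → ∀ Z : 𝒯, SiltGE A Z → HomVanish V Z N := by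
    intro k
    induction k with
    | zero => exact fun N _ hN Z hZ => hN₀ N (by simpa using hN) Z hZ
    | succ k ih =>
      intro N hN hNk Z hZ
      obtain ⟨Q, q, hq⟩ := happ Z
      obtain ⟨Z₁, d, δ, hT⟩ := distinguished_cocone_triangle₁ q
      exact homVanish_cov₃ hT rfl (ih (N + 1) (by lia) (by push_cast at hNk; lia) Z₁
        (hA.cocone hT hq hZ)) ((h₂.inAdd_right hq.mem) N (by lia))
  obtain ⟨Q, q, hq⟩ := happ V
  obtain ⟨Z₁, d, δ, hT⟩ := distinguished_cocone_triangle₁ q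
  have hδ : δ = 0 := key N₀.toNat 1 le_rfl (by have := Int.self_le_toNat N₀; lia) Z₁
    (hA.cocone hT hq h₁) δ
  obtain ⟨s, hs⟩ := Triangle.coyoneda_exact₃ _ hT (𝟙 V) (by
    change 𝟙 V ≫ δ = 0
    rw [hδ, comp_zero])
  exact hq.mem.of_retract s q hs.symm

/-- The cocone V of a minimal approximation of T is orthogonal to the positive shifts on both sides:
Hom(A, V[i]) = 0 by `SiltGE.cocone`, and Hom(V, A[i]) = 0 because T ≥ A[1]. So `inAdd_of_siltGE`
puts V in add A; minimality gives radicality. -/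
theorem exists_isPresentation {A : 𝒯} (hA : SiltGE A A)
    (happ : ∀ T : 𝒯, ∃ (Q : 𝒯) (q : Q ⟶ T), IsMinRightApprox A q)
    (hgen : (ObjectProperty.singleton A).IsClassicalTriangulatedGenerator) {P : 𝒯}
    (hP : IsLocalEnd P) {T : 𝒯} (h₁ : SiltGE A T) (h₂ : SiltGE T (A⟦(1 : ℤ)⟧)) :
    ∃ (V Q : 𝒯) (d : V ⟶ Q) (q : Q ⟶ T) (δ : T ⟶ V⟦(1 : ℤ)⟧), IsPresentation A P d q δ := by
  obtain ⟨Q, q, hq⟩ := happ T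
  obtain ⟨V, d, δ, hT⟩ := distinguished_cocone_triangle₁ q
  have hV : SiltGE V A := fun i hi => homVanish_contra₁ hT rfl
    ((hA.inAdd_left hq.mem) i hi) ((homVanish_shift_right (by lia)).1 (h₂ i hi))
  exact ⟨V, Q, d, q, δ, hT, inAdd_of_siltGE hA happ hgen (hA.cocone hT hq h₁) hV, hq.mem,
    hq.not_isIso hP (comp_distTriang_mor_zero₁₂ _ hT)⟩

end Presentation

/-! ### Mutation intervals and rigidity read off from presentations -/

section Presentation

variable {𝒯 : Type u} [Category.{v} 𝒯] [HasZeroObject 𝒯] [HasShift 𝒯 ℤ] [Preadditive 𝒯]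
  [∀ n : ℤ, (shiftFunctor 𝒯 n).Additive] [Pretriangulated 𝒯]

/-- If P split off Q, the composite X ⟶ P ⟶ Q ⟶ T would extend along f : X ⟶ M' because Hom(Y, T[1])
= 0. The extension lifts to Q, and the error factors through d. An isomorphism of P becomes a sum of
a map through M', excluded since P is not in add M, and a map through d, excluded by radicality. -/
theorem IsPresentation.not_splits_of_isLeftMutationAt {A P V Q T U : 𝒯} {d : V ⟶ Q} {q : Q ⟶ T}
    {δ : T ⟶ V⟦(1 : ℤ)⟧} (hT : IsPresentation A P d q δ) (hA : SiltGE A A) (hP : IsLocalEnd P)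
    (hPA : Splits P A) (hU : IsLeftMutationAt P A U) (hUT : SiltGE U T) : ¬ Splits P Q := by
  obtain ⟨X, M, ⟨⟨e⟩, -, hMP⟩, M', Y, f, g, h, htri, hf, ⟨eU⟩⟩ := hU
  have hYT : SiltGE Y T := hUT.inAdd_left
    (inAdd_of_retract (biprod.inl ≫ eU.inv) (eU.hom ≫ biprod.fst) (by simp))
  have hMA : InAdd A M := inAdd_of_retract (biprod.inr ≫ e.inv) (e.hom ≫ biprod.snd) (by simp)
  -- A summand of X ⊞ M with local endomorphism ring splits off X or M, and M is excluded.
  have hPX : Splits P X := by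
    obtain ⟨a, b, hab⟩ := hPA
    obtain ⟨i₁, p₁, i₂, p₂, -, -, hip⟩ := nonempty_iso_biprod_iff.1 ⟨e⟩
    have h1 : (a ≫ p₁) ≫ (i₁ ≫ b) + (a ≫ p₂) ≫ (i₂ ≫ b) = a ≫ b := by
      have := a ≫= hip =≫ b
      simpa only [Preadditive.add_comp, Preadditive.comp_add, Category.assoc, Category.id_comp]
        using this
    rcases hP.of_isIso_add (h1 ▸ hab) with h2 | h2
    · exact ⟨_, _, h2⟩
    · exact absurd (Splits.inAdd ⟨_, _, h2⟩) hMP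
  rintro ⟨s, r, hsr⟩
  obtain ⟨a, b, hab⟩ := hPX
  have hfac : ∃ k : M' ⟶ T, (b ≫ s ≫ q) = f ≫ k := by
    have hy : h ≫ (b ≫ s ≫ q)⟦(1 : ℤ)⟧' = 0 := hYT 1 one_pos _
    obtain ⟨k, hk⟩ := Triangle.yoneda_exact₂ _ (inv_rot_of_distTriang _ htri) (b ≫ s ≫ q) (by
      apply (shiftFunctor 𝒯 (1 : ℤ)).map_injective
      rw [Functor.map_zero, Functor.map_comp]
      change ((-(h⟦(-1 : ℤ)⟧' ≫ (shiftFunctorCompIsoId 𝒯 (1 : ℤ) (-1) (by lia)).hom.app X))⟦(1 : ℤ)⟧')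
        ≫ (b ≫ s ≫ q)⟦(1 : ℤ)⟧' = 0
      rw [Functor.map_neg, Functor.map_comp, Preadditive.neg_comp, Category.assoc,
        shift_shiftFunctorCompIsoId_hom_app, neg_eq_zero]
      have hn := (shiftFunctorCompIsoId 𝒯 (-1 : ℤ) 1 (by lia)).hom.naturality h
      simp only [Functor.comp_map, Functor.id_map] at hn
      rw [← Category.assoc, hn, Category.assoc, hy, comp_zero])
    exact ⟨k, hk⟩
  obtain ⟨k, hk⟩ := hfac
  have hV0 : HomVanish M' V 1 :=
    ((hA.inAdd_left (hMA.trans hf.mem)).inAdd_right hT.left_mem) 1 one_pos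
  obtain ⟨l, rfl⟩ := Triangle.coyoneda_exact₃ _ hT.mem_distTriang k (hV0 _)
  change M' ⟶ Q at l
  change b ≫ s ≫ q = f ≫ l ≫ q at hk
  obtain ⟨m, hm⟩ := Triangle.coyoneda_exact₂ _ hT.mem_distTriang (b ≫ s - f ≫ l) (by
    change (b ≫ s - f ≫ l) ≫ q = 0
    rw [Preadditive.sub_comp, Category.assoc, Category.assoc, hk, sub_self])
  change X ⟶ V at m
  change b ≫ s - f ≫ l = m ≫ d at hm
  have h1 : (a ≫ f) ≫ (l ≫ r) + (a ≫ m) ≫ d ≫ r = (a ≫ b) ≫ (s ≫ r) := by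
    have h2 : b ≫ s = f ≫ l + m ≫ d := by rw [← hm]; abel
    simp only [Category.assoc, reassoc_of% h2, Preadditive.add_comp, Preadditive.comp_add]
  have h3 : IsIso ((a ≫ f) ≫ (l ≫ r) + (a ≫ m) ≫ d ≫ r) := by
    rw [h1]
    infer_instance
  rcases hP.of_isIso_add h3 with h4 | h4
  · exact hMP (hf.mem.trans (Splits.inAdd ⟨_, _, h4⟩))
  · exact hT.radical _ _ h4

/-- Only Hom(Y, T[1]) needs an argument. Such a map comes from some P ⟶ T through Y ⟶ P[1]. That map
lifts to Q, which now lies in add M, so it factors through the approximation f, and h ≫ f[1] = 0. -/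
theorem IsPresentation.siltGE_of_not_splits {A P M M' V Q T Y U : 𝒯} {d : V ⟶ Q} {q : Q ⟶ T}
    {δ : T ⟶ V⟦(1 : ℤ)⟧} (hT : IsPresentation A P d q δ) (hA : SiltGE A A) (hP : IsLocalEnd P)
    (hAT : SiltGE A T) (hQ : ¬ Splits P Q) (hPM : Nonempty (A ≅ P ⊞ M))
    {f : P ⟶ M'} (hf : IsMinLeftApprox M f) {g : M' ⟶ Y} {h : Y ⟶ P⟦(1 : ℤ)⟧}
    (htri : Triangle.mk f g h ∈ distTriang 𝒯) (eU : U ≅ Y ⊞ M) : SiltGE U T := by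
  obtain ⟨e⟩ := hPM
  have hMA : InAdd A M := inAdd_of_retract (biprod.inr ≫ e.inv) (e.hom ≫ biprod.snd) (by simp)
  have hPA : InAdd A P := inAdd_of_retract (biprod.inl ≫ e.inv) (e.hom ≫ biprod.fst) (by simp)
  have hMT : SiltGE M T := hAT.inAdd_left hMA
  have hM'T : SiltGE M' T := hMT.inAdd_left hf.mem
  have hPT : SiltGE P T := hAT.inAdd_left hPA
  have hYT : SiltGE Y T := by
    intro i hi
    rcases eq_or_ne i 1 with rfl | hi1
    · intro y
      obtain ⟨z, rfl⟩ := Triangle.yoneda_exact₃ _ htri y (hM'T 1 one_pos _)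
      change P⟦(1 : ℤ)⟧ ⟶ T⟦(1 : ℤ)⟧ at z
      obtain ⟨t, rfl⟩ := (shiftFunctor 𝒯 (1 : ℤ)).map_surjective z
      obtain ⟨c, rfl⟩ := Triangle.coyoneda_exact₃ _ hT.mem_distTriang t
        (((hA.inAdd_left hPA).inAdd_right hT.left_mem) 1 one_pos _)
      change P ⟶ Q at c
      obtain ⟨k, rfl⟩ := hf.factors Q (hP.inAdd_of_not_splits ⟨e⟩ hT.right_mem hQ) c
      change h ≫ ((f ≫ k) ≫ q)⟦(1 : ℤ)⟧' = 0
      have h0 : h ≫ f⟦(1 : ℤ)⟧' = 0 := comp_distTriang_mor_zero₃₁ _ htri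
      rw [Functor.map_comp, Functor.map_comp, Category.assoc, reassoc_of% h0, zero_comp]
    · exact homVanish_contra₃ htri (show i - 1 + 1 = i by lia) (hPT (i - 1) (by lia)) (hM'T i hi)
  intro i hi
  refine HomVanish.of_iso (W := Y ⊞ M) ?_ eU.symm (Iso.refl _)
  exact homVanish_contra₂ (binaryBiproductTriangle_distinguished Y M) (hYT i hi) (hMT i hi)

/-- The lower interval below the left mutation, in terms of presentations. -/
theorem IsPresentation.exists_isLeftMutationAt_iff {A P M M' V Q T : 𝒯} {d : V ⟶ Q} {q : Q ⟶ T}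
    {δ : T ⟶ V⟦(1 : ℤ)⟧} (hT : IsPresentation A P d q δ) (hA : SiltGE A A) (hP : IsLocalEnd P)
    (hAT : SiltGE A T) (hPM : Nonempty (A ≅ P ⊞ M)) (hMP : ¬ InAdd M P)
    {f : P ⟶ M'} (hf : IsMinLeftApprox M f) :
    (∃ U : 𝒯, IsLeftMutationAt P A U ∧ SiltGE U T) ↔ ¬ Splits P Q := by
  constructor
  · rintro ⟨U, hU, hUT⟩
    obtain ⟨i₁, p₁, i₂, p₂, h1, -, -⟩ := nonempty_iso_biprod_iff.1 hPM
    exact hT.not_splits_of_isLeftMutationAt hA hP ⟨i₁, p₁, by rw [h1]; infer_instance⟩ hU hUT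
  · intro hQ
    obtain ⟨Y, g, h, htri⟩ := distinguished_cocone_triangle f
    exact ⟨Y ⊞ M, ⟨P, M, ⟨hPM, inAdd_self P, hMP⟩, M', Y, f, g, h, htri, hf, ⟨Iso.refl _⟩⟩,
      hT.siltGE_of_not_splits hA hP hAT hQ hPM hf htri (Iso.refl _)⟩

/-- If P split off both V and Q, the map V ⟶ P ⟶ Q would induce T ⟶ V[1] ⟶ Q[1] ⟶ T[1]. This
composite is zero by rigidity, so V ⟶ P ⟶ Q is null-homotopic, a sum of a map ending in d and one
starting with d. Restricted to P, an isomorphism becomes a sum of two non-isomorphisms. -/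
theorem IsPresentation.not_splits_or_not_splits {A P V Q T : 𝒯} {d : V ⟶ Q} {q : Q ⟶ T}
    {δ : T ⟶ V⟦(1 : ℤ)⟧} (hT : IsPresentation A P d q δ) (hA : SiltGE A A) (hP : IsLocalEnd P)
    (hTT : SiltGE T T) : ¬ Splits P V ∨ ¬ Splits P Q := by
  by_contra! hcon
  obtain ⟨⟨a, b, hab⟩, ⟨a', b', hab'⟩⟩ := hcon
  have hT' := hT.mem_distTriang
  have hQV : HomVanish Q V 1 := ((hA.inAdd_left hT.right_mem).inAdd_right hT.left_mem) 1 one_pos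
  have hdq : d ≫ q = 0 := comp_distTriang_mor_zero₁₂ _ hT'
  let f : V ⟶ Q := b ≫ a'
  obtain ⟨k, hk⟩ := coyoneda_shift_exact₂ hT' 1 (δ ≫ f⟦(1 : ℤ)⟧') (hTT 1 one_pos _)
  obtain ⟨k', rfl⟩ := Triangle.yoneda_exact₃ _ hT' k (hQV _)
  change V⟦(1 : ℤ)⟧ ⟶ V⟦(1 : ℤ)⟧ at k'
  obtain ⟨h₁, rfl⟩ := (shiftFunctor 𝒯 (1 : ℤ)).map_surjective k'
  change δ ≫ f⟦(1 : ℤ)⟧' = (δ ≫ h₁⟦(1 : ℤ)⟧') ≫ d⟦(1 : ℤ)⟧' at hk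
  -- The first half `h₁` of the homotopy has been found; what remains is killed by `δ` and therefore
  -- factors through -d[1], giving the second half `h₀`.
  obtain ⟨l, hl⟩ := Triangle.yoneda_exact₂ _ (rot_of_distTriang _ (rot_of_distTriang _ hT'))
    ((f - h₁ ≫ d)⟦(1 : ℤ)⟧') (by
      change δ ≫ (f - h₁ ≫ d)⟦(1 : ℤ)⟧' = 0
      rw [Functor.map_sub, Preadditive.comp_sub, hk, Functor.map_comp, Category.assoc, sub_self])
  change Q⟦(1 : ℤ)⟧ ⟶ Q⟦(1 : ℤ)⟧ at l
  obtain ⟨h₀, rfl⟩ := (shiftFunctor 𝒯 (1 : ℤ)).map_surjective l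
  change (f - h₁ ≫ d)⟦(1 : ℤ)⟧' = (-d⟦(1 : ℤ)⟧') ≫ h₀⟦(1 : ℤ)⟧' at hl
  have hl' : f = h₁ ≫ d + (-d) ≫ h₀ := by
    have : f - h₁ ≫ d = (-d) ≫ h₀ := by
      apply (shiftFunctor 𝒯 (1 : ℤ)).map_injective
      rw [hl, Functor.map_comp, Functor.map_neg]
    rw [← this]; abel
  have h2 : (a ≫ h₁) ≫ d ≫ b' + a ≫ d ≫ (-(h₀ ≫ b')) = (a ≫ b) ≫ (a' ≫ b') := by
    have := a ≫= hl' =≫ b'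
    simp only [f, Category.assoc, Preadditive.add_comp, Preadditive.comp_add,
      Preadditive.neg_comp, Preadditive.comp_neg] at this ⊢
    exact this.symm
  have h3 : IsIso ((a ≫ h₁) ≫ d ≫ b' + a ≫ d ≫ (-(h₀ ≫ b'))) := by
    rw [h2]
    infer_instance
  rcases hP.of_isIso_add h3 with h4 | h4
  · exact hT.radical _ _ h4
  · exact hT.radical _ _ h4

end Presentation

/-! ### Detecting P by its simple top -/

section Detection

variable {𝒯 : Type u} [Category.{v} 𝒯] [HasZeroObject 𝒯] [HasShift 𝒯 ℤ] [Preadditive 𝒯]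
  [∀ n : ℤ, (shiftFunctor 𝒯 n).Additive] [Pretriangulated 𝒯]
  {𝒯' : Type u'} [Category.{v'} 𝒯'] [HasZeroObject 𝒯'] [HasShift 𝒯' ℤ] [Preadditive 𝒯']
  [∀ n : ℤ, (shiftFunctor 𝒯' n).Additive] [Pretriangulated 𝒯']

/-- The object `S` behaves like the simple top of the summand `P` of `A`. -/
structure IsSimpleTop (Φ : 𝒯 ⥤ 𝒯') (A P : 𝒯) {S : 𝒯'} (s : Φ.obj P ⟶ S) : Prop where
  ne_zero : s ≠ 0
  factors : ∀ φ : Φ.obj A ⟶ S, ∃ α : A ⟶ P, φ = Φ.map α ≫ s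
  exists_isIso : ∀ α : A ⟶ P, Φ.map α ≫ s ≠ 0 → ∃ a : P ⟶ A, IsIso (a ≫ α)
  homVanish : ∀ n : ℤ, n ≠ 0 → HomVanish (Φ.obj A) S n

/-- The objects of `𝒯` without nonzero maps to shifts of `S`. -/
def orthogonalTo (Φ : 𝒯 ⥤ 𝒯') (S : 𝒯') : ObjectProperty 𝒯 :=
  fun X => ∀ n : ℤ, HomVanish (Φ.obj X) S n

variable (Φ : 𝒯 ⥤ 𝒯') [Φ.CommShift ℤ] [Φ.IsTriangulated]

set_option linter.unusedSectionVars false in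
instance (S : 𝒯') : (orthogonalTo Φ S).IsStableUnderRetracts where
  of_retract := by
    intro X Y h hY n
    exact (hY n).inAdd_left (inAdd_of_retract (Φ.map h.i) (Φ.map h.r)
      (by rw [← Functor.map_comp, h.retract, CategoryTheory.Functor.map_id]))

set_option linter.unusedSectionVars false in
instance (S : 𝒯') : (orthogonalTo Φ S).IsClosedUnderIsomorphisms where
  of_iso e h n := (h n).of_iso (Φ.mapIso e) (Iso.refl _)

open ZeroObject in
instance (S : 𝒯') : (orthogonalTo Φ S).IsTriangulated where
  exists_zero := ⟨0, isZero_zero _, fun _ f => (Φ.map_isZero (isZero_zero 𝒯)).eq_of_src f 0⟩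
  isStableUnderShiftBy n :=
    { le_shift X hX m := HomVanish.of_iso ((homVanish_shift_left
          (show n + (m - n) = m by lia)).2 (hX (m - n)))
          ((Φ.commShiftIso n).app X).symm (Iso.refl _) }
  toIsTriangulatedClosed₂ := .mk' fun T hT h₁ h₃ n =>
    homVanish_contra₂ (Φ.map_distinguished T hT) (h₁ n) (h₃ n)

/-- A nonzero map from Q to S yields, since Q is in add A, a map A ⟶ Q ⟶ A ⟶ P that stays nonzero in
S. Such a map is a split epimorphism, so P splits off Q. -/
theorem IsSimpleTop.orthogonalTo {A P Q : 𝒯} {S : 𝒯'} {s : Φ.obj P ⟶ S}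
    (hs : IsSimpleTop Φ A P s) (hQ : InAdd A Q) (hPQ : ¬ Splits P Q) : orthogonalTo Φ S Q := by
  have hΦ : Φ.Additive := inferInstance
  obtain ⟨n, a, b, hab⟩ := inAdd_iff.1 hQ
  intro m
  rcases eq_or_ne m 0 with rfl | hm
  · rw [homVanish_zero]
    intro φ
    have h1 := congrArg Φ.map hab =≫ φ
    rw [CategoryTheory.Functor.map_id, Category.id_comp, Functor.map_sum,
      Preadditive.sum_comp] at h1
    rw [← h1]
    refine Finset.sum_eq_zero fun i _ => ?_
    obtain ⟨α, hα⟩ := hs.factors (Φ.map (b i) ≫ φ)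
    rw [Functor.map_comp, Category.assoc, hα, ← Category.assoc, ← Functor.map_comp]
    by_contra hne
    -- some map `A ⟶ Q ⟶ A ⟶ P ⟶ S` is nonzero
    have h2 := congrArg Φ.map hab =≫ (Φ.map (a i ≫ α) ≫ s)
    rw [CategoryTheory.Functor.map_id, Category.id_comp, Functor.map_sum,
      Preadditive.sum_comp] at h2
    obtain ⟨j, -, hj⟩ := Finset.exists_ne_zero_of_sum_ne_zero (h2.trans_ne hne)
    obtain ⟨c, hc⟩ := hs.exists_isIso (b j ≫ a i ≫ α) (by
      intro h0
      apply hj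
      rw [Functor.map_comp, Category.assoc, ← Category.assoc (Φ.map (b j)), ← Functor.map_comp,
        h0, comp_zero])
    exact hPQ ⟨c ≫ b j, a i ≫ α, by simpa only [Category.assoc] using hc⟩
  · refine (hs.homVanish m hm).inAdd_left (inAdd_iff.2
      ⟨n, fun i => Φ.map (a i), fun i => Φ.map (b i), ?_⟩)
    rw [← CategoryTheory.Functor.map_id, ← hab, Functor.map_sum]
    simp

/-- If P occurred in neither term, then V and Q, hence T, would be orthogonal to all shifts of S.
The objects with this property form a thick subcategory; as T generates, it would contain P,
contradicting `s ≠ 0`. -/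
theorem IsPresentation.splits_or_splits {A P V Q T : 𝒯} {d : V ⟶ Q} {q : Q ⟶ T}
    {δ : T ⟶ V⟦(1 : ℤ)⟧} (hT : IsPresentation A P d q δ) {S : 𝒯'} {s : Φ.obj P ⟶ S}
    (hs : IsSimpleTop Φ A P s) (hgen : (ObjectProperty.singleton T).IsClassicalTriangulatedGenerator) :
    Splits P V ∨ Splits P Q := by
  by_contra! hcon
  have hTS : Silting.orthogonalTo Φ S T := fun n =>
    homVanish_contra₃ (Φ.map_distinguished _ hT.mem_distTriang) (sub_add_cancel n 1)
      (hs.orthogonalTo Φ hT.left_mem hcon.1 _) (hs.orthogonalTo Φ hT.right_mem hcon.2 _)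
  have h := (ObjectProperty.triangEnvelope_le_iff (P := ObjectProperty.singleton T)
    (Q := Silting.orthogonalTo Φ S)).2 (by rwa [ObjectProperty.singleton_le_iff])
  rw [(ObjectProperty.isClassicalTriangulatedGenerator_iff _).1 hgen] at h
  exact hs.ne_zero (homVanish_zero.1 (h P trivial 0) s)

end Detection

/-! ### Contravariant dualities acting on silting objects -/

section Duality

open Opposite

variable {𝒯 : Type u} [Category.{v} 𝒯] [HasZeroObject 𝒯] [HasShift 𝒯 ℤ] [Preadditive 𝒯]
  [∀ n : ℤ, (shiftFunctor 𝒯 n).Additive] [Pretriangulated 𝒯]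

/-- A contravariant functor that is involutive on objects, inverts shifts and reverses
distinguished triangles. -/
structure IsDuality (G : 𝒯ᵒᵖ ⥤ 𝒯) : Prop where
  shift : ∀ (X : 𝒯) (n : ℤ), Nonempty (G.obj (op (X⟦n⟧)) ≅ (G.obj (op X))⟦-n⟧)
  triangle : ∀ {X Y Z : 𝒯} {f : X ⟶ Y} {g : Y ⟶ Z} {h : Z ⟶ X⟦(1 : ℤ)⟧},
    Triangle.mk f g h ∈ distTriang 𝒯 →
      ∃ h' : G.obj (op X) ⟶ (G.obj (op Z))⟦(1 : ℤ)⟧,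
        Triangle.mk (G.map g.op) (G.map f.op) h' ∈ distTriang 𝒯
  invol : ∀ X : 𝒯, Nonempty (G.obj (op (G.obj (op X))) ≅ X)

variable {G : 𝒯ᵒᵖ ⥤ 𝒯} [G.Additive]

theorem map_op_add {X Y : 𝒯} (f g : X ⟶ Y) : G.map (f + g).op = G.map f.op + G.map g.op := by
  rw [op_add, Functor.map_add]

theorem map_op_sum {X Y : 𝒯} {ι : Type*} (s : Finset ι) (f : ι → (X ⟶ Y)) :
    G.map (∑ i ∈ s, f i).op = ∑ i ∈ s, G.map (f i).op := by
  rw [op_sum, Functor.map_sum]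

variable (G) in
theorem nonempty_iso_biprod_dual {T X M : 𝒯} (h : Nonempty (T ≅ X ⊞ M)) :
    Nonempty (G.obj (op T) ≅ G.obj (op X) ⊞ G.obj (op M)) := by
  obtain ⟨i₁, p₁, i₂, p₂, h₁, h₂, h⟩ := nonempty_iso_biprod_iff.1 h
  refine nonempty_iso_biprod_iff.2 ⟨G.map p₁.op, G.map i₁.op, G.map p₂.op, G.map i₂.op, ?_, ?_, ?_⟩
  · rw [← G.map_comp, ← op_comp, h₁, op_id, G.map_id]
  · rw [← G.map_comp, ← op_comp, h₂, op_id, G.map_id]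
  · rw [← G.map_comp, ← G.map_comp, ← op_comp, ← op_comp, ← map_op_add, h, op_id, G.map_id]

variable (G) in
theorem InAdd.dual {M X : 𝒯} (h : InAdd M X) : InAdd (G.obj (op M)) (G.obj (op X)) := by
  obtain ⟨n, a, b, hab⟩ := inAdd_iff.1 h
  refine inAdd_iff.2 ⟨n, fun i => G.map (b i).op, fun i => G.map (a i).op, ?_⟩
  rw [← G.map_id, ← op_id, ← hab, map_op_sum]
  simp

theorem IsDuality.inAdd_iff (hG : IsDuality G) {M X : 𝒯} :
    InAdd (G.obj (op M)) (G.obj (op X)) ↔ InAdd M X := by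
  obtain ⟨a⟩ := hG.invol M
  obtain ⟨b⟩ := hG.invol X
  exact ⟨fun h => (h.dual G).of_iso a b, fun h => h.dual G⟩

variable [G.Full] [G.Faithful]

/-- By fullness, every map GX ⟶ (GW)[n] ≅ G(W[-n]) comes from a map W[-n] ⟶ X. -/
theorem IsDuality.homVanish (hG : IsDuality G) {W X : 𝒯} {n : ℤ} (h : HomVanish W X n) :
    HomVanish (G.obj (op X)) (G.obj (op W)) n := by
  obtain ⟨e⟩ := hG.shift W (-n)
  rw [neg_neg] at e
  intro f
  obtain ⟨g, hg⟩ := G.map_surjective (f ≫ e.inv)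
  have h1 : HomVanish (W⟦-n⟧) X 0 := (homVanish_shift_left (neg_add_cancel n)).2 h
  have hg0 : g = 0 := Quiver.Hom.unop_inj (homVanish_zero.1 h1 g.unop)
  rw [hg0, Functor.map_zero] at hg
  rw [← cancel_mono e.inv, ← hg, zero_comp]

theorem IsDuality.siltGE (hG : IsDuality G) {T U : 𝒯} (h : SiltGE T U) :
    SiltGE (G.obj (op U)) (G.obj (op T)) :=
  fun i hi => hG.homVanish (h i hi)

theorem IsDuality.isMinRightApprox (hG : IsDuality G) {M X M' : 𝒯} {f : X ⟶ M'}
    (hf : IsMinLeftApprox M f) : IsMinRightApprox (G.obj (op M)) (G.map f.op) where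
  mem := hf.mem.dual G
  factors N hN g := by
    obtain ⟨e⟩ := hG.invol N
    obtain ⟨k, hk⟩ := G.map_surjective (e.hom ≫ g)
    obtain ⟨l, hl⟩ := hf.factors (G.obj (op N))
      (hG.inAdd_iff.1 (hN.of_iso (Iso.refl _) e.symm)) k.unop
    refine ⟨e.inv ≫ G.map l.op, ?_⟩
    rw [Category.assoc, ← G.map_comp, ← op_comp, hl, Quiver.Hom.op_unop, hk, e.inv_hom_id_assoc]
  minimal h hh := by
    obtain ⟨k, rfl⟩ := G.map_surjective h
    have hk : f ≫ k.unop = f := by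
      rw [← G.map_comp] at hh
      exact congrArg Quiver.Hom.unop (G.map_injective hh)
    have := hf.minimal k.unop hk
    have : IsIso k := (isIso_unop_iff k).1 this
    infer_instance

theorem IsDuality.isMinLeftApprox (hG : IsDuality G) {M X M' : 𝒯} {f : M' ⟶ X}
    (hf : IsMinRightApprox M f) : IsMinLeftApprox (G.obj (op M)) (G.map f.op) where
  mem := hf.mem.dual G
  factors N hN g := by
    obtain ⟨e⟩ := hG.invol N
    obtain ⟨k, hk⟩ := G.map_surjective (g ≫ e.inv)
    obtain ⟨l, hl⟩ := hf.factors (G.obj (op N))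
      (hG.inAdd_iff.1 (hN.of_iso (Iso.refl _) e.symm)) k.unop
    refine ⟨G.map l.op ≫ e.hom, ?_⟩
    rw [← Category.assoc, ← G.map_comp, ← op_comp, hl, Quiver.Hom.op_unop, hk, Category.assoc,
      e.inv_hom_id, Category.comp_id]
  minimal h hh := by
    obtain ⟨k, rfl⟩ := G.map_surjective h
    have hk : k.unop ≫ f = f := by
      rw [← G.map_comp] at hh
      exact congrArg Quiver.Hom.unop (G.map_injective hh)
    have := hf.minimal k.unop hk
    have : IsIso k := (isIso_unop_iff k).1 this
    infer_instance

set_option linter.unusedSectionVars false in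
theorem IsDuality.isSplittingAt (hG : IsDuality G) {P T X M : 𝒯} (h : IsSplittingAt P T X M) :
    IsSplittingAt (G.obj (op P)) (G.obj (op T)) (G.obj (op X)) (G.obj (op M)) :=
  ⟨nonempty_iso_biprod_dual G h.1, h.2.1.dual G, fun h' => h.2.2 (hG.inAdd_iff.1 h')⟩

theorem IsDuality.isRightMutationAt (hG : IsDuality G) {P T U : 𝒯} (h : IsLeftMutationAt P T U) :
    IsRightMutationAt (G.obj (op P)) (G.obj (op T)) (G.obj (op U)) := by
  obtain ⟨X, M, hs, M', Y, f, g, h, htri, hf, hU⟩ := h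
  obtain ⟨h', htri'⟩ := hG.triangle htri
  exact ⟨_, _, hG.isSplittingAt hs, _, _, _, _, _, htri', hG.isMinRightApprox hf,
    nonempty_iso_biprod_dual G hU⟩

theorem IsDuality.isLeftMutationAt (hG : IsDuality G) {P T U : 𝒯} (h : IsRightMutationAt P T U) :
    IsLeftMutationAt (G.obj (op P)) (G.obj (op T)) (G.obj (op U)) := by
  obtain ⟨X, M, hs, M', Y, k, f, h, htri, hf, hU⟩ := h
  obtain ⟨h', htri'⟩ := hG.triangle htri
  exact ⟨_, _, hG.isSplittingAt hs, _, _, _, _, _, htri', hG.isMinLeftApprox hf,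
    nonempty_iso_biprod_dual G hU⟩

theorem IsSplittingAt.of_iso {P T X M P' T' : 𝒯} (h : IsSplittingAt P T X M) (a : P ≅ P')
    (b : T ≅ T') : IsSplittingAt P' T' X M := by
  obtain ⟨⟨e⟩, h₁, h₂⟩ := h
  exact ⟨⟨b.symm ≪≫ e⟩, h₁.of_iso a (Iso.refl _), fun h => h₂ (h.of_iso (Iso.refl _) a.symm)⟩

theorem IsLeftMutationAt.of_iso {P T U P' T' : 𝒯} (h : IsLeftMutationAt P T U) (a : P ≅ P')
    (b : T ≅ T') : IsLeftMutationAt P' T' U := by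
  obtain ⟨X, M, hs, hm⟩ := h
  exact ⟨X, M, hs.of_iso a b, hm⟩

theorem IsRightMutationAt.of_iso {P T U P' T' : 𝒯} (h : IsRightMutationAt P T U) (a : P ≅ P')
    (b : T ≅ T') : IsRightMutationAt P' T' U := by
  obtain ⟨X, M, hs, hm⟩ := h
  exact ⟨X, M, hs.of_iso a b, hm⟩

theorem IsDuality.isBasic (hG : IsDuality G) {T : 𝒯} (h : IsBasic T) : IsBasic (G.obj (op T)) := by
  rintro X Y e
  obtain ⟨eT⟩ := hG.invol T
  obtain ⟨e₁⟩ := nonempty_iso_biprod_dual G e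
  obtain ⟨e₂⟩ := nonempty_iso_biprod_dual G ⟨Iso.refl (X ⊞ X)⟩
  have h0 : IsZero (G.obj (op X)) :=
    h _ (G.obj (op Y)) ⟨eT.symm ≪≫ e₁ ≪≫ biprod.mapIso e₂ (Iso.refl _)⟩
  obtain ⟨eX⟩ := hG.invol X
  exact ((G.map_isZero (IsZero.op h0)).of_iso eX.symm)

/-- The preimage under G of the thick closure of GT is thick and contains T, so it is everything.
Every W is isomorphic to G(GW), so the thick closure of GT is everything too. -/
theorem IsDuality.isClassicalTriangulatedGenerator [IsTriangulated 𝒯] (hG : IsDuality G) {T : 𝒯}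
    (h : (ObjectProperty.singleton T).IsClassicalTriangulatedGenerator) :
    (ObjectProperty.singleton (G.obj (op T))).IsClassicalTriangulatedGenerator := by
  let E := (ObjectProperty.singleton (G.obj (op T))).triangEnvelope
  let R : ObjectProperty 𝒯 := fun Z => E (G.obj (op Z))
  have hR₁ : R.IsStableUnderRetracts :=
    { of_retract := fun {X Y} r hY => E.prop_of_retract
        { i := G.map r.r.op
          r := G.map r.i.op
          retract := by rw [← G.map_comp, ← op_comp, r.retract, op_id, G.map_id] } hY }
  have hRiso : R.IsClosedUnderIsomorphisms :=
    { of_iso := fun e hX => E.prop_of_iso (G.mapIso e.op.symm) hX }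
  have hR₂ : R.IsTriangulated :=
    { exists_zero := by
        obtain ⟨Z, hZ⟩ := HasZeroObject.zero (C := 𝒯)
        exact ⟨Z, hZ, E.prop_of_isZero (G.map_isZero hZ.op)⟩
      isStableUnderShiftBy := fun n =>
        { le_shift := fun X hX => by
            obtain ⟨e⟩ := hG.shift X n
            exact E.prop_of_iso e.symm (E.le_shift (-n) _ hX) }
      toIsTriangulatedClosed₂ := .mk' fun T' hT' h₁ h₃ => by
        obtain ⟨h', htri⟩ := hG.triangle (f := T'.mor₁) (g := T'.mor₂) (h := T'.mor₃) hT'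
        exact E.ext_of_isTriangulatedClosed₂ _ htri h₃ h₁ }
  have hle := (ObjectProperty.triangEnvelope_le_iff (P := ObjectProperty.singleton T)
    (Q := R)).2 (by
      rw [ObjectProperty.singleton_le_iff]
      exact (ObjectProperty.singleton (G.obj (op T))).le_triangEnvelope _ (by simp))
  rw [(ObjectProperty.isClassicalTriangulatedGenerator_iff _).1 h] at hle
  rw [ObjectProperty.isClassicalTriangulatedGenerator_iff, eq_top_iff]
  intro W _
  obtain ⟨e⟩ := hG.invol W
  exact E.prop_of_iso e (hle (G.obj (op W)) trivial)

theorem IsDuality.isSilting [IsTriangulated 𝒯] (hG : IsDuality G) {T : 𝒯} (h : IsSilting T) :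
    IsSilting (G.obj (op T)) :=
  ⟨hG.siltGE h.self_ge, hG.isClassicalTriangulatedGenerator h.thick_eq_top⟩

/-- The action of a duality on `silt 𝒯`. -/
def IsDuality.siltMap [IsTriangulated 𝒯] (hG : IsDuality G) : Silt 𝒯 → Silt 𝒯 :=
  Quotient.map (fun T => ⟨G.obj (op T.1), hG.isSilting T.2.1, hG.isBasic T.2.2⟩) (by
    rintro T U ⟨e⟩
    exact ⟨G.mapIso e.op.symm⟩)

theorem IsDuality.siltMap_involutive [IsTriangulated 𝒯] (hG : IsDuality G) :
    Function.Involutive hG.siltMap := by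
  intro q
  induction q using Quotient.inductionOn with
  | h T => exact Quotient.sound (hG.invol T.1)

theorem IsDuality.siltMap_le [IsTriangulated 𝒯] (hG : IsDuality G) {q r : Silt 𝒯} (h : q ≤ r) :
    hG.siltMap r ≤ hG.siltMap q := by
  induction q using Quotient.inductionOn with
  | h T =>
    induction r using Quotient.inductionOn with
    | h U => exact hG.siltGE (T := U.1) (U := T.1) h

theorem IsDuality.siltMap_le_iff [IsTriangulated 𝒯] (hG : IsDuality G) {q r : Silt 𝒯} :
    hG.siltMap r ≤ hG.siltMap q ↔ q ≤ r := by
  refine ⟨fun h => ?_, hG.siltMap_le⟩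
  simpa only [hG.siltMap_involutive q, hG.siltMap_involutive r] using hG.siltMap_le h

/-- Dualizing reverses both bounds, and GA ≅ A[1] together with G² ≅ 1 on objects gives G(A[1]) ≅ A,
so the interval returns to itself. -/
theorem IsDuality.siltMap_mem_twoSilt [IsTriangulated 𝒯] (hG : IsDuality G) {A : 𝒯}
    (eA : G.obj (op A) ≅ A⟦(1 : ℤ)⟧) {q : Silt 𝒯} (hq : q ∈ twoSilt A) :
    hG.siltMap q ∈ twoSilt A := by
  obtain ⟨e⟩ := hG.invol A
  induction q using Quotient.inductionOn with
  | h T => exact ⟨(hG.siltGE hq.2).of_iso (G.mapIso eA.op ≪≫ e) (Iso.refl _),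
      (hG.siltGE hq.1).of_iso (Iso.refl _) eA⟩

theorem IsDuality.siltMap_mem_siltPlus [IsTriangulated 𝒯] (hG : IsDuality G) {A P : 𝒯}
    (eA : G.obj (op A) ≅ A⟦(1 : ℤ)⟧) (eP : G.obj (op P) ≅ P⟦(1 : ℤ)⟧) {q : Silt 𝒯}
    (hq : q ∈ siltMinus A P) : hG.siltMap q ∈ siltPlus A P := by
  obtain ⟨hq, U, hU, hUT⟩ := hq
  refine ⟨hG.siltMap_mem_twoSilt eA hq, G.obj (op U), (hG.isRightMutationAt hU).of_iso eP eA, ?_⟩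
  induction q using Quotient.inductionOn with
  | h T => exact hG.siltGE hUT

theorem IsDuality.siltMap_mem_siltMinus [IsTriangulated 𝒯] (hG : IsDuality G) {A P : 𝒯}
    (eA : G.obj (op A) ≅ A⟦(1 : ℤ)⟧) (eP : G.obj (op P) ≅ P⟦(1 : ℤ)⟧) {q : Silt 𝒯}
    (hq : q ∈ siltPlus A P) : hG.siltMap q ∈ siltMinus A P := by
  obtain ⟨hq, U, hU, hUT⟩ := hq
  obtain ⟨a⟩ := hG.invol A
  obtain ⟨b⟩ := hG.invol P
  refine ⟨hG.siltMap_mem_twoSilt eA hq, G.obj (op U), (hG.isLeftMutationAt hU).of_iso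
    (G.mapIso eP.op ≪≫ b) (G.mapIso eA.op ≪≫ a), ?_⟩
  induction q using Quotient.inductionOn with
  | h T => exact hG.siltGE hUT

theorem IsDuality.nonempty_orderIso [IsTriangulated 𝒯] (hG : IsDuality G) {A P : 𝒯}
    (eA : G.obj (op A) ≅ A⟦(1 : ℤ)⟧) (eP : G.obj (op P) ≅ P⟦(1 : ℤ)⟧) :
    Nonempty (siltMinus A P ≃o (siltPlus A P)ᵒᵈ) :=
  ⟨{ toFun q := OrderDual.toDual ⟨hG.siltMap q.1, hG.siltMap_mem_siltPlus eA eP q.2⟩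
     invFun q := ⟨hG.siltMap (OrderDual.ofDual q).1,
      hG.siltMap_mem_siltMinus eA eP (OrderDual.ofDual q).2⟩
     left_inv q := Subtype.ext (hG.siltMap_involutive q.1)
     right_inv q := Subtype.ext (hG.siltMap_involutive (OrderDual.ofDual q).1)
     map_rel_iff' := hG.siltMap_le_iff }⟩

/-- The composition of a duality with the shift is a duality. -/
theorem IsDuality.comp_shift {F : 𝒯ᵒᵖ ⥤ 𝒯} (hF : IsDuality F) :
    IsDuality (F ⋙ shiftFunctor 𝒯 (1 : ℤ)) where
  shift X n := by
    obtain ⟨e⟩ := hF.shift X n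
    exact ⟨(shiftFunctor 𝒯 (1 : ℤ)).mapIso e ≪≫ shiftComm _ _ _⟩
  triangle {X Y Z f g h} hT := by
    obtain ⟨h', hT'⟩ := hF.triangle hT
    -- Three rotations put a sign on every morphism; the automorphism -1 of the middle vertex
    -- removes two of them.
    have key {X Y Z : 𝒯} (a : X ⟶ Y) (b : Y ⟶ Z) (c : Z ⟶ X⟦(1 : ℤ)⟧) :
        Triangle.mk a b c ≅ Triangle.mk (-a) (-b) c :=
      Triangle.isoMk _ _ (Iso.refl X) (-Iso.refl Y) (Iso.refl Z)
        (by change a ≫ (-𝟙 Y) = 𝟙 X ≫ (-a); simp) (by change b ≫ 𝟙 Z = (-𝟙 Y) ≫ (-b); simp)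
        (by change c ≫ (𝟙 X)⟦(1 : ℤ)⟧' = 𝟙 Z ≫ c; simp)
    exact ⟨-h'⟦(1 : ℤ)⟧', isomorphic_distinguished _
      (rot_of_distTriang _ (rot_of_distTriang _ (rot_of_distTriang _ hT'))) _ (key _ _ _)⟩
  invol X := by
    obtain ⟨a⟩ := hF.invol X
    obtain ⟨b⟩ := hF.shift (F.obj (op X)) 1
    exact ⟨(shiftFunctor 𝒯 (1 : ℤ)).mapIso b ≪≫
      (shiftFunctorCompIsoId 𝒯 (-1 : ℤ) 1 (by simp)).app _ ≪≫ a⟩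

end Duality

/-! ### The symmetry theorem in a triangulated category -/

section Main

open Opposite

variable {𝒯 : Type u} [Category.{v} 𝒯] [HasZeroObject 𝒯] [HasShift 𝒯 ℤ] [Preadditive 𝒯]
  [∀ n : ℤ, (shiftFunctor 𝒯 n).Additive] [Pretriangulated 𝒯]

theorem splits_dual_iff {F : 𝒯ᵒᵖ ⥤ 𝒯} [F.Full] [F.Faithful] {P V : 𝒯}
    (eP : F.obj (op P) ≅ P) : Splits P (F.obj (op V)) ↔ Splits P V := by
  constructor
  · rintro ⟨a, b, h⟩
    obtain ⟨a', ha⟩ := F.map_surjective (eP.hom ≫ a)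
    obtain ⟨b', hb⟩ := F.map_surjective (b ≫ eP.inv)
    have h1 : F.map (a' ≫ b') = eP.hom ≫ (a ≫ b) ≫ eP.inv := by
      rw [F.map_comp, ha, hb]; simp
    have h2 : IsIso (F.map (a' ≫ b')) := by rw [h1]; infer_instance
    have h3 : IsIso (a' ≫ b') := isIso_of_reflects_iso _ F
    exact ⟨b'.unop, a'.unop, by rw [← unop_comp]; infer_instance⟩
  · rintro ⟨a, b, h⟩
    refine ⟨eP.inv ≫ F.map b.op, F.map a.op ≫ eP.hom, ?_⟩
    have h1 : (eP.inv ≫ F.map b.op) ≫ F.map a.op ≫ eP.hom = eP.inv ≫ F.map (a ≫ b).op ≫ eP.hom := by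
      rw [op_comp, F.map_comp]; simp
    rw [h1]
    infer_instance

/-- The dual triangle FT ⟶ FQ ⟶ FV, rotated once, presents (FT)[1] by FQ ⟶ FV: the two terms of the
presentation have changed places. -/
theorem IsPresentation.dual {F : 𝒯ᵒᵖ ⥤ 𝒯} [F.Additive] [F.Full] [F.Faithful] (hF : IsDuality F)
    {A P : 𝒯} (eA : F.obj (op A) ≅ A) (eP : F.obj (op P) ≅ P) {V Q T : 𝒯} {d : V ⟶ Q}
    {q : Q ⟶ T} {δ : T ⟶ V⟦(1 : ℤ)⟧} (hT : IsPresentation A P d q δ) :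
    ∃ (q' : F.obj (op V) ⟶ (F.obj (op T))⟦(1 : ℤ)⟧)
      (δ' : (F.obj (op T))⟦(1 : ℤ)⟧ ⟶ (F.obj (op Q))⟦(1 : ℤ)⟧),
      IsPresentation A P (F.map d.op) q' δ' := by
  obtain ⟨h', hT'⟩ := hF.triangle hT.mem_distTriang
  refine ⟨h', _, rot_of_distTriang _ hT', (hT.right_mem.dual F).of_iso eA (Iso.refl _),
    (hT.left_mem.dual F).of_iso eA (Iso.refl _), fun a b h => ?_⟩
  obtain ⟨a', ha⟩ := F.map_surjective (eP.hom ≫ a)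
  obtain ⟨b', hb⟩ := F.map_surjective (b ≫ eP.inv)
  have h1 : F.map (a' ≫ d.op ≫ b') = eP.hom ≫ (a ≫ F.map d.op ≫ b) ≫ eP.inv := by
    rw [F.map_comp, F.map_comp, ha, hb]; simp
  have h2 : IsIso (F.map (a' ≫ d.op ≫ b')) := by rw [h1]; infer_instance
  have h3 : IsIso (a' ≫ d.op ≫ b') := isIso_of_reflects_iso _ F
  have h4 : IsIso (a' ≫ d.op ≫ b').unop := inferInstance
  exact hT.radical b'.unop a'.unop (by simpa using h4)

variable [IsTriangulated 𝒯]
  {𝒯' : Type u'} [Category.{v'} 𝒯'] [HasZeroObject 𝒯'] [HasShift 𝒯' ℤ] [Preadditive 𝒯']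
  [∀ n : ℤ, (shiftFunctor 𝒯' n).Additive] [Pretriangulated 𝒯']

/-- Symmetry of the two-term silting objects with respect to a duality fixing `A` and the
summand `P`. -/
theorem nonempty_orderIso_and_mk_twoSilt {A P : 𝒯} (hA : SiltGE A A) (hP : IsLocalEnd P)
    (hgen : (ObjectProperty.singleton A).IsClassicalTriangulatedGenerator)
    (happ : ∀ T : 𝒯, ∃ (Q : 𝒯) (q : Q ⟶ T), IsMinRightApprox A q)
    (hmut : ∃ (M M' : 𝒯) (f : P ⟶ M'), Nonempty (A ≅ P ⊞ M) ∧ ¬ InAdd M P ∧ IsMinLeftApprox M f)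
    (Φ : 𝒯 ⥤ 𝒯') [Φ.CommShift ℤ] [Φ.IsTriangulated] {S : 𝒯'} {s : Φ.obj P ⟶ S}
    (hs : IsSimpleTop Φ A P s)
    {F : 𝒯ᵒᵖ ⥤ 𝒯} [F.Additive] [F.Full] [F.Faithful] (hF : IsDuality F)
    (eA : F.obj (op A) ≅ A) (eP : F.obj (op P) ≅ P) :
    Nonempty (siltMinus A P ≃o (siltPlus A P)ᵒᵈ) ∧ #(twoSilt A) = 2 * #(siltMinus A P) := by
  have hG := hF.comp_shift
  let G := F ⋙ shiftFunctor 𝒯 (1 : ℤ)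
  let gA : G.obj (op A) ≅ A⟦(1 : ℤ)⟧ := (shiftFunctor 𝒯 (1 : ℤ)).mapIso eA
  let gP : G.obj (op P) ≅ P⟦(1 : ℤ)⟧ := (shiftFunctor 𝒯 (1 : ℤ)).mapIso eP
  obtain ⟨M, M', f, hPM, hMP, hf⟩ := hmut
  obtain ⟨θ⟩ := hG.nonempty_orderIso gA gP
  -- Membership in 𝒯⁻ means that P is absent from Q. Membership in 𝒯⁺ is membership of the dual in
  -- 𝒯⁻, so that P is absent from V. Exactly one of these holds.
  have hdich : ∀ q ∈ twoSilt A, (q ∈ siltMinus A P ↔ q ∉ siltPlus A P) := by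
    intro q hq
    have hplus : q ∈ siltPlus A P ↔ hG.siltMap q ∈ siltMinus A P :=
      ⟨hG.siltMap_mem_siltMinus gA gP, fun h => by
        simpa only [hG.siltMap_involutive q] using hG.siltMap_mem_siltPlus gA gP h⟩
    rw [hplus]
    have hq' := hG.siltMap_mem_twoSilt gA hq
    induction q using Quotient.inductionOn with
    | h T =>
      obtain ⟨V, Q, d, q, δ, hT⟩ := exists_isPresentation hA happ hgen hP hq.1 hq.2
      obtain ⟨q', δ', hT'⟩ := hT.dual hF eA eP
      have h₁ := hT.exists_isLeftMutationAt_iff hA hP hq.1 hPM hMP hf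
      have h₂ := hT'.exists_isLeftMutationAt_iff hA hP hq'.1 hPM hMP hf
      rw [splits_dual_iff eP] at h₂
      have h₃ := hT.not_splits_or_not_splits hA hP T.2.1.self_ge
      have h₄ := hT.splits_or_splits Φ hs T.2.1.thick_eq_top
      have h₅ : ⟦T⟧ ∈ siltMinus A P ↔ ¬ Splits P Q := (and_iff_right hq).trans h₁
      have h₆ : hG.siltMap ⟦T⟧ ∈ siltMinus A P ↔ ¬ Splits P V := (and_iff_right hq').trans h₂
      refine h₅.trans (Iff.trans ?_ (not_congr h₆).symm)
      tauto
  refine ⟨⟨θ⟩, ?_⟩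
  have hunion : twoSilt A = siltMinus A P ∪ siltPlus A P := by
    ext q
    constructor
    · intro hq
      by_cases h : q ∈ siltPlus A P
      · exact Or.inr h
      · exact Or.inl ((hdich q hq).2 h)
    · rintro (h | h)
      · exact h.1
      · exact h.1
  have hdisj : Disjoint (siltMinus A P) (siltPlus A P) :=
    Set.disjoint_left.2 fun q h h' => (hdich q h.1).1 h h'
  have hcard : #(siltPlus A P) = #(siltMinus A P) :=
    Cardinal.mk_congr (OrderDual.toDual.trans θ.symm.toEquiv)
  rw [hunion, Cardinal.mk_union_of_disjoint hdisj, hcard, two_mul]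

end Main

/-! ### Stalk complexes in K^b(C) and generation -/

section FullSubcategory

variable {𝒯 : Type u} [Category.{v} 𝒯] [HasZeroObject 𝒯] [HasShift 𝒯 ℤ] [Preadditive 𝒯]
  [∀ n : ℤ, (shiftFunctor 𝒯 n).Additive] [Pretriangulated 𝒯]
  {𝒯' : Type u'} [Category.{v'} 𝒯'] [HasZeroObject 𝒯'] [HasShift 𝒯' ℤ] [Preadditive 𝒯']
  [∀ n : ℤ, (shiftFunctor 𝒯' n).Additive] [Pretriangulated 𝒯']

theorem HomVanish.of_map (Φ : 𝒯 ⥤ 𝒯') [Φ.CommShift ℤ] [Φ.Faithful] [Φ.PreservesZeroMorphisms]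
    {W X : 𝒯} {n : ℤ}
    (h : HomVanish (Φ.obj W) (Φ.obj X) n) : HomVanish W X n := by
  intro f
  apply Φ.map_injective
  rw [Φ.map_zero, ← cancel_mono ((Φ.commShiftIso n).hom.app X), zero_comp]
  exact h _

/-- Distinguished triangles with vertices in a triangulated subcategory can be lifted to it. -/
theorem exists_triangle_fullSubcategory (P : ObjectProperty 𝒯) [P.IsTriangulated]
    {X Y Z : P.FullSubcategory} {f : X.obj ⟶ Y.obj} {g : Y.obj ⟶ Z.obj}
    {h : Z.obj ⟶ X.obj⟦(1 : ℤ)⟧} (hT : Triangle.mk f g h ∈ distTriang 𝒯) :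
    ∃ h' : Z ⟶ X⟦(1 : ℤ)⟧,
      Triangle.mk (ObjectProperty.homMk f) (ObjectProperty.homMk g) h' ∈
        distTriang P.FullSubcategory := by
  refine ⟨ObjectProperty.homMk (h ≫ (P.ι.commShiftIso (1 : ℤ)).inv.app X),
    isomorphic_distinguished _ hT _ ?_⟩
  refine Triangle.isoMk _ _ (Iso.refl X.obj) (Iso.refl Y.obj) (Iso.refl Z.obj) ?_ ?_ ?_
  · exact (Category.comp_id f).trans (Category.id_comp f).symm
  · exact (Category.comp_id g).trans (Category.id_comp g).symm
  · change ((h ≫ (P.ι.commShiftIso (1 : ℤ)).inv.app X) ≫ (P.ι.commShiftIso (1 : ℤ)).hom.app X) ≫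
      (𝟙 X.obj)⟦(1 : ℤ)⟧' = 𝟙 Z.obj ≫ h
    have h1 : (h ≫ (P.ι.commShiftIso (1 : ℤ)).inv.app X) ≫ (P.ι.commShiftIso (1 : ℤ)).hom.app X =
        h := by
      rw [Category.assoc, (P.ι.commShiftIso (1 : ℤ)).inv_hom_id_app X]
      exact Category.comp_id h
    have h2 : (𝟙 X.obj)⟦(1 : ℤ)⟧' = 𝟙 _ := CategoryTheory.Functor.map_id _ _
    exact (congrArg₂ (· ≫ ·) h1 h2).trans ((Category.comp_id h).trans (Category.id_comp h).symm)

end FullSubcategory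

section Stalk

variable (C : Type u) [Category.{v} C] [Preadditive C] [HasZeroObject C]

instance (n : ℤ) : (HomotopyCategory.singleFunctor C n).Full :=
  inferInstanceAs (CochainComplex.singleFunctor C n ⋙ HomotopyCategory.quotient _ _).Full

variable {C}

theorem quotient_map_single_eq_zero {X : C} {K : CochainComplex C ℤ} {n : ℤ}
    (hK : IsZero (K.X n)) (f : (CochainComplex.singleFunctor C n).obj X ⟶ K) : f = 0 :=
  HomologicalComplex.from_single_hom_ext (hK.eq_of_tgt _ _)

theorem homVanish_single {X Y : C} {n : ℤ} (hn : n ≠ 0) :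
    HomVanish ((HomotopyCategory.singleFunctor C 0).obj X)
      ((HomotopyCategory.singleFunctor C 0).obj Y) n := by
  intro f
  let e := ((HomotopyCategory.singleFunctors C).shiftIso n (-n) 0 (by simp)).app Y
  let f' : (HomotopyCategory.singleFunctor C 0).obj X ⟶
    (HomotopyCategory.singleFunctor C (-n)).obj Y := f ≫ e.hom
  obtain ⟨g, hg⟩ := (HomotopyCategory.quotient C (ComplexShape.up ℤ)).map_surjective f'
  have hg0 : g = 0 := quotient_map_single_eq_zero
    (HomologicalComplex.isZero_single_obj_X _ _ _ _ (by lia)) g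
  rw [← cancel_mono e.hom, zero_comp]
  change f' = 0
  rw [← hg, hg0]
  exact Functor.map_zero _ _ _

/-- The homotopy components that could contribute in degree n start or end at a zero object, so
homotopic maps of stalks are equal. -/
instance (n : ℤ) : (HomotopyCategory.singleFunctor C n).Faithful where
  map_injective {X Y} f g h := by
    have h' := HomotopyCategory.homotopyOfEq _ _ h
    apply (CochainComplex.singleFunctor C n).map_injective
    refine HomologicalComplex.from_single_hom_ext ?_
    rw [h'.comm n, dNext_eq _ (show (ComplexShape.up ℤ).Rel n (n + 1) from rfl),
      prevD_eq _ (show (ComplexShape.up ℤ).Rel (n - 1) n by simp)]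
    have h₁ : h'.hom n (n - 1) = 0 :=
      (HomologicalComplex.isZero_single_obj_X _ _ _ _ (by lia)).eq_of_tgt _ _
    have h₂ : h'.hom (n + 1) n = 0 :=
      (HomologicalComplex.isZero_single_obj_X _ _ _ _ (by lia)).eq_of_src _ _
    rw [h₁, h₂, comp_zero, zero_comp, add_zero, zero_add]

end Stalk

section Kb

variable (C : Type u) [Category.{v} C] [Preadditive C] [HasZeroObject C] [HasBinaryBiproducts C]

theorem bounded_singleFunctor_obj (X : C) :
    bounded C ((HomotopyCategory.singleFunctor C 0).obj X) :=
  (stalk C X).property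

/-- The objects of `C` as complexes concentrated in degree `0`. -/
noncomputable def stalkFunctor : C ⥤ Kb C :=
  (bounded C).lift (HomotopyCategory.singleFunctor C 0) (bounded_singleFunctor_obj C)

instance : (stalkFunctor C).Full := by
  dsimp only [stalkFunctor]
  infer_instance

instance : (stalkFunctor C).Faithful := by
  dsimp only [stalkFunctor]
  infer_instance

instance : (stalkFunctor C).Additive where
  map_add := ObjectProperty.hom_ext _ ((HomotopyCategory.singleFunctor C 0).map_add)

variable {C}

theorem homVanish_stalk {X Y : C} {n : ℤ} (hn : n ≠ 0) :
    HomVanish ((stalkFunctor C).obj X) ((stalkFunctor C).obj Y) n :=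
  HomVanish.of_map (bounded C).ι (homVanish_single hn)

theorem hasLift_id_embeddingUpIntLE (K : CochainComplex C ℤ) (n : ℤ) :
    (ComplexShape.embeddingUpIntLE n).HasLift
      (𝟙 (K.restriction (ComplexShape.embeddingUpIntLE n))) :=
  fun _ hj => hj.false_of_isTruncLE.elim

/-- The projection of a complex onto its stupid truncation. -/
noncomputable def toStupidTrunc (K : CochainComplex C ℤ) (n : ℤ) :
    K ⟶ K.stupidTrunc (ComplexShape.embeddingUpIntLE n) :=
  (ComplexShape.embeddingUpIntLE n).liftExtend (𝟙 _) (hasLift_id_embeddingUpIntLE K n)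

theorem isIso_toStupidTrunc_f (K : CochainComplex C ℤ) (n i : ℤ) (hi : i ≤ n) :
    IsIso ((toStupidTrunc K n).f i) := by
  obtain ⟨k, hk⟩ := Int.le.dest hi
  exact (ComplexShape.Embedding.isIso_liftExtend_f_iff (ComplexShape.embeddingUpIntLE n) _
    (hasLift_id_embeddingUpIntLE K n) (i := k) (by
      change n - k = i
      lia)).2 (inferInstanceAs (IsIso (𝟙 _)))

/-- Induction on the number of degrees in the support. The top term K^b is a subcomplex whose
quotient is the stupid truncation below b; the sequence splits in each degree and so gives a
triangle. For `k = 0` the interval is empty and K is zero. -/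
theorem prop_of_bounded (E : ObjectProperty (Kb C)) [E.IsTriangulated]
    [E.IsClosedUnderIsomorphisms] (hE : ∀ X : C, E ((stalkFunctor C).obj X)) (k : ℕ) :
    ∀ (K : CochainComplex C ℤ) (a b : ℤ) (_ : b < a + k) (ha : K.IsStrictlyGE a)
      (hb : K.IsStrictlyLE b),
      E ⟨(HomotopyCategory.quotient C _).obj K, (bounded_quotient_obj_iff C K).2 ⟨a, b, ha, hb⟩⟩ := by
  induction k with
  | zero =>
    intro K a b hab ha hb
    refine E.prop_of_isZero ?_
    rw [IsZero.iff_id_eq_zero]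
    apply ObjectProperty.hom_ext
    refine (IsZero.eq_of_src ?_ _ _)
    refine Functor.map_isZero (HomotopyCategory.quotient C (ComplexShape.up ℤ)) (X := K) ?_
    rw [IsZero.iff_id_eq_zero]
    ext i
    rcases lt_or_ge i a with h | h
    · exact (K.isZero_of_isStrictlyGE a i h).eq_of_src _ _
    · exact (K.isZero_of_isStrictlyLE b i (by lia)).eq_of_src _ _
  | succ k ih =>
    intro K a b hab ha hb
    have hd : ∀ i, (ComplexShape.up ℤ).Rel b i → 𝟙 (K.X b) ≫ K.d b i = 0 := fun i hi =>
      (K.isZero_of_isStrictlyLE b i (by change b + 1 = i at hi; lia)).eq_of_tgt _ _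
    let K' : CochainComplex C ℤ := K.stupidTrunc (ComplexShape.embeddingUpIntLE (b - 1))
    have hK' : K'.IsStrictlyGE a := by dsimp only [K']; infer_instance
    have hK'' : K'.IsStrictlyLE (b - 1) := by dsimp only [K']; infer_instance
    let S : ShortComplex (CochainComplex C ℤ) :=
      { X₁ := (CochainComplex.singleFunctor C b).obj (K.X b)
        X₂ := K
        X₃ := K'
        f := HomologicalComplex.mkHomFromSingle (𝟙 (K.X b)) hd
        g := toStupidTrunc K (b - 1)
        zero := HomologicalComplex.from_single_hom_ext
          ((K'.isZero_of_isStrictlyLE (b - 1) b (by lia)).eq_of_tgt _ _) }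
    have hS₁ : ∀ i, i ≠ b → IsZero (S.X₁.X i) := fun i hi =>
      HomologicalComplex.isZero_single_obj_X _ _ _ _ hi
    let σ : ∀ n, (S.map (HomologicalComplex.eval C _ n)).Splitting := fun n =>
      if hn : n = b then ShortComplex.Splitting.ofIsIsoOfIsZero _ (by
          subst hn
          change IsIso ((HomologicalComplex.mkHomFromSingle (𝟙 (K.X n)) hd).f n)
          rw [HomologicalComplex.mkHomFromSingle_f]
          infer_instance)
        (K'.isZero_of_isStrictlyLE (b - 1) n (by lia))
      else if hn' : n < b then ShortComplex.Splitting.ofIsZeroOfIsIso _ (hS₁ n hn)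
        (isIso_toStupidTrunc_f K (b - 1) n (by lia))
      else ShortComplex.Splitting.ofIsZeroOfIsIso _ (hS₁ n hn)
        ⟨0, (K.isZero_of_isStrictlyLE b n (by lia)).eq_of_src _ _,
          (K'.isZero_of_isStrictlyLE (b - 1) n (by lia)).eq_of_src _ _⟩
    have hT := (HomotopyCategory.distinguished_iff_iso_trianglehOfDegreewiseSplit _).2
      ⟨S, σ, ⟨Iso.refl _⟩⟩
    have h₁ : bounded C ((HomotopyCategory.quotient C _).obj S.X₁) :=
      (bounded_quotient_obj_iff C S.X₁).2 ⟨b, b, inferInstanceAs (CochainComplex.IsStrictlyGE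
        ((HomologicalComplex.single C (ComplexShape.up ℤ) b).obj (K.X b)) b),
        inferInstanceAs (CochainComplex.IsStrictlyLE
        ((HomologicalComplex.single C (ComplexShape.up ℤ) b).obj (K.X b)) b)⟩
    have h₃ := ih K' a (b - 1) (by push_cast at hab; lia) hK' hK''
    obtain ⟨h', hT'⟩ := exists_triangle_fullSubcategory (bounded C)
      (X := ⟨(HomotopyCategory.quotient C _).obj S.X₁, h₁⟩)
      (Y := ⟨(HomotopyCategory.quotient C _).obj K, (bounded_quotient_obj_iff C K).2 ⟨a, b, ha, hb⟩⟩)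
      (Z := ⟨(HomotopyCategory.quotient C _).obj K', _⟩) hT
    refine E.ext_of_isTriangulatedClosed₂ _ hT' ?_ h₃
    refine E.prop_of_iso ?_ (E.le_shift (-b) _ (hE (K.X b)))
    exact (bounded C).fullyFaithfulι.preimageIso
      (((bounded C).ι.commShiftIso (-b)).app ((stalkFunctor C).obj (K.X b)) ≪≫
        ((HomotopyCategory.singleFunctors C).shiftIso (-b) b 0 (by simp)).app (K.X b))

theorem isClassicalTriangulatedGenerator_stalk {A : C}
    (hA : ∀ X : C, InAdd ((stalkFunctor C).obj A) ((stalkFunctor C).obj X)) :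
    (ObjectProperty.singleton ((stalkFunctor C).obj A)).IsClassicalTriangulatedGenerator := by
  rw [ObjectProperty.isClassicalTriangulatedGenerator_iff, eq_top_iff]
  rintro ⟨K, hK⟩ -
  obtain ⟨K, rfl⟩ := HomotopyCategory.quotient_obj_surjective K
  obtain ⟨a, b, ha, hb⟩ := (bounded_quotient_obj_iff C K).1 hK
  -- The interval [a, b] has b + 1 - a degrees; truncation to 0 covers the case of an empty
  -- interval.
  refine prop_of_bounded _ (fun X => ?_) (b + 1 - a).toNat K a b ?_ ha hb
  · obtain ⟨n, Y, ⟨e⟩⟩ := hA X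
    let E := (ObjectProperty.singleton ((stalkFunctor C).obj A)).triangEnvelope
    have h := E.prop_product (f := fun _ : Fin n => (stalkFunctor C).obj A)
      (fun _ => ObjectProperty.le_triangEnvelope _ _ (by simp))
    exact E.prop_of_retract
      { i := biprod.inl ≫ e.hom
        r := e.inv ≫ biprod.fst
        retract := by simp } (E.prop_of_iso (biproduct.isoProduct _).symm h)
  · have := Int.self_le_toNat (b + 1 - a)
    lia

end Kb

/-! ### The duality on complexes induced by a contravariant functor -/

section Triangulated

variable {𝒯 : Type u} [Category.{v} 𝒯] [HasZeroObject 𝒯] [HasShift 𝒯 ℤ] [Preadditive 𝒯]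
  [∀ n : ℤ, (shiftFunctor 𝒯 n).Additive] [Pretriangulated 𝒯]

theorem exists_triangle_of_iso {X Y Z X' Y' Z' : 𝒯} {a : X ⟶ Y} {b : Y ⟶ Z} {c : Z ⟶ X⟦(1 : ℤ)⟧}
    (hT : Triangle.mk a b c ∈ distTriang 𝒯) (eX : X' ≅ X) (eY : Y' ≅ Y) (eZ : Z' ≅ Z)
    {a' : X' ⟶ Y'} {b' : Y' ⟶ Z'} (ha : a' ≫ eY.hom = eX.hom ≫ a) (hb : b' ≫ eZ.hom = eY.hom ≫ b) :
    ∃ c' : Z' ⟶ X'⟦(1 : ℤ)⟧, Triangle.mk a' b' c' ∈ distTriang 𝒯 := by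
  refine ⟨eZ.hom ≫ c ≫ eX.inv⟦(1 : ℤ)⟧', isomorphic_distinguished _ hT _
    (Triangle.isoMk _ _ eX eY eZ ha hb ?_)⟩
  change (eZ.hom ≫ c ≫ eX.inv⟦(1 : ℤ)⟧') ≫ eX.hom⟦(1 : ℤ)⟧' = eZ.hom ≫ c
  rw [Category.assoc, Category.assoc, ← Functor.map_comp, eX.inv_hom_id,
    CategoryTheory.Functor.map_id, Category.comp_id]

end Triangulated

open Opposite

section Complexes

variable {C : Type u} [Category.{v} C] [Preadditive C] (D : Cᵒᵖ ⥤ C) [D.Additive]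

/-- The complex obtained by applying a contravariant functor to a complex. -/
def dualComplex (K : CochainComplex C ℤ) : CochainComplex C ℤ where
  X n := D.obj (op (K.X (-n)))
  d i j := D.map (K.d (-j) (-i)).op
  shape i j hij := by
    rw [K.shape _ _ (fun h => hij (by simp only [ComplexShape.up_Rel] at h ⊢; lia)), op_zero,
      D.map_zero]
  d_comp_d' i j k _ _ := by
    rw [← D.map_comp, ← op_comp, K.d_comp_d, op_zero, D.map_zero]

variable {K L M : CochainComplex C ℤ}

/-- The action of a contravariant functor on morphisms of complexes. -/
def dualComplexMap (f : K ⟶ L) : dualComplex D L ⟶ dualComplex D K where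
  f n := D.map (f.f (-n)).op
  comm' i j _ := by
    have h := congrArg (fun t => D.map t.op) (f.comm (-j) (-i)).symm
    simp only [op_comp, D.map_comp] at h
    exact h

/-- The action of a contravariant functor on homotopies. -/
def dualHomotopy {f g : K ⟶ L} (h : Homotopy f g) :
    Homotopy (dualComplexMap D f) (dualComplexMap D g) where
  hom i j := D.map (h.hom (-j) (-i)).op
  zero i j hij := by
    rw [h.zero _ _ (fun h => hij (by simp only [ComplexShape.up_Rel] at h ⊢; lia)), op_zero,
      D.map_zero]
    rfl
  comm n := by
    let hh : ∀ i j, (dualComplex D L).X i ⟶ (dualComplex D K).X j :=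
      fun i j => D.map (h.hom (-j) (-i)).op
    change (dualComplexMap D f).f n = dNext n hh + prevD n hh + (dualComplexMap D g).f n
    rw [dNext_eq hh (show (ComplexShape.up ℤ).Rel n (n + 1) from rfl),
      prevD_eq hh (show (ComplexShape.up ℤ).Rel (n - 1) n by simp)]
    change D.map (f.f (-n)).op = D.map (L.d (-(n + 1)) (-n)).op ≫ D.map (h.hom (-n) (-(n + 1))).op +
      D.map (h.hom (-(n - 1)) (-n)).op ≫ D.map (K.d (-n) (-(n - 1))).op + D.map (g.f (-n)).op
    rw [← D.map_comp, ← D.map_comp, ← D.map_add, ← D.map_add, ← op_comp, ← op_comp, ← op_add,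
      ← op_add, h.comm (-n), dNext_eq _ (show (ComplexShape.up ℤ).Rel (-n) (-(n - 1)) by
        change -n + 1 = -(n - 1); lia),
      prevD_eq _ (show (ComplexShape.up ℤ).Rel (-(n + 1)) (-n) by simp)]
    congr 3
    exact add_comm _ _

theorem dualComplexMap_id : dualComplexMap D (𝟙 K) = 𝟙 _ := by
  ext n
  change D.map (𝟙 (K.X (-n))).op = 𝟙 _
  rw [op_id, D.map_id]

theorem dualComplexMap_comp (f : K ⟶ L) (g : L ⟶ M) :
    dualComplexMap D (f ≫ g) = dualComplexMap D g ≫ dualComplexMap D f := by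
  ext n
  change D.map (f.f (-n) ≫ g.f (-n)).op = D.map (g.f (-n)).op ≫ D.map (f.f (-n)).op
  rw [op_comp, D.map_comp]

theorem dualComplexMap_add (f g : K ⟶ L) :
    dualComplexMap D (f + g) = dualComplexMap D f + dualComplexMap D g := by
  ext n
  change D.map (f.f (-n) + g.f (-n)).op = D.map (f.f (-n)).op + D.map (g.f (-n)).op
  rw [op_add, D.map_add]

variable (C) in
/-- `dualComplex` as a functor. -/
def dualComplexFunctor : CochainComplex C ℤ ⥤ (CochainComplex C ℤ)ᵒᵖ where
  obj K := op (dualComplex D K)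
  map f := (dualComplexMap D f).op
  map_id K := by rw [dualComplexMap_id, op_id]
  map_comp f g := by rw [dualComplexMap_comp, op_comp]

variable (C) in
/-- The contravariant functor induced on the homotopy category, as a functor to the opposite
category. -/
def dualHomotopyFunctorOp :
    HomotopyCategory C (ComplexShape.up ℤ) ⥤ (HomotopyCategory C (ComplexShape.up ℤ))ᵒᵖ :=
  CategoryTheory.Quotient.lift _ (dualComplexFunctor C D ⋙ (HomotopyCategory.quotient C _).op) (by
    rintro K L f g ⟨h⟩
    exact congrArg Quiver.Hom.op (HomotopyCategory.eq_of_homotopy _ _ (dualHomotopy D h)))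

variable (C) in
/-- The contravariant functor induced on the homotopy category. -/
def dualHomotopyFunctor :
    (HomotopyCategory C (ComplexShape.up ℤ))ᵒᵖ ⥤ HomotopyCategory C (ComplexShape.up ℤ) :=
  (dualHomotopyFunctorOp C D).leftOp

instance : (dualHomotopyFunctor C D).Additive where
  map_add {X Y} f g := by
    obtain ⟨f', hf⟩ := (HomotopyCategory.quotient C _).map_surjective f.unop
    obtain ⟨g', hg⟩ := (HomotopyCategory.quotient C _).map_surjective g.unop
    obtain rfl : ((HomotopyCategory.quotient C _).map f').op = f := congrArg Quiver.Hom.op hf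
    obtain rfl : ((HomotopyCategory.quotient C _).map g').op = g := congrArg Quiver.Hom.op hg
    exact (congrArg (HomotopyCategory.quotient C _).map (dualComplexMap_add D f' g')).trans
      (Functor.map_add _)

variable {D}

/-- A complex is isomorphic to its double dual. -/
def dualDualIso (η : D.rightOp ⋙ D ≅ 𝟭 C) (K : CochainComplex C ℤ) :
    dualComplex D (dualComplex D K) ≅ K :=
  HomologicalComplex.Hom.isoOfComponents
    (fun n => η.app (K.X (- -n)) ≪≫ K.XIsoOfEq (neg_neg n)) (by
      intro i j _
      have h := η.hom.naturality (K.d (- -i) (- -j))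
      change D.map (D.map (K.d (- -i) (- -j)).op).op ≫ η.hom.app (K.X (- -j)) =
        η.hom.app (K.X (- -i)) ≫ K.d (- -i) (- -j) at h
      change (η.hom.app (K.X (- -i)) ≫ (K.XIsoOfEq (neg_neg i)).hom) ≫ K.d i j =
        D.map (D.map (K.d (- -i) (- -j)).op).op ≫ η.hom.app (K.X (- -j)) ≫
          (K.XIsoOfEq (neg_neg j)).hom
      rw [reassoc_of% h, Category.assoc, HomologicalComplex.XIsoOfEq_hom_comp_d,
        HomologicalComplex.d_comp_XIsoOfEq_hom])

theorem dualDualIso_naturality (η : D.rightOp ⋙ D ≅ 𝟭 C) (f : K ⟶ L) :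
    dualComplexMap D (dualComplexMap D f) ≫ (dualDualIso η L).hom = (dualDualIso η K).hom ≫ f := by
  ext n
  have h := η.hom.naturality (f.f (- -n))
  change D.map (D.map (f.f (- -n)).op).op ≫ η.hom.app (L.X (- -n)) =
    η.hom.app (K.X (- -n)) ≫ f.f (- -n) at h
  change D.map (D.map (f.f (- -n)).op).op ≫ η.hom.app (L.X (- -n)) ≫
    (L.XIsoOfEq (neg_neg n)).hom = (η.hom.app (K.X (- -n)) ≫ (K.XIsoOfEq (neg_neg n)).hom) ≫ f.f n
  rw [reassoc_of% h, Category.assoc, HomologicalComplex.XIsoOfEq_hom_naturality]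

/-- The double dual on the homotopy category. -/
def dualHomotopyFunctorInvol (η : D.rightOp ⋙ D ≅ 𝟭 C) :
    (dualHomotopyFunctor C D).rightOp ⋙ dualHomotopyFunctor C D ≅ 𝟭 _ :=
  NatIso.ofComponents (fun X => (HomotopyCategory.quotient C _).mapIso (dualDualIso η X.as)) (by
    intro X Y f
    obtain ⟨f, rfl⟩ := (HomotopyCategory.quotient C _).map_surjective f
    change (HomotopyCategory.quotient C _).map (dualComplexMap D (dualComplexMap D f)) ≫
      (HomotopyCategory.quotient C _).map (dualDualIso η Y.as).hom =
      (HomotopyCategory.quotient C _).map (dualDualIso η X.as).hom ≫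
        (HomotopyCategory.quotient C _).map f
    rw [← Functor.map_comp, ← Functor.map_comp]
    exact congrArg _ (dualDualIso_naturality η f))

/-- Both halves of "F is an equivalence" follow by cancelling one factor of the composite F² ≅ 1. -/
theorem faithful_of_invol {𝒜 : Type u'} [Category.{v'} 𝒜] {F : 𝒜ᵒᵖ ⥤ 𝒜}
    (η : F.rightOp ⋙ F ≅ 𝟭 𝒜) : F.Faithful := by
  have h₁ : (F.rightOp ⋙ F).Faithful := Functor.Faithful.of_iso η.symm
  have h₂ : F.rightOp.Faithful := Functor.Faithful.of_comp F.rightOp F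
  exact ⟨fun {X Y} f g h => Quiver.Hom.unop_inj (F.rightOp.map_injective (congrArg Quiver.Hom.op h))⟩

theorem full_of_invol {𝒜 : Type u'} [Category.{v'} 𝒜] {F : 𝒜ᵒᵖ ⥤ 𝒜}
    (η : F.rightOp ⋙ F ≅ 𝟭 𝒜) : F.Full := by
  have h₀ := faithful_of_invol η
  have h₁ : (F.rightOp ⋙ F).Full := Functor.Full.of_iso η.symm
  have h₂ : F.rightOp.Full := Functor.Full.of_comp_faithful F.rightOp F
  refine ⟨fun {X Y} f => ?_⟩
  obtain ⟨g, hg⟩ := F.rightOp.map_surjective (X := Y.unop) (Y := X.unop) f.op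
  exact ⟨g.op, congrArg Quiver.Hom.unop hg⟩

/-- The dual of a shifted complex. -/
def dualShiftIso (D : Cᵒᵖ ⥤ C) [D.Additive] (K : CochainComplex C ℤ) (n : ℤ) :
    dualComplex D (K⟦n⟧) ≅ (dualComplex D K)⟦-n⟧ :=
  HomologicalComplex.Hom.isoOfComponents
    (fun i => D.mapIso (K.XIsoOfEq (show -(i + -n) = -i + n by lia)).op) (by
      intro i j _
      change D.map (K.XIsoOfEq (show -(i + -n) = -i + n by lia)).hom.op ≫
        ((-n).negOnePow • D.map (K.d (-(j + -n)) (-(i + -n))).op) =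
        D.map (n.negOnePow • K.d (-j + n) (-i + n)).op ≫
          D.map (K.XIsoOfEq (show -(j + -n) = -j + n by lia)).hom.op
      have h : K.d (-(j + -n)) (-(i + -n)) ≫ (K.XIsoOfEq (show -(i + -n) = -i + n by lia)).hom =
          (K.XIsoOfEq (show -(j + -n) = -j + n by lia)).hom ≫ K.d (-j + n) (-i + n) := by
        rw [HomologicalComplex.XIsoOfEq_hom_comp_d, HomologicalComplex.d_comp_XIsoOfEq_hom]
      have h' := congrArg (fun f => D.map f.op) h
      simp only [op_comp, D.map_comp] at h'
      -- The sign (-1)ⁿ passes through the additive functor `D` and agrees with (-1)⁻ⁿ, so the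
      -- differentials match without correcting signs on objects.
      have h'' : D.map (n.negOnePow • K.d (-j + n) (-i + n)).op =
          n.negOnePow • D.map (K.d (-j + n) (-i + n)).op := by
        rcases Int.even_or_odd n with hn | hn
        · simp [Int.negOnePow_even _ hn]
        · simp [Int.negOnePow_odd _ hn]
      rw [h'', Int.negOnePow_neg, Linear.comp_units_smul, Linear.units_smul_comp, h'])

variable [HasZeroObject C] [HasBinaryBiproducts C]

/-- Distinguished triangles are those coming from degreewise split short exact sequences of
complexes. An additive contravariant functor reverses such sequences, exchanging sections and
retractions, so mapping cones never have to be dualized. -/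
theorem isDuality_dualHomotopyFunctor (η : D.rightOp ⋙ D ≅ 𝟭 C) :
    IsDuality (dualHomotopyFunctor C D) where
  shift X n := by
    obtain ⟨K, rfl⟩ := HomotopyCategory.quotient_obj_surjective X
    exact ⟨(dualHomotopyFunctor C D).mapIso
      (((HomotopyCategory.quotient C _).commShiftIso n).app K).op ≪≫
      (HomotopyCategory.quotient C _).mapIso (dualShiftIso D K n) ≪≫
      ((HomotopyCategory.quotient C _).commShiftIso (-n)).app (dualComplex D K)⟩
  triangle {X Y Z f g h} hT := by
    obtain ⟨S, σ, ⟨e⟩⟩ :=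
      (HomotopyCategory.distinguished_iff_iso_trianglehOfDegreewiseSplit _).1 hT
    let S' : ShortComplex (CochainComplex C ℤ) :=
      { X₁ := dualComplex D S.X₃
        X₂ := dualComplex D S.X₂
        X₃ := dualComplex D S.X₁
        f := dualComplexMap D S.g
        g := dualComplexMap D S.f
        zero := by
          rw [← dualComplexMap_comp, S.zero]
          ext n
          change D.map (0 : S.X₁.X (-n) ⟶ S.X₃.X (-n)).op = 0
          rw [op_zero, D.map_zero] }
    let σ' : ∀ n, (S'.map (HomologicalComplex.eval C _ n)).Splitting := fun n =>
      { r := D.map (σ (-n)).s.op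
        s := D.map (σ (-n)).r.op
        f_r := by
          have := congrArg (fun f => D.map f.op) (σ (-n)).s_g
          simp only [op_comp, D.map_comp, op_id, D.map_id] at this
          exact this
        s_g := by
          have := congrArg (fun f => D.map f.op) (σ (-n)).f_r
          simp only [op_comp, D.map_comp, op_id, D.map_id] at this
          exact this
        id := by
          have := congrArg (fun f => D.map f.op) (σ (-n)).id
          simp only [op_comp, D.map_comp, op_id, D.map_id, op_add, D.map_add] at this
          rw [add_comm] at this
          exact this }
    have hT' := (HomotopyCategory.distinguished_iff_iso_trianglehOfDegreewiseSplit _).2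
      ⟨S', σ', ⟨Iso.refl _⟩⟩
    let G := dualHomotopyFunctor C D
    let e₁ : X ≅ (HomotopyCategory.quotient C _).obj S.X₁ := Triangle.π₁.mapIso e
    let e₂ : Y ≅ (HomotopyCategory.quotient C _).obj S.X₂ := Triangle.π₂.mapIso e
    let e₃ : Z ≅ (HomotopyCategory.quotient C _).obj S.X₃ := Triangle.π₃.mapIso e
    have c₁ : f ≫ e₂.hom = e₁.hom ≫ (HomotopyCategory.quotient C _).map S.f := e.hom.comm₁
    have c₂ : g ≫ e₃.hom = e₂.hom ≫ (HomotopyCategory.quotient C _).map S.g := e.hom.comm₂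
    refine exists_triangle_of_iso hT' (G.mapIso e₃.symm.op) (G.mapIso e₂.symm.op)
      (G.mapIso e₁.symm.op) ?_ ?_
    · have h : e₂.inv ≫ g = (HomotopyCategory.quotient C _).map S.g ≫ e₃.inv := by
        rw [Iso.inv_comp_eq, ← Category.assoc, ← c₂, Category.assoc, e₃.hom_inv_id,
          Category.comp_id]
      have h' := congrArg (fun t => G.map t.op) h
      simp only [op_comp, G.map_comp] at h'
      exact h'
    · have h : e₁.inv ≫ f = (HomotopyCategory.quotient C _).map S.f ≫ e₂.inv := by
        rw [Iso.inv_comp_eq, ← Category.assoc, ← c₁, Category.assoc, e₂.hom_inv_id,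
          Category.comp_id]
      have h' := congrArg (fun t => G.map t.op) h
      simp only [op_comp, G.map_comp] at h'
      exact h'
  invol X := ⟨(dualHomotopyFunctorInvol η).app X⟩

theorem bounded_dual {X : HomotopyCategory C (ComplexShape.up ℤ)} (hX : bounded C X) :
    bounded C ((dualHomotopyFunctor C D).obj (op X)) := by
  obtain ⟨K : CochainComplex C ℤ, rfl⟩ := HomotopyCategory.quotient_obj_surjective X
  obtain ⟨a, b, ha, hb⟩ := (bounded_quotient_obj_iff C K).1 hX
  refine (bounded_quotient_obj_iff C (dualComplex D K)).2 ⟨-b, -a, ?_, ?_⟩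
  · rw [CochainComplex.isStrictlyGE_iff]
    intro i hi
    exact D.map_isZero (CochainComplex.isZero_of_isStrictlyLE K b (-i) (by lia)).op
  · rw [CochainComplex.isStrictlyLE_iff]
    intro i hi
    exact D.map_isZero (CochainComplex.isZero_of_isStrictlyGE K a (-i) (by lia)).op

variable (D) in
/-- The duality on bounded complexes. -/
def dualKb : (Kb C)ᵒᵖ ⥤ Kb C :=
  (bounded C).lift ((bounded C).ι.op ⋙ dualHomotopyFunctor C D) (fun X => bounded_dual X.unop.2)

instance : (dualKb D).Additive where
  map_add := by
    intro X Y f g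
    exact ObjectProperty.hom_ext _ ((dualHomotopyFunctor C D).map_add
      (f := ((bounded C).ι.map f.unop).op) (g := ((bounded C).ι.map g.unop).op))

theorem dualKb_full (η : D.rightOp ⋙ D ≅ 𝟭 C) : (dualKb D).Full := by
  have := full_of_invol (dualHomotopyFunctorInvol η)
  dsimp only [dualKb]
  infer_instance

theorem dualKb_faithful (η : D.rightOp ⋙ D ≅ 𝟭 C) : (dualKb D).Faithful := by
  have := faithful_of_invol (dualHomotopyFunctorInvol η)
  dsimp only [dualKb]
  infer_instance

theorem isDuality_dualKb (η : D.rightOp ⋙ D ≅ 𝟭 C) : IsDuality (dualKb D) where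
  shift X n := by
    obtain ⟨e⟩ := (isDuality_dualHomotopyFunctor η).shift X.obj n
    exact ⟨(bounded C).fullyFaithfulι.preimageIso ((dualHomotopyFunctor C D).mapIso
      (((bounded C).ι.commShiftIso n).app X).symm.op ≪≫ e ≪≫
      (((bounded C).ι.commShiftIso (-n)).app ((dualKb D).obj (op X))).symm)⟩
  triangle {X Y Z f g h} hT := by
    have hT₁ : Triangle.mk f.hom g.hom (h.hom ≫ ((bounded C).ι.commShiftIso (1 : ℤ)).hom.app X) ∈
      distTriang _ := (bounded C).ι.map_distinguished _ hT
    obtain ⟨h', hT'⟩ := (isDuality_dualHomotopyFunctor η).triangle hT₁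
    exact exists_triangle_fullSubcategory (bounded C) (X := (dualKb D).obj (op Z))
      (Y := (dualKb D).obj (op Y)) (Z := (dualKb D).obj (op X)) hT'
  invol X := by
    obtain ⟨e⟩ := (isDuality_dualHomotopyFunctor η).invol X.obj
    exact ⟨(bounded C).fullyFaithfulι.preimageIso e⟩

theorem isIso_mkHomToSingle_f {K : CochainComplex C ℤ} {X : C} {n : ℤ} (φ : K.X n ⟶ X) [IsIso φ]
    (hφ : ∀ i, (ComplexShape.up ℤ).Rel i n → K.d i n ≫ φ = 0) :
    IsIso ((HomologicalComplex.mkHomToSingle φ hφ).f n) := by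
  rw [HomologicalComplex.mkHomToSingle_f]
  infer_instance

/-- The dual of a complex concentrated in degree `0`. -/
theorem nonempty_dualKb_stalk (X : C) :
    Nonempty ((dualKb D).obj (op ((stalkFunctor C).obj X)) ≅
      (stalkFunctor C).obj (D.obj (op X))) := by
  let L := (CochainComplex.singleFunctor C 0).obj X
  have hL : ∀ i, i ≠ 0 → IsZero (D.obj (op (L.X (-i)))) := fun i hi =>
    D.map_isZero (HomologicalComplex.isZero_single_obj_X _ _ _ _ (by lia)).op
  let e₀ : (dualComplex D L).X 0 ≅ D.obj (op X) :=
    D.mapIso (HomologicalComplex.singleObjXSelf (ComplexShape.up ℤ) 0 X).symm.op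
  let f : dualComplex D L ⟶ (CochainComplex.singleFunctor C 0).obj (D.obj (op X)) :=
    HomologicalComplex.mkHomToSingle (j := (0 : ℤ)) e₀.hom (fun i hi =>
      (hL i (by change i + 1 = 0 at hi; lia)).eq_of_src _ _)
  have hf : ∀ i, IsIso (f.f i) := by
    intro i
    by_cases hi : i = 0
    · subst hi
      exact isIso_mkHomToSingle_f _ _
    · exact ⟨0, (hL i hi).eq_of_src _ _,
        (HomologicalComplex.isZero_single_obj_X _ _ _ _ hi).eq_of_src _ _⟩
  have hf' : IsIso f := HomologicalComplex.Hom.isIso_of_components f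
  exact ⟨(bounded C).fullyFaithfulι.preimageIso
    ((HomotopyCategory.quotient C _).mapIso (@asIso _ _ _ _ f hf'))⟩

end Complexes

/-! ### Projective modules over a ring with involution and the duality Hom(-, Λ) -/

section ProjCat

variable {Λ : Type w} [Ring Λ]

/-- The linear map underlying a morphism of `proj Λ`. -/
def toLin {X Y : ProjCat Λ} (f : X ⟶ Y) : X.obj →ₗ[Λᵐᵒᵖ] Y.obj := f.hom.hom

/-- A linear map, as a morphism of `proj Λ`. -/
def ofLin {X Y : ProjCat Λ} (f : X.obj →ₗ[Λᵐᵒᵖ] Y.obj) : X ⟶ Y :=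
  ObjectProperty.homMk (ModuleCat.ofHom f)

theorem toLin_injective {X Y : ProjCat Λ} {f g : X ⟶ Y} (h : toLin f = toLin g) : f = g :=
  ObjectProperty.hom_ext _ (ModuleCat.hom_ext h)

/-- `toLin` as an additive homomorphism. -/
def toLinHom (X Y : ProjCat Λ) : (X ⟶ Y) →+ (X.obj →ₗ[Λᵐᵒᵖ] Y.obj) where
  toFun := toLin
  map_zero' := rfl
  map_add' _ _ := rfl

theorem toLin_sum {X Y : ProjCat Λ} {ι : Type*} (s : Finset ι) (f : ι → (X ⟶ Y)) :
    toLin (∑ i ∈ s, f i) = ∑ i ∈ s, toLin (f i) :=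
  map_sum (toLinHom X Y) f s

/-- An isomorphism of `proj Λ` from a linear equivalence. -/
def isoOfEquiv {X Y : ProjCat Λ} (f : X.obj ≃ₗ[Λᵐᵒᵖ] Y.obj) : X ≅ Y where
  hom := ofLin f.toLinearMap
  inv := ofLin f.symm.toLinearMap
  hom_inv_id := toLin_injective (LinearMap.ext f.symm_apply_apply)
  inv_hom_id := toLin_injective (LinearMap.ext f.apply_symm_apply)

theorem isIso_of_bijective {X Y : ProjCat Λ} (f : X ⟶ Y) (hf : Function.Bijective (toLin f)) :
    IsIso f := by
  have : f = (isoOfEquiv (LinearEquiv.ofBijective (toLin f) hf)).hom := toLin_injective rfl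
  rw [this]
  infer_instance

/-- The dual basis criterion. -/
theorem isFGProj_iff_exists_dualBasis (X : ModuleCat.{w} Λᵐᵒᵖ) :
    isFGProj Λ X ↔ ∃ (n : ℕ) (x : Fin n → X) (φ : Fin n → X →ₗ[Λᵐᵒᵖ] Λ),
      ∀ y : X, ∑ i, MulOpposite.op (φ i y) • x i = y := by
  constructor
  · rintro ⟨h₁, h₂⟩
    obtain ⟨n, f, hf⟩ := Module.Finite.exists_fin' Λᵐᵒᵖ X
    obtain ⟨g, hg⟩ := Module.projective_lifting_property f LinearMap.id hf
    refine ⟨n, fun i => f (Pi.single i 1),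
      fun i => (regularEquiv Λ).toLinearMap ∘ₗ LinearMap.proj i ∘ₗ g, fun y => ?_⟩
    have h := LinearMap.congr_fun hg y
    rw [LinearMap.comp_apply, LinearMap.id_apply, LinearMap.pi_apply_eq_sum_univ f] at h
    conv_rhs => rw [← h]
    refine Finset.sum_congr rfl fun i _ => ?_
    refine congrArg (fun t => g y i • f t) ?_
    ext j
    rw [Pi.single_apply]
    simp only [eq_comm]
  · rintro ⟨n, x, φ, h⟩
    let f : (Fin n → Λᵐᵒᵖ) →ₗ[Λᵐᵒᵖ] X := Fintype.linearCombination Λᵐᵒᵖ x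
    let g : X →ₗ[Λᵐᵒᵖ] (Fin n → Λᵐᵒᵖ) :=
      LinearMap.pi fun i => (regularEquiv Λ).symm.toLinearMap ∘ₗ φ i
    have hfg : f ∘ₗ g = LinearMap.id := LinearMap.ext fun y => by
      rw [LinearMap.comp_apply, LinearMap.id_apply, Fintype.linearCombination_apply]
      exact h y
    exact ⟨Module.Finite.of_surjective f fun y => ⟨g y, LinearMap.congr_fun hfg y⟩,
      Module.Projective.of_split g f hfg⟩

/-- The map of right modules `Λ ⟶ X` sending `1` to `x`. -/
def fromRegular {X : ProjCat Λ} (x : X.obj) : regularModule Λ ⟶ X :=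
  ofLin (X := regularModule Λ) (LinearMap.toSpanSingleton Λᵐᵒᵖ X.obj x ∘ₗ
    (regularEquiv Λ).symm.toLinearMap)

/-- A dual basis writes the identity of X as a sum of maps X ⟶ Λ ⟶ X. -/
theorem inAdd_stalk_regular (X : ProjCat Λ) :
    InAdd ((stalkFunctor (ProjCat Λ)).obj (regularModule Λ)) ((stalkFunctor _).obj X) := by
  obtain ⟨n, x, φ, h⟩ := (isFGProj_iff_exists_dualBasis X.obj).1 X.property
  refine inAdd_iff.2 ⟨n, fun i => (stalkFunctor _).map (ofLin (Y := regularModule Λ) (φ i)),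
    fun i => (stalkFunctor _).map (fromRegular (x i)), ?_⟩
  simp only [← Functor.map_comp]
  rw [← Functor.map_sum, ← CategoryTheory.Functor.map_id]
  congr 1
  apply toLin_injective
  rw [toLin_sum]
  ext y
  rw [LinearMap.sum_apply]
  exact h y

theorem mem_rightIdeal_self (e : Λ) : e ∈ rightIdeal e := mem_rightIdeal.2 ⟨1, (mul_one e).symm⟩

theorem mul_coe_rightIdeal {e : Λ} (he : IsIdempotentElem e) (x : rightIdeal e) :
    e * (x : Λ) = x := by
  obtain ⟨y, hy⟩ := mem_rightIdeal.1 x.2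
  rw [hy, ← mul_assoc, he.eq]

section Dual

variable [StarRing Λ]

/-- The dual `Hom(X, Λ)` of a right module over a ring with involution, as a right module. -/
def DualModule (X : Type w) [AddCommGroup X] [Module Λᵐᵒᵖ X] : Type w := X →ₗ[Λᵐᵒᵖ] Λ

namespace DualModule

variable {X Y Z : Type w} [AddCommGroup X] [Module Λᵐᵒᵖ X] [AddCommGroup Y] [Module Λᵐᵒᵖ Y]
  [AddCommGroup Z] [Module Λᵐᵒᵖ Z]

instance : AddCommGroup (DualModule (Λ := Λ) X) := inferInstanceAs (AddCommGroup (X →ₗ[Λᵐᵒᵖ] Λ))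

instance : FunLike (DualModule (Λ := Λ) X) X Λ := inferInstanceAs (FunLike (X →ₗ[Λᵐᵒᵖ] Λ) X Λ)

theorem ext {φ ψ : DualModule (Λ := Λ) X} (h : ∀ x, φ x = ψ x) : φ = ψ := LinearMap.ext h

theorem map_add' (φ : DualModule (Λ := Λ) X) (x y : X) : φ (x + y) = φ x + φ y :=
  LinearMap.map_add φ x y

theorem map_smul' (φ : DualModule (Λ := Λ) X) (a : Λᵐᵒᵖ) (x : X) : φ (a • x) = φ x * a.unop :=
  LinearMap.map_smul φ a x

/-- Multiplying values on the left makes Hom(X, Λ) a left module; `star` converts this into a right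
module structure. -/
instance : SMul Λᵐᵒᵖ (DualModule (Λ := Λ) X) where
  smul a φ :=
    ({ toFun := fun x => star a.unop * φ x
       map_add' := fun x y => by rw [map_add', mul_add]
       map_smul' := fun b x => by
        rw [map_smul', ← mul_assoc]
        rfl } : X →ₗ[Λᵐᵒᵖ] Λ)

theorem smul_apply (a : Λᵐᵒᵖ) (φ : DualModule (Λ := Λ) X) (x : X) :
    (a • φ) x = star a.unop * φ x := rfl

theorem add_apply (φ ψ : DualModule (Λ := Λ) X) (x : X) : (φ + ψ) x = φ x + ψ x := rfl

theorem zero_apply (x : X) : (0 : DualModule (Λ := Λ) X) x = 0 := rfl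

instance : Module Λᵐᵒᵖ (DualModule (Λ := Λ) X) where
  one_smul φ := ext fun x => by rw [smul_apply, MulOpposite.unop_one, star_one, one_mul]
  mul_smul a b φ := ext fun x => by
    rw [smul_apply, smul_apply, smul_apply, MulOpposite.unop_mul, star_mul, mul_assoc]
  smul_zero a := ext fun x => by rw [smul_apply, zero_apply, mul_zero]
  zero_smul φ := ext fun x => by
    rw [smul_apply, MulOpposite.unop_zero, star_zero, zero_mul, zero_apply]
  smul_add a φ ψ := ext fun x => by simp only [smul_apply, add_apply, mul_add]
  add_smul a b φ := ext fun x => by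
    simp only [smul_apply, add_apply, MulOpposite.unop_add, star_add, add_mul]

/-- The transpose of a linear map. -/
def map (f : X →ₗ[Λᵐᵒᵖ] Y) : DualModule (Λ := Λ) Y →ₗ[Λᵐᵒᵖ] DualModule (Λ := Λ) X where
  toFun φ := LinearMap.comp (show Y →ₗ[Λᵐᵒᵖ] Λ from φ) f
  map_add' _ _ := rfl
  map_smul' _ _ := rfl

/-- Evaluation at an element. -/
def eval (x : X) : DualModule (Λ := Λ) X →ₗ[Λᵐᵒᵖ] Λ where
  toFun φ := star (φ x)
  map_add' φ ψ := by rw [add_apply, star_add]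
  map_smul' a φ := by
    rw [smul_apply, star_mul, star_star]
    rfl

theorem eval_apply (x : X) (φ : DualModule (Λ := Λ) X) : eval x φ = star (φ x) := rfl

/-- The canonical map to the double dual. -/
def toDouble : X →ₗ[Λᵐᵒᵖ] DualModule (Λ := Λ) (DualModule (Λ := Λ) X) where
  toFun x := (eval x : DualModule (Λ := Λ) X →ₗ[Λᵐᵒᵖ] Λ)
  map_add' x y := ext fun φ => by
    change star (φ (x + y)) = star (φ x) + star (φ y)
    rw [map_add', star_add]
  map_smul' a x := ext fun φ => by
    change star (φ (a • x)) = star a.unop * star (φ x)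
    rw [map_smul', star_mul]

theorem toDouble_apply (x : X) (φ : DualModule (Λ := Λ) X) : toDouble x φ = star (φ x) := rfl

theorem map_sum' (φ : DualModule (Λ := Λ) X) {ι : Type*} (s : Finset ι) (x : ι → X) :
    φ (∑ i ∈ s, x i) = ∑ i ∈ s, φ (x i) :=
  map_sum (show X →ₗ[Λᵐᵒᵖ] Λ from φ) x s

theorem sum_apply {ι : Type*} (s : Finset ι) (φ : ι → DualModule (Λ := Λ) X) (x : X) :
    (∑ i ∈ s, φ i) x = ∑ i ∈ s, φ i x :=
  LinearMap.sum_apply s (fun i => (show X →ₗ[Λᵐᵒᵖ] Λ from φ i)) x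

/-- The coordinate functionals of X and the evaluations at its basis elements form a dual basis of
the dual. This shows both that duals are finitely generated projective and that biduality is
bijective. -/
theorem sum_dualBasis {n : ℕ} {x : Fin n → X} {ψ : Fin n → X →ₗ[Λᵐᵒᵖ] Λ}
    (h : ∀ y : X, ∑ i, MulOpposite.op (ψ i y) • x i = y) (φ : DualModule (Λ := Λ) X) :
    ∑ i, MulOpposite.op (eval (x i) φ) • (show DualModule (Λ := Λ) X from ψ i) = φ :=
  ext fun y => by
    conv_rhs => rw [← h y]
    rw [sum_apply, map_sum']
    refine Finset.sum_congr rfl fun i _ => ?_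
    rw [smul_apply, map_smul', MulOpposite.unop_op, MulOpposite.unop_op, eval_apply, star_star]
    rfl

theorem bijective_toDouble {n : ℕ} {x : Fin n → X} {ψ : Fin n → X →ₗ[Λᵐᵒᵖ] Λ}
    (h : ∀ y : X, ∑ i, MulOpposite.op (ψ i y) • x i = y) :
    Function.Bijective (toDouble : X →ₗ[Λᵐᵒᵖ] DualModule (Λ := Λ) (DualModule (Λ := Λ) X)) := by
  constructor
  · rw [injective_iff_map_eq_zero]
    intro y hy
    rw [← h y]
    refine Finset.sum_eq_zero fun i _ => ?_
    have h1 : star (ψ i y) = 0 := DFunLike.congr_fun hy (show DualModule (Λ := Λ) X from ψ i)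
    rw [star_eq_zero.1 h1, MulOpposite.op_zero, zero_smul]
  · intro θ
    refine ⟨∑ i, MulOpposite.op (star (θ (show DualModule (Λ := Λ) X from ψ i))) • x i,
      ext fun φ => ?_⟩
    conv_rhs => rw [← sum_dualBasis h φ]
    rw [toDouble_apply, map_sum', map_sum', star_sum]
    refine Finset.sum_congr rfl fun i _ => ?_
    rw [map_smul', map_smul', star_mul, MulOpposite.unop_op, MulOpposite.unop_op, star_star]
    rfl

end DualModule

theorem isFGProj_dual (X : ProjCat Λ) : isFGProj Λ (ModuleCat.of Λᵐᵒᵖ (DualModule (Λ := Λ) X.obj)) := by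
  obtain ⟨n, x, φ, h⟩ := (isFGProj_iff_exists_dualBasis X.obj).1 X.property
  exact (isFGProj_iff_exists_dualBasis _).2
    ⟨n, φ, fun i => DualModule.eval (x i), DualModule.sum_dualBasis h⟩

open Opposite

variable (Λ) in
/-- The duality `Hom(-, Λ)` on `proj Λ`, for a ring `Λ` with involution. -/
def projDual : (ProjCat Λ)ᵒᵖ ⥤ ProjCat Λ where
  obj X := ⟨ModuleCat.of Λᵐᵒᵖ (DualModule (Λ := Λ) X.unop.obj), isFGProj_dual X.unop⟩
  map f := ObjectProperty.homMk (ModuleCat.ofHom (DualModule.map (toLin f.unop)))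
  map_id _ := rfl
  map_comp _ _ := rfl

instance : (projDual Λ).Additive where
  map_add {X Y f g} := by
    apply toLin_injective
    refine LinearMap.ext fun φ => DualModule.ext fun y => ?_
    exact DualModule.map_add' φ _ _

variable (Λ) in
/-- The duality on `proj Λ` is an involution. -/
noncomputable def projDualInvol : (projDual Λ).rightOp ⋙ projDual Λ ≅ 𝟭 (ProjCat Λ) :=
  (NatIso.ofComponents (fun X => isoOfEquiv (Y := (projDual Λ).obj (op ((projDual Λ).obj (op X))))
    (LinearEquiv.ofBijective DualModule.toDouble (by
      obtain ⟨n, x, φ, h⟩ := (isFGProj_iff_exists_dualBasis X.obj).1 X.property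
      exact DualModule.bijective_toDouble h))) (fun _ => rfl)).symm

/-- The dual of the right module `Λ`. -/
def dualRegularEquiv : DualModule (Λ := Λ) Λ ≃ₗ[Λᵐᵒᵖ] Λ :=
  { DualModule.eval (X := Λ) (1 : Λ) with
    invFun := fun y => ({ toFun := fun x : Λ => star y * x
                          map_add' := mul_add _
                          map_smul' := fun a x => (mul_assoc (star y) x a.unop).symm } :
                          Λ →ₗ[Λᵐᵒᵖ] Λ)
    left_inv := fun φ => DualModule.ext fun x => by
      change star (star (φ 1)) * x = φ x
      have h := DualModule.map_smul' φ (MulOpposite.op x) (1 : Λ)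
      rw [star_star]
      exact h.symm.trans (congrArg φ (one_mul x))
    right_inv := fun y => by
      change star (star y * 1) = y
      rw [mul_one, star_star] }

/-- Since x = ex on eΛ, a functional is left multiplication by its value at e; for self-adjoint e
this identifies the dual of eΛ with eΛ. -/
theorem DualModule.apply_rightIdeal {e : Λ} (he : IsIdempotentElem e)
    (φ : DualModule (Λ := Λ) (rightIdeal e)) (x : rightIdeal e) :
    φ ⟨e, mem_rightIdeal_self e⟩ * x.1 = φ x :=
  (DualModule.map_smul' φ (MulOpposite.op x.1) ⟨e, mem_rightIdeal_self e⟩).symm.trans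
    (congrArg φ (Subtype.ext (mul_coe_rightIdeal he x)))

/-- The dual of `eΛ`, for a self-adjoint idempotent `e`. -/
def dualRightIdealEquiv {e : Λ} (he : IsIdempotentElem e) (he' : star e = e) :
    DualModule (Λ := Λ) (rightIdeal e) ≃ₗ[Λᵐᵒᵖ] rightIdeal e where
  toFun φ := ⟨star (φ ⟨e, mem_rightIdeal_self e⟩),
    mem_rightIdeal.2 ⟨star (φ ⟨e, mem_rightIdeal_self e⟩), by
      have h := congrArg star (DualModule.apply_rightIdeal he φ ⟨e, mem_rightIdeal_self e⟩)
      rw [star_mul] at h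
      exact (h.symm).trans (congrArg (· * _) he')⟩⟩
  map_add' φ ψ := Subtype.ext (star_add _ _)
  map_smul' a φ := Subtype.ext (by
    change star (star a.unop * φ ⟨e, _⟩) = star (φ ⟨e, _⟩) * a.unop
    rw [star_mul, star_star])
  invFun y :=
    ({ toFun := fun x : rightIdeal e => star y.1 * x.1
       map_add' := fun x x' => mul_add _ _ _
       map_smul' := fun a x => (mul_assoc (star y.1) x.1 a.unop).symm } :
       rightIdeal e →ₗ[Λᵐᵒᵖ] Λ)
  left_inv φ := DualModule.ext fun x => by
    change star (star (φ ⟨e, _⟩)) * x.1 = φ x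
    rw [star_star, DualModule.apply_rightIdeal he]
  right_inv y := Subtype.ext (by
    change star (star y.1 * e) = y.1
    rw [star_mul, star_star, he', mul_coe_rightIdeal he])

/-- The dual of `Λ` in `proj Λ`. -/
def projDualRegular : (projDual Λ).obj (op (regularModule Λ)) ≅ regularModule Λ :=
  isoOfEquiv (X := (projDual Λ).obj (op (regularModule Λ))) (Y := regularModule Λ)
    dualRegularEquiv

/-- The dual of `eΛ` in `proj Λ`, for a self-adjoint idempotent `e`. -/
def projDualIdempotent {e : Λ} (he : IsIdempotentElem e) (he' : star e = e) :
    (projDual Λ).obj (op (idempotentModule e he)) ≅ idempotentModule e he :=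
  isoOfEquiv (X := (projDual Λ).obj (op (idempotentModule e he))) (Y := idempotentModule e he)
    (dualRightIdealEquiv he he')

end Dual

end ProjCat

/-! ### Minimal approximations of perfect complexes -/

section FromStalk

variable {C : Type u} [Category.{v} C] [Preadditive C] [HasZeroObject C] [HasBinaryBiproducts C]

theorem mkHomFromSingle_add {W : C} {K : CochainComplex C ℤ} {n : ℤ} (φ ψ : W ⟶ K.X n)
    (h₁ : ∀ i, (ComplexShape.up ℤ).Rel n i → (φ + ψ) ≫ K.d n i = 0)
    (h₂ : ∀ i, (ComplexShape.up ℤ).Rel n i → φ ≫ K.d n i = 0)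
    (h₃ : ∀ i, (ComplexShape.up ℤ).Rel n i → ψ ≫ K.d n i = 0) :
    HomologicalComplex.mkHomFromSingle (φ + ψ) h₁ =
      HomologicalComplex.mkHomFromSingle φ h₂ + HomologicalComplex.mkHomFromSingle ψ h₃ := by
  apply HomologicalComplex.from_single_hom_ext
  rw [HomologicalComplex.add_f_apply, HomologicalComplex.mkHomFromSingle_f,
    HomologicalComplex.mkHomFromSingle_f, HomologicalComplex.mkHomFromSingle_f,
    Preadditive.comp_add]

theorem mkHomFromSingle_comp {V W : C} {K : CochainComplex C ℤ} {n : ℤ} (a : V ⟶ W) (φ : W ⟶ K.X n)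
    (h₁ : ∀ i, (ComplexShape.up ℤ).Rel n i → (a ≫ φ) ≫ K.d n i = 0)
    (h₂ : ∀ i, (ComplexShape.up ℤ).Rel n i → φ ≫ K.d n i = 0) :
    HomologicalComplex.mkHomFromSingle (a ≫ φ) h₁ =
      (HomologicalComplex.single C (ComplexShape.up ℤ) n).map a ≫
        HomologicalComplex.mkHomFromSingle φ h₂ := by
  apply HomologicalComplex.from_single_hom_ext
  rw [HomologicalComplex.comp_f, HomologicalComplex.mkHomFromSingle_f,
    HomologicalComplex.mkHomFromSingle_f, HomologicalComplex.single_map_f_self]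
  simp

theorem comp_d_eq_zero {W : C} {K : CochainComplex C ℤ} {φ : W ⟶ K.X 0}
    (hφ : φ ≫ K.d 0 1 = 0) (i : ℤ) (hi : (ComplexShape.up ℤ).Rel 0 i) : φ ≫ K.d 0 i = 0 := by
  obtain rfl : 0 + 1 = i := hi
  exact hφ

/-- Morphisms from an object of `C` to a bounded complex come from its cycles in degree `0`. -/
noncomputable def fromStalk (W : C) (K : CochainComplex C ℤ)
    (hK : bounded C ((HomotopyCategory.quotient _ _).obj K)) :
    (Preadditive.rightComp W (K.d 0 1)).ker →+
      ((stalkFunctor C).obj W ⟶ (⟨(HomotopyCategory.quotient _ _).obj K, hK⟩ : Kb C)) where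
  toFun φ := ObjectProperty.homMk ((HomotopyCategory.quotient _ _).map
    (HomologicalComplex.mkHomFromSingle φ.1 (comp_d_eq_zero φ.2)))
  map_zero' := by
    apply ObjectProperty.hom_ext
    refine Eq.trans (congrArg (HomotopyCategory.quotient C (ComplexShape.up ℤ)).map ?_) (Functor.map_zero _ _ _)
    apply HomologicalComplex.from_single_hom_ext
    rw [HomologicalComplex.mkHomFromSingle_f]
    exact comp_zero
  map_add' φ ψ := by
    apply ObjectProperty.hom_ext
    refine Eq.trans (congrArg (HomotopyCategory.quotient C (ComplexShape.up ℤ)).map ?_) (Functor.map_add _)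
    exact mkHomFromSingle_add φ.1 ψ.1 (comp_d_eq_zero (φ + ψ).2) (comp_d_eq_zero φ.2)
      (comp_d_eq_zero ψ.2)

theorem fromStalk_surjective (W : C) (K : CochainComplex C ℤ)
    (hK : bounded C ((HomotopyCategory.quotient _ _).obj K)) :
    Function.Surjective (fromStalk W K hK) := by
  intro g
  obtain ⟨G, hG⟩ := (HomotopyCategory.quotient C (ComplexShape.up ℤ)).map_surjective g.hom
  let G' : (HomologicalComplex.single C (ComplexShape.up ℤ) 0).obj W ⟶ K := G
  refine ⟨⟨(HomologicalComplex.singleObjXSelf (ComplexShape.up ℤ) 0 W).inv ≫ G'.f 0, ?_⟩, ?_⟩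
  · change ((HomologicalComplex.singleObjXSelf (ComplexShape.up ℤ) 0 W).inv ≫ G'.f 0) ≫ K.d 0 1 = 0
    rw [Category.assoc, G'.comm, (HomologicalComplex.isZero_single_obj_X (ComplexShape.up ℤ) 0 W 1
      (by simp)).eq_of_src (G'.f 1) 0, comp_zero, comp_zero]
  · apply ObjectProperty.hom_ext
    rw [← hG]
    refine congrArg (HomotopyCategory.quotient C (ComplexShape.up ℤ)).map ?_
    apply HomologicalComplex.from_single_hom_ext
    rw [HomologicalComplex.mkHomFromSingle_f]
    exact Iso.hom_inv_id_assoc _ _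

theorem fromStalk_comp {V W : C} (K : CochainComplex C ℤ)
    (hK : bounded C ((HomotopyCategory.quotient _ _).obj K)) (a : V ⟶ W)
    (φ : (Preadditive.rightComp W (K.d 0 1)).ker) (h : a ≫ φ.1 ∈ (Preadditive.rightComp V (K.d 0 1)).ker) :
    fromStalk V K hK ⟨a ≫ φ.1, h⟩ = (stalkFunctor C).map a ≫ fromStalk W K hK φ := by
  apply ObjectProperty.hom_ext
  refine Eq.trans (congrArg (HomotopyCategory.quotient C (ComplexShape.up ℤ)).map ?_) (Functor.map_comp _ _ _)
  exact mkHomFromSingle_comp a φ.1 (comp_d_eq_zero h) (comp_d_eq_zero φ.2)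

end FromStalk

section Fitting

variable {Λ : Type w} [Ring Λ]

theorem toLin_pow {Q : ProjCat Λ} (h : End Q) (n : ℕ) :
    toLin (h ^ n) = (show Module.End Λᵐᵒᵖ Q.obj from toLin h) ^ n := by
  induction n with
  | zero => rfl
  | succ n ih =>
    rw [pow_succ, pow_succ, ← ih]
    rfl

/-- An endomorphism of a projective module of finite length is an isomorphism, or some power of it
factors through a shorter direct summand. -/
theorem isIso_or_exists_factors_pow [IsArtinianRing Λᵐᵒᵖ] [IsNoetherianRing Λᵐᵒᵖ] {Q : ProjCat Λ}
    (h : End Q) :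
    IsIso h ∨ ∃ (n : ℕ) (Q₁ : ProjCat Λ) (i : Q₁ ⟶ Q) (r r' : Q ⟶ Q₁), i ≫ r = 𝟙 Q₁ ∧
      r' ≫ i = h ^ n ∧ Module.length Λᵐᵒᵖ Q₁.obj < Module.length Λᵐᵒᵖ Q.obj := by
  have hfin : Module.Finite Λᵐᵒᵖ Q.obj := Q.property.1
  have hproj : Module.Projective Λᵐᵒᵖ Q.obj := Q.property.2
  let l : Module.End Λᵐᵒᵖ Q.obj := toLin h
  -- Fitting's lemma: for large n the module is the sum of kernel and range of the n-th power. The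
  -- condition n ≥ 1 is what lets bijectivity of the power descend to the map.
  obtain ⟨n, hn, hn1⟩ := (l.eventually_isCompl_ker_pow_range_pow.and
    (Filter.eventually_ge_atTop 1)).exists
  obtain ⟨m, rfl⟩ : ∃ m, n = m + 1 := ⟨n - 1, by lia⟩
  by_cases hr : LinearMap.range (l ^ (m + 1)) = ⊤
  · left
    have hk : LinearMap.ker (l ^ (m + 1)) = ⊥ := by
      have := hn.inf_eq_bot
      rwa [hr, inf_top_eq] at this
    refine isIso_of_bijective _ ⟨?_, ?_⟩
    · rw [pow_succ] at hk
      exact Function.Injective.of_comp (f := ⇑(l ^ m)) (LinearMap.ker_eq_bot.1 hk)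
    · rw [pow_succ'] at hr
      exact Function.Surjective.of_comp (g := ⇑(l ^ m)) (LinearMap.range_eq_top.1 hr)
  · right
    let p := (LinearMap.range (l ^ (m + 1))).projectionOnto _ hn.symm
    have hp : p ∘ₗ (LinearMap.range (l ^ (m + 1))).subtype = LinearMap.id :=
      LinearMap.ext fun x => Submodule.projectionOnto_apply_left hn.symm x
    let Q₁ : ProjCat Λ := ⟨ModuleCat.of Λᵐᵒᵖ (LinearMap.range (l ^ (m + 1))),
      inferInstanceAs (Module.Finite Λᵐᵒᵖ (LinearMap.range (l ^ (m + 1)))),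
      Module.Projective.of_split _ p hp⟩
    refine ⟨m + 1, Q₁, ofLin (X := Q₁) (LinearMap.range (l ^ (m + 1))).subtype,
      ofLin (Y := Q₁) p, ofLin (Y := Q₁) (l ^ (m + 1)).rangeRestrict, toLin_injective hp,
      toLin_injective ?_, Submodule.length_lt hr⟩
    rw [toLin_pow]
    rfl

theorem map_pow_comp {𝒯 : Type u} [Category.{v} 𝒯] {C : Type u'} [Category.{v'} C] (F : C ⥤ 𝒯)
    {Q : C} {T : 𝒯} {q : F.obj Q ⟶ T} {h : End Q} (hq : F.map h ≫ q = q) (n : ℕ) :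
    F.map (h ^ n) ≫ q = q := by
  induction n with
  | zero => exact (congrArg (· ≫ q) (F.map_id Q)).trans (Category.id_comp q)
  | succ n ih =>
    rw [pow_succ, End.mul_def, F.map_comp, Category.assoc, ih, hq]

end Fitting

section Approximation

variable {Λ : Type w} [Ring Λ]

/-- `W` is generated by `w`, and `w` is the universal element with `w f = w`: the properties of
`W = f Λ` and `w = f` for an idempotent `f`. -/
structure IsCyclicAt (W : ProjCat Λ) (w : W.obj) (f : Λ) : Prop where
  isIdempotentElem : IsIdempotentElem f
  smul_eq : MulOpposite.op f • w = w
  exists_smul : ∀ x : W.obj, ∃ a : Λ, x = MulOpposite.op a • w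
  exists_lift : ∀ (X : ProjCat Λ) (z : X.obj), MulOpposite.op f • z = z →
    ∃ φ : W ⟶ X, toLin φ w = z

theorem isCyclicAt_regularModule : IsCyclicAt (regularModule Λ) (1 : Λ) 1 where
  isIdempotentElem := mul_one 1
  smul_eq := one_smul Λᵐᵒᵖ (1 : Λ)
  exists_smul (x : Λ) := ⟨x, (one_mul x).symm⟩
  exists_lift _ z _ := ⟨fromRegular z, one_smul _ _⟩

theorem isCyclicAt_idempotentModule {e : Λ} (he : IsIdempotentElem e) :
    IsCyclicAt (idempotentModule e he) (⟨e, mem_rightIdeal_self e⟩ : rightIdeal e) e where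
  isIdempotentElem := he
  smul_eq := Subtype.ext he.eq
  exists_smul (x : rightIdeal e) := ⟨x, Subtype.ext (mul_coe_rightIdeal he x).symm⟩
  exists_lift _ z hz := ⟨ofLin (X := idempotentModule e he)
    (toLin (fromRegular z) ∘ₗ (rightIdeal e).subtype), hz⟩

variable {W : ProjCat Λ} {w : W.obj} {f : Λ}

theorem IsCyclicAt.hom_ext (hW : IsCyclicAt W w f) {X : ProjCat Λ} {φ ψ : W ⟶ X}
    (h : toLin φ w = toLin ψ w) : φ = ψ := by
  apply toLin_injective
  refine LinearMap.ext fun x => ?_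
  obtain ⟨a, rfl⟩ := hW.exists_smul x
  rw [LinearMap.map_smul, LinearMap.map_smul, h]

theorem IsCyclicAt.smul_apply (hW : IsCyclicAt W w f) {X : ProjCat Λ} (φ : W ⟶ X) :
    MulOpposite.op f • toLin φ w = toLin φ w := by
  rw [← LinearMap.map_smul, hW.smul_eq]

/-- Morphisms from `W = f Λ` to a bounded complex form a finitely generated `End W`-module. -/
theorem IsCyclicAt.exists_generators [IsNoetherianRing Λᵐᵒᵖ] (hW : IsCyclicAt W w f)
    (T : PerfCat Λ) :
    ∃ (n : ℕ) (t : Fin n → ((stalkFunctor (ProjCat Λ)).obj W ⟶ T)),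
      ∀ g : (stalkFunctor (ProjCat Λ)).obj W ⟶ T, ∃ a : Fin n → (W ⟶ W),
        g = ∑ i, (stalkFunctor _).map (a i) ≫ t i := by
  obtain ⟨T, hT⟩ := T
  obtain ⟨K, rfl⟩ := HomotopyCategory.quotient_obj_surjective T
  have hfin : Module.Finite Λᵐᵒᵖ (K.X 0).obj := (K.X 0).property.1
  -- A map W ⟶ K⁰ is determined by the image of `w`. The span of the images of all cycles is
  -- finitely generated by the Noetherian property, and the generators can be taken among these
  -- images, so that they come from actual maps.
  let S : Set (K.X 0).obj := {z | ∃ φ : W ⟶ K.X 0, φ ≫ K.d 0 1 = 0 ∧ toLin φ w = z}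
  obtain ⟨s, hs, hspan⟩ := (Submodule.fg_span_iff_fg_span_finset_subset S).1
    (IsNoetherian.noetherian (R := Λᵐᵒᵖ) _)
  have hs' : ∀ i, ∃ φ : W ⟶ K.X 0, φ ≫ K.d 0 1 = 0 ∧ toLin φ w = (s.equivFin.symm i).1 :=
    fun i => hs (s.equivFin.symm i).2
  choose φ hφ hφw using hs'
  refine ⟨s.card, fun i => fromStalk W K hT ⟨φ i, hφ i⟩, fun g => ?_⟩
  obtain ⟨⟨ψ, hψ⟩, rfl⟩ := fromStalk_surjective W K hT g
  have hmem : toLin ψ w ∈ Submodule.span Λᵐᵒᵖ (s : Set (K.X 0).obj) :=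
    hspan ▸ Submodule.subset_span ⟨ψ, hψ, rfl⟩
  rw [Submodule.mem_span_finset'] at hmem
  obtain ⟨c, hc⟩ := hmem
  -- The image of `w` is fixed by `f`, so each coefficient may be multiplied by `f`, which makes it
  -- realizable by an endomorphism of W.
  have hff : ∀ i, ∃ a : W ⟶ W, toLin a w =
      MulOpposite.op f • c (s.equivFin.symm i) • w := fun i =>
    hW.exists_lift W _ (by
      rw [smul_smul, ← MulOpposite.op_mul, hW.isIdempotentElem.eq])
  choose a ha using hff
  refine ⟨a, ?_⟩
  have hker : ∀ i, a i ≫ φ i ∈ (Preadditive.rightComp W (K.d 0 1)).ker := fun i => by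
    change (a i ≫ φ i) ≫ K.d 0 1 = 0
    rw [Category.assoc, hφ, comp_zero]
  have hsum : (⟨ψ, hψ⟩ : (Preadditive.rightComp W (K.d 0 1)).ker) =
      ∑ i, ⟨a i ≫ φ i, hker i⟩ := by
    refine Subtype.ext ?_
    rw [AddSubgroup.val_finsetSum]
    apply hW.hom_ext
    rw [toLin_sum, LinearMap.sum_apply]
    change toLin ψ w = ∑ i, toLin (φ i) (toLin (a i) w)
    rw [← hW.smul_apply ψ, ← hc, Finset.smul_sum, ← Equiv.sum_comp s.equivFin.symm]
    refine Finset.sum_congr rfl fun i _ => ?_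
    rw [ha, LinearMap.map_smul, LinearMap.map_smul, hφw]
  rw [hsum, map_sum]
  exact Finset.sum_congr rfl fun i _ => fromStalk_comp K hT (a i) ⟨φ i, hφ i⟩ (hker i)

/-- Every bounded complex has a minimal right approximation by copies of `W = f Λ`. -/
theorem IsCyclicAt.exists_isMinRightApprox [IsArtinianRing Λᵐᵒᵖ] [IsNoetherianRing Λᵐᵒᵖ]
    (hW : IsCyclicAt W w f) (T : PerfCat Λ) :
    ∃ (Q : ProjCat Λ) (q : (stalkFunctor (ProjCat Λ)).obj Q ⟶ T),
      IsMinRightApprox ((stalkFunctor (ProjCat Λ)).obj W) q := by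
  have := HasFiniteBiproducts.of_hasFiniteProducts (C := ProjCat Λ)
  let F := stalkFunctor (ProjCat Λ)
  let 𝒬 : Set (ProjCat Λ) := {Q | InAdd (F.obj W) (F.obj Q) ∧ ∃ q : F.obj Q ⟶ T,
    ∀ g : F.obj W ⟶ T, ∃ h : W ⟶ Q, F.map h ≫ q = g}
  have h𝒬 : 𝒬.Nonempty := by
    obtain ⟨n, t, ht⟩ := hW.exists_generators T
    refine ⟨⨁ fun _ : Fin n => W, inAdd_iff.2 ⟨n, fun i => F.map (biproduct.π _ i),
      fun i => F.map (biproduct.ι (fun _ : Fin n => W) i), ?_⟩, ∑ i, F.map (biproduct.π _ i) ≫ t i, fun g => ?_⟩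
    · simp only [← Functor.map_comp]
      rw [← Functor.map_sum, biproduct.total, CategoryTheory.Functor.map_id]
    · obtain ⟨a, rfl⟩ := ht g
      refine ⟨biproduct.lift a, ?_⟩
      rw [Preadditive.comp_sum]
      refine Finset.sum_congr rfl fun i _ => ?_
      rw [← Category.assoc, ← Functor.map_comp, biproduct.lift_π]
  -- An approximation of least length is minimal: if hq = q with h not invertible, a power of h
  -- factors through a shorter summand Q₁, and q restricted to Q₁ is still an approximation.
  obtain ⟨Q, ⟨hQ, q, hq⟩, hmin⟩ := WellFounded.has_min
    (InvImage.wf (fun Q : ProjCat Λ => Module.length Λᵐᵒᵖ Q.obj) wellFounded_lt) 𝒬 h𝒬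
  refine ⟨Q, q, hQ, fun N hN g => ?_, fun h hh => ?_⟩
  · obtain ⟨n, a, b, hab⟩ := inAdd_iff.1 hN
    choose k hk using fun i => hq (b i ≫ g)
    refine ⟨∑ i, a i ≫ F.map (k i), ?_⟩
    rw [Preadditive.sum_comp]
    simp only [Category.assoc, hk]
    simp only [← Category.assoc]
    rw [← Preadditive.sum_comp, hab, Category.id_comp]
  · obtain ⟨h, rfl⟩ := F.map_surjective h
    rcases isIso_or_exists_factors_pow h with h' | ⟨n, Q₁, i, r, r', hir, hri, hlt⟩
    · infer_instance
    · refine (hmin Q₁ ⟨?_, F.map i ≫ q, fun g => ?_⟩ hlt).elim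
      · exact hQ.of_retract (F.map i) (F.map r) (by
          rw [← F.map_comp, hir, CategoryTheory.Functor.map_id])
      · obtain ⟨k, rfl⟩ := hq g
        refine ⟨k ≫ r', ?_⟩
        rw [← Category.assoc, ← F.map_comp, Category.assoc, hri, F.map_comp, Category.assoc,
          map_pow_comp F hh]

end Approximation

theorem IsMinLeftApprox.of_iso {𝒯 : Type u} [Category.{v} 𝒯] [HasZeroObject 𝒯] [HasShift 𝒯 ℤ]
    [Preadditive 𝒯] [∀ n : ℤ, (shiftFunctor 𝒯 n).Additive] [Pretriangulated 𝒯]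
    {M M₁ X X₁ M' : 𝒯} {f : X ⟶ M'} (hf : IsMinLeftApprox M f) (e : M ≅ M₁) (a : X₁ ≅ X) :
    IsMinLeftApprox M₁ (a.hom ≫ f) where
  mem := hf.mem.of_iso e (Iso.refl _)
  factors N hN g := by
    obtain ⟨h, hh⟩ := hf.factors N (hN.of_iso e.symm (Iso.refl _)) (a.inv ≫ g)
    exact ⟨h, by rw [Category.assoc, hh, a.hom_inv_id_assoc]⟩
  minimal h hh := hf.minimal h (by rwa [Category.assoc, cancel_epi] at hh)

/-! ### Idempotents that are local for an augmentation -/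

section Augmented

variable {K : Type u} [Field K] {Λ : Type w} [Ring Λ] [Algebra K Λ] {ε : Λ →ₐ[K] K} {e : Λ}

/-- `e` is an idempotent such that `e Λ e` is local with residue field `K`. -/
structure IsLocalIdempotent (ε : Λ →ₐ[K] K) (e : Λ) : Prop where
  isIdempotentElem : IsIdempotentElem e
  map_eq_one : ε e = 1
  isNilpotent : ∀ x : Λ, ε x = 0 → IsNilpotent (e * x * e)

/-- Put v = e(x - ε(x))e, which is nilpotent. Then u = ε(x) + v is a unit of Λ commuting with e and
satisfying eu = exe, so eu⁻¹ is the inverse of exe in the corner eΛe. -/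
theorem IsLocalIdempotent.exists_inverse (he : IsLocalIdempotent ε e) {x : Λ} (hx : ε x ≠ 0) :
    ∃ b, e * b = b ∧ b * e = b ∧ e * x * e * b = e ∧ b * (e * x * e) = e := by
  have hee := he.isIdempotentElem.eq
  let v := e * (x - algebraMap K Λ (ε x)) * e
  have hv : IsNilpotent v := he.isNilpotent _ (by
    rw [map_sub, AlgHom.commutes]
    exact sub_self _)
  have hu : IsUnit (algebraMap K Λ (ε x) + v) :=
    hv.isUnit_add_left_of_commute ((IsUnit.mk0 _ hx).map (algebraMap K Λ))
      (Algebra.commutes _ _).symm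
  obtain ⟨u, hu⟩ := hu
  have hv' : v = e * x * e - algebraMap K Λ (ε x) * e := by
    simp only [v]
    rw [mul_sub, sub_mul, ← Algebra.commutes (ε x) e, mul_assoc (algebraMap K Λ (ε x)), hee]
  have h₁ : e * u = e * x * e := by
    rw [hu, mul_add, ← Algebra.commutes, hv', mul_sub, ← mul_assoc, ← mul_assoc, ← mul_assoc, hee,
      ← Algebra.commutes, mul_assoc (algebraMap K Λ (ε x)), hee, add_sub_cancel]
  have h₂ : u * e = e * x * e := by
    rw [hu, add_mul, hv', sub_mul, mul_assoc (e * x), hee, mul_assoc (algebraMap K Λ (ε x)), hee,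
      add_sub_cancel]
  have hc : e * ↑u⁻¹ = ↑u⁻¹ * e := Commute.units_inv_right (h₁.trans h₂.symm)
  refine ⟨e * ↑u⁻¹, ?_, ?_, ?_, ?_⟩
  · rw [← mul_assoc, hee]
  · rw [mul_assoc, ← hc, ← mul_assoc, hee]
  · rw [← h₂, mul_assoc, ← mul_assoc e, hee, hc, ← mul_assoc, u.mul_inv, one_mul]
  · rw [← h₁, hc, mul_assoc, ← mul_assoc e, hee, h₁, ← h₂, ← mul_assoc, u.inv_mul, one_mul]

section Coeff

variable {f g : Λ} {he : IsIdempotentElem e} {hf : IsIdempotentElem f} {hg : IsIdempotentElem g}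

/-- The element of `f Λ e` that describes a homomorphism `e Λ ⟶ f Λ`. -/
def coeff : (idempotentModule e he ⟶ idempotentModule f hf) →+ Λ where
  toFun φ := (show rightIdeal f from toLin φ (⟨e, mem_rightIdeal_self e⟩ : rightIdeal e)).1
  map_zero' := rfl
  map_add' _ _ := rfl

theorem coeff_id : coeff (𝟙 (idempotentModule e he)) = e := rfl

theorem mul_coeff (φ : idempotentModule e he ⟶ idempotentModule f hf) : f * coeff φ = coeff φ :=
  mul_coe_rightIdeal hf _

theorem coeff_mul (φ : idempotentModule e he ⟶ idempotentModule f hf) : coeff φ * e = coeff φ :=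
  congrArg Subtype.val ((isCyclicAt_idempotentModule he).smul_apply φ)

theorem coeff_comp (φ : idempotentModule e he ⟶ idempotentModule f hf)
    (ψ : idempotentModule f hf ⟶ idempotentModule g hg) :
    coeff (φ ≫ ψ) = coeff ψ * coeff φ := by
  have h : (⟨coeff φ, mem_rightIdeal.2 ⟨_, (mul_coeff φ).symm⟩⟩ : rightIdeal f) =
      MulOpposite.op (coeff φ) • (⟨f, mem_rightIdeal_self f⟩ : rightIdeal f) :=
    Subtype.ext (mul_coeff φ).symm
  exact congrArg Subtype.val ((congrArg (toLin ψ) h).trans (LinearMap.map_smul (toLin ψ) _ _))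

theorem coeff_injective {φ ψ : idempotentModule e he ⟶ idempotentModule f hf}
    (h : coeff φ = coeff ψ) : φ = ψ :=
  (isCyclicAt_idempotentModule he).hom_ext (Subtype.ext h)

theorem exists_coeff_eq {b : Λ} (h₁ : f * b = b) (h₂ : b * e = b) :
    ∃ φ : idempotentModule e he ⟶ idempotentModule f hf, coeff φ = b := by
  obtain ⟨φ, hφ⟩ := (isCyclicAt_idempotentModule he).exists_lift (idempotentModule f hf)
    (⟨b, mem_rightIdeal.2 ⟨b, h₁.symm⟩⟩ : rightIdeal f) (Subtype.ext h₂)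
  exact ⟨φ, congrArg Subtype.val hφ⟩

end Coeff

theorem IsLocalIdempotent.isIso (he : IsLocalIdempotent ε e)
    (α : idempotentModule e he.isIdempotentElem ⟶ idempotentModule e he.isIdempotentElem)
    (h : ε (coeff α) ≠ 0) : IsIso α := by
  obtain ⟨b, heb, hbe, hab, hba⟩ := he.exists_inverse h
  rw [mul_coeff, coeff_mul] at hab hba
  obtain ⟨β, rfl⟩ := exists_coeff_eq (he := he.isIdempotentElem) (hf := he.isIdempotentElem) heb hbe
  exact ⟨β, coeff_injective ((coeff_comp _ _).trans hba),
    coeff_injective ((coeff_comp _ _).trans hab)⟩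

/-- An endomorphism of eΛ is invertible as soon as ε of its coefficient is nonzero; if two
endomorphisms sum to 1, these scalars sum to 1 and cannot both vanish. -/
theorem IsLocalIdempotent.isLocalEnd (he : IsLocalIdempotent ε e) :
    IsLocalEnd ((stalkFunctor _).obj (idempotentModule e he.isIdempotentElem)) where
  id_ne_zero h := by
    rw [← CategoryTheory.Functor.map_id, ← (stalkFunctor (ProjCat Λ)).map_zero] at h
    have h2 := congrArg (fun t => ε (coeff t)) ((stalkFunctor (ProjCat Λ)).map_injective h)
    simp only [coeff_id, he.map_eq_one, map_zero] at h2
    exact one_ne_zero h2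
  isIso_or_isIso x y hxy := by
    obtain ⟨x, rfl⟩ := (stalkFunctor (ProjCat Λ)).map_surjective x
    obtain ⟨y, rfl⟩ := (stalkFunctor (ProjCat Λ)).map_surjective y
    rw [← CategoryTheory.Functor.map_id, ← Functor.map_add] at hxy
    have h2 := congrArg (fun t => ε (coeff t)) ((stalkFunctor (ProjCat Λ)).map_injective hxy)
    simp only [coeff_id, he.map_eq_one, map_add] at h2
    by_cases hx : ε (coeff x) = 0
    · right
      rw [hx, zero_add] at h2
      have := he.isIso y (by rw [h2]; exact one_ne_zero)
      infer_instance
    · left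
      have := he.isIso x hx
      infer_instance

theorem nonempty_iso_biprod_idempotentModule (he : IsIdempotentElem e) :
    Nonempty ((stalkFunctor _).obj (regularModule Λ) ≅
      (stalkFunctor _).obj (idempotentModule e he) ⊞
        (stalkFunctor _).obj (idempotentModule (1 - e) he.one_sub)) := by
  let i (e : Λ) (he : IsIdempotentElem e) : idempotentModule e he ⟶ regularModule Λ :=
    ofLin (X := idempotentModule e he) (Y := regularModule Λ) (rightIdeal e).subtype
  let p (e : Λ) (he : IsIdempotentElem e) : regularModule Λ ⟶ idempotentModule e he :=
    ofLin (X := regularModule Λ) (Y := idempotentModule e he) (toRightIdeal e)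
  have hip (e : Λ) (he : IsIdempotentElem e) : i e he ≫ p e he = 𝟙 _ :=
    toLin_injective (LinearMap.ext fun x => Subtype.ext (mul_coe_rightIdeal he x))
  refine nonempty_iso_biprod_iff.2 ⟨(stalkFunctor _).map (i e he), (stalkFunctor _).map (p e he),
    (stalkFunctor _).map (i _ he.one_sub), (stalkFunctor _).map (p _ he.one_sub), ?_, ?_, ?_⟩
  · rw [← Functor.map_comp, hip, CategoryTheory.Functor.map_id]
  · rw [← Functor.map_comp, hip, CategoryTheory.Functor.map_id]
  · rw [← Functor.map_comp, ← Functor.map_comp, ← Functor.map_add, ← CategoryTheory.Functor.map_id]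
    congr 1
    refine toLin_injective (LinearMap.ext fun (x : Λ) => ?_)
    change e * x + (1 - e) * x = x
    rw [← add_mul, add_sub_cancel, one_mul]

/-- Any map through (1 - e)Λ has a coefficient killed by ε, because ε(1 - e) = 0, whereas the
identity of eΛ has coefficient e. Thus eΛ occurs only once in Λ. -/
theorem IsLocalIdempotent.not_inAdd (he : IsLocalIdempotent ε e) :
    ¬ InAdd ((stalkFunctor _).obj (idempotentModule (1 - e) he.isIdempotentElem.one_sub))
      ((stalkFunctor _).obj (idempotentModule e he.isIdempotentElem)) := by
  intro h
  obtain ⟨n, a, b, hab⟩ := inAdd_iff.1 h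
  choose a' ha using fun i => (stalkFunctor (ProjCat Λ)).map_surjective (a i)
  choose b' hb using fun i => (stalkFunctor (ProjCat Λ)).map_surjective (b i)
  simp only [← ha, ← hb, ← Functor.map_comp] at hab
  rw [← Functor.map_sum, ← CategoryTheory.Functor.map_id] at hab
  have h1 := (stalkFunctor (ProjCat Λ)).map_injective hab
  have h2 := congrArg (fun t => ε (coeff t)) h1
  simp only [coeff_id, he.map_eq_one, map_sum, coeff_comp, map_mul] at h2
  rw [Finset.sum_eq_zero] at h2
  · exact zero_ne_one h2
  intro i _
  rw [← mul_coeff (a' i), map_mul, map_sub, map_one, he.map_eq_one, sub_self, zero_mul, mul_zero]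

theorem map_eq_op_smul {X : Type*} [AddCommGroup X] [Module Λᵐᵒᵖ X] (f : Λ →ₗ[Λᵐᵒᵖ] X) (x : Λ) :
    f x = MulOpposite.op x • f 1 := by
  rw [← LinearMap.map_smul]
  exact congrArg f (one_mul x).symm

section SimpleTop

variable (ε) in
/-- The kernel of the augmentation, as a right ideal. -/
def augmentationKer : Submodule Λᵐᵒᵖ Λ where
  carrier := {x | ε x = 0}
  add_mem' {x y} hx hy := by
    change ε (x + y) = 0
    rw [map_add, show ε x = 0 from hx, show ε y = 0 from hy, add_zero]
  zero_mem' := map_zero ε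
  smul_mem' a x hx := by
    change ε (x * a.unop) = 0
    rw [map_mul, show ε x = 0 from hx, zero_mul]

theorem mk_augmentationKer_eq_iff {x y : Λ} :
    (Submodule.Quotient.mk x : Λ ⧸ augmentationKer ε) = Submodule.Quotient.mk y ↔ ε x = ε y := by
  rw [Submodule.Quotient.eq]
  change ε (x - y) = 0 ↔ _
  rw [map_sub, sub_eq_zero]

variable (Λ) in
/-- The embedding of the perfect derived category into the homotopy category of modules. -/
noncomputable abbrev perfEmbedding :
    PerfCat Λ ⥤ HomotopyCategory (ModuleCat.{w} Λᵐᵒᵖ) (ComplexShape.up ℤ) :=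
  (bounded (ProjCat Λ)).ι ⋙ (isFGProj Λ).ι.mapHomotopyCategory (ComplexShape.up ℤ)

/-- The embedding on complexes concentrated in degree `0`. -/
noncomputable def perfEmbeddingStalk (X : ProjCat Λ) :
    (perfEmbedding Λ).obj ((stalkFunctor _).obj X) ≅
      (HomotopyCategory.singleFunctor (ModuleCat.{w} Λᵐᵒᵖ) 0).obj X.obj :=
  (HomotopyCategory.quotient _ _).mapIso
    ((HomologicalComplex.singleMapHomologicalComplex (isFGProj Λ).ι (ComplexShape.up ℤ) 0).app X)

theorem perfEmbeddingStalk_naturality {X Y : ProjCat Λ} (α : X ⟶ Y) :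
    (perfEmbedding Λ).map ((stalkFunctor _).map α) ≫ (perfEmbeddingStalk Y).hom =
      (perfEmbeddingStalk X).hom ≫
        (HomotopyCategory.singleFunctor (ModuleCat.{w} Λᵐᵒᵖ) 0).map α.hom := by
  refine ((HomotopyCategory.quotient _ _).map_comp _ _).symm.trans
    (Eq.trans (congrArg (HomotopyCategory.quotient _ _).map ?_)
      ((HomotopyCategory.quotient _ _).map_comp _ _))
  exact (HomologicalComplex.singleMapHomologicalComplex (isFGProj Λ).ι
    (ComplexShape.up ℤ) 0).hom.naturality α

variable (ε e) in
/-- The map from `e Λ` to the simple module defined by the augmentation. -/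
noncomputable def toSimple (he : IsIdempotentElem e) :
    (perfEmbedding Λ).obj ((stalkFunctor _).obj (idempotentModule e he)) ⟶
      (HomotopyCategory.singleFunctor (ModuleCat.{w} Λᵐᵒᵖ) 0).obj
        (ModuleCat.of Λᵐᵒᵖ (Λ ⧸ augmentationKer ε)) :=
  (perfEmbeddingStalk _).hom ≫ (HomotopyCategory.singleFunctor (ModuleCat.{w} Λᵐᵒᵖ) 0).map
    (ModuleCat.ofHom ((augmentationKer ε).mkQ ∘ₗ (rightIdeal e).subtype))

/-- The simple module Λ/ker ε need not be perfect, so the test takes place in the homotopy category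
of all modules. There maps out of the stalk Λ are governed by the image of 1. -/
theorem IsLocalIdempotent.isSimpleTop (he : IsLocalIdempotent ε e) :
    IsSimpleTop (perfEmbedding Λ) ((stalkFunctor _).obj (regularModule Λ))
      ((stalkFunctor _).obj (idempotentModule e he.isIdempotentElem))
      (toSimple ε e he.isIdempotentElem) := by
  let F := HomotopyCategory.singleFunctor (ModuleCat.{w} Λᵐᵒᵖ) 0
  have hcomp : ∀ {X : ProjCat Λ} (α : X ⟶ idempotentModule e he.isIdempotentElem),
      (perfEmbedding Λ).map ((stalkFunctor _).map α) ≫ toSimple ε e he.isIdempotentElem =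
        (perfEmbeddingStalk X).hom ≫ F.map (ModuleCat.ofHom
          ((augmentationKer ε).mkQ ∘ₗ (rightIdeal e).subtype ∘ₗ toLin α)) := fun {X} α => by
    rw [toSimple, ← Category.assoc, perfEmbeddingStalk_naturality, Category.assoc]
    exact congrArg _ (F.map_comp _ _).symm
  have hee := he.isIdempotentElem.eq
  refine ⟨fun h => ?_, fun φ => ?_, fun α hα => ?_, fun n hn => ?_⟩
  · have h1 : F.map (ModuleCat.ofHom ((augmentationKer ε).mkQ ∘ₗ (rightIdeal e).subtype)) = 0 := by
      exact (cancel_epi (perfEmbeddingStalk _).hom).1 (Eq.trans h comp_zero.symm)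
    rw [← F.map_zero] at h1
    have h2 := congrArg (fun t => t.hom ⟨e, mem_rightIdeal_self e⟩) (F.map_injective h1)
    have h3 : ε e = ε 0 := mk_augmentationKer_eq_iff.1 h2
    rw [he.map_eq_one, map_zero] at h3
    exact one_ne_zero h3
  · obtain ⟨φ', hφ'⟩ := F.map_surjective ((perfEmbeddingStalk (regularModule Λ)).inv ≫ φ)
    -- If 1 maps to the class of z, the map x ↦ ezx to eΛ is a lift, because ε(ez) = ε(z).
    obtain ⟨z, hz⟩ := Submodule.Quotient.mk_surjective (augmentationKer ε) (φ'.hom (1 : Λ))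
    refine ⟨(stalkFunctor _).map (fromRegular (X := idempotentModule e he.isIdempotentElem)
      (toRightIdeal e z)), ?_⟩
    rw [hcomp, ← Iso.inv_comp_eq, ← hφ']
    congr 1
    refine ModuleCat.hom_ext (LinearMap.ext fun x : Λ => ?_)
    refine (map_eq_op_smul φ'.hom x).trans ((congrArg (MulOpposite.op x • ·) hz.symm).trans
      (mk_augmentationKer_eq_iff.2 ?_))
    change ε (z * x) = ε (e * z * x)
    rw [mul_assoc, map_mul ε e, he.map_eq_one, one_mul]
  · obtain ⟨α, rfl⟩ := (stalkFunctor (ProjCat Λ)).map_surjective α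
    let ι : idempotentModule e he.isIdempotentElem ⟶ regularModule Λ :=
      ofLin (X := idempotentModule e he.isIdempotentElem) (Y := regularModule Λ)
        (rightIdeal e).subtype
    obtain ⟨y, hy⟩ : ∃ y : rightIdeal e, toLin α (1 : Λ) = y := ⟨_, rfl⟩
    have hα' : ∀ x : Λ, toLin α x = MulOpposite.op x • y := fun x =>
      (map_eq_op_smul (toLin α) x).trans (congrArg _ hy)
    refine ⟨(stalkFunctor _).map ι, ?_⟩
    rw [← Functor.map_comp]
    -- With y = α(1), the restriction of α to eΛ has coefficient ye and ε(ye) = ε(y); if this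
    -- vanished, α would die in Λ/ker ε.
    have : IsIso (ι ≫ α) := by
      refine he.isIso _ fun h => hα ?_
      have h1 : coeff (ι ≫ α) = (y : Λ) * e := congrArg Subtype.val (hα' e)
      rw [h1, map_mul, he.map_eq_one, mul_one] at h
      rw [hcomp]
      have h2 : (augmentationKer ε).mkQ ∘ₗ (rightIdeal e).subtype ∘ₗ toLin α = 0 := by
        refine LinearMap.ext fun x : Λ => ?_
        refine (congrArg (fun t => (augmentationKer ε).mkQ ((rightIdeal e).subtype t))
          (hα' x)).trans ((mk_augmentationKer_eq_iff (y := (0 : Λ))).2 ?_)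
        change ε ((y : Λ) * x) = ε 0
        rw [map_mul, h, zero_mul, map_zero]
      rw [h2]
      exact (congrArg _ (F.map_zero _ _)).trans comp_zero
    infer_instance
  · intro g
    have h := homVanish_single (X := (regularModule Λ).obj)
      (Y := ModuleCat.of Λᵐᵒᵖ (Λ ⧸ augmentationKer ε)) hn ((perfEmbeddingStalk _).inv ≫ g)
    rw [← cancel_epi (perfEmbeddingStalk _).inv, comp_zero]
    exact h

end SimpleTop

end Augmented

/-! ### The theorem for a finite-dimensional algebra with involution -/

section Main

open Opposite

theorem IsLocalIdempotent.nonempty_orderIso_and_mk_twoSiltAlg {K : Type u} [Field K] {Λ : Type w}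
    [Ring Λ] [Algebra K Λ] [Module.Finite K Λ] [StarRing Λ] {ε : Λ →ₐ[K] K} {e : Λ}
    (he : IsLocalIdempotent ε e) (hstar : star e = e) :
    Nonempty (TMinus (idempotentModule e he.isIdempotentElem) ≃o
        (TPlus (idempotentModule e he.isIdempotentElem))ᵒᵈ) ∧
      #(twoSiltAlg Λ) = 2 * #(TMinus (idempotentModule e he.isIdempotentElem)) := by
  have : Module.Finite K Λᵐᵒᵖ := Module.Finite.equiv (MulOpposite.opLinearEquiv K)
  have : IsArtinianRing Λᵐᵒᵖ := IsArtinianRing.of_finite K _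
  have : IsNoetherianRing Λᵐᵒᵖ := IsNoetherianRing.of_finite K _
  have hidem := he.isIdempotentElem
  have η := projDualInvol Λ
  have hD := isDuality_dualKb η
  have := dualKb_full η
  have := dualKb_faithful η
  have hdual : ∀ {X Y : ProjCat Λ}, ((projDual Λ).obj (op X) ≅ Y) →
      Nonempty ((dualKb (projDual Λ)).obj (op ((stalkFunctor _).obj X)) ≅ (stalkFunctor _).obj Y) :=
    fun {X Y} i => (nonempty_dualKb_stalk X).map fun j => j ≪≫ (stalkFunctor _).mapIso i
  obtain ⟨eA⟩ := hdual projDualRegular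
  obtain ⟨eP⟩ := hdual (projDualIdempotent hidem hstar)
  obtain ⟨eM⟩ := hdual (projDualIdempotent hidem.one_sub (by rw [star_sub, star_one, hstar]))
  refine nonempty_orderIso_and_mk_twoSilt (𝒯 := PerfCat Λ)
    (A := (stalkFunctor _).obj (regularModule Λ)) (P := (stalkFunctor _).obj (idempotentModule e hidem))
    (fun i hi => homVanish_stalk hi.ne') he.isLocalEnd
    (isClassicalTriangulatedGenerator_stalk inAdd_stalk_regular) (fun T => ?_)
    ⟨(stalkFunctor _).obj (idempotentModule (1 - e) hidem.one_sub), ?_⟩ (perfEmbedding Λ) he.isSimpleTop hD eA eP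
  · obtain ⟨Q, q, hq⟩ := isCyclicAt_regularModule.exists_isMinRightApprox T
    exact ⟨_, q, hq⟩
  -- The left approximation of eΛ by copies of (1 - e)Λ is the dual of a right one, since the
  -- duality fixes both modules.
  · obtain ⟨Q, q, hq⟩ := (isCyclicAt_idempotentModule hidem.one_sub).exists_isMinRightApprox
      ((stalkFunctor _).obj (idempotentModule e hidem))
    exact ⟨_, _, nonempty_iso_biprod_idempotentModule hidem, he.not_inAdd,
      (hD.isMinLeftApprox hq).of_iso eM eP.symm⟩

end Main

/-! ### The augmentation ideal of a p-group algebra is nil -/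

section PGroup

variable {K : Type u} [Field K]

/-- The augmentation of the group algebra. -/
noncomputable def augmentation (K : Type u) [Field K] (G : Type v) [Group G] :
    MonoidAlgebra K G →ₐ[K] K :=
  MonoidAlgebra.lift K K G 1

theorem augmentation_single {G : Type v} [Group G] (g : G) (a : K) :
    augmentation K G (MonoidAlgebra.single g a) = a := by
  rw [augmentation, MonoidAlgebra.lift_single, MonoidHom.one_apply, smul_eq_mul, mul_one]

theorem augmentation_mapDomain {G : Type v} {H : Type w} [Group G] [Group H] (f : G →* H)
    (x : MonoidAlgebra K G) :
    augmentation K H (MonoidAlgebra.mapDomainAlgHom K K f x) = augmentation K G x := by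
  induction x using MonoidAlgebra.induction_linear with
  | zero => rw [map_zero, map_zero, map_zero]
  | add x y hx hy => rw [map_add, map_add, map_add, hx, hy]
  | single g a =>
    rw [MonoidAlgebra.mapDomainAlgHom_apply, MonoidAlgebra.mapDomain_single, augmentation_single,
      augmentation_single]

theorem eq_single_of_subsingleton {G : Type v} [Group G] [Subsingleton G] (x : MonoidAlgebra K G) :
    x = MonoidAlgebra.single 1 (augmentation K G x) := by
  induction x using MonoidAlgebra.induction_linear with
  | zero => rw [map_zero, MonoidAlgebra.single_zero]
  | add x y hx hy => rw [map_add, MonoidAlgebra.single_add, ← hx, ← hy]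
  | single g a => rw [augmentation_single, Subsingleton.elim g 1]

/-- The kernel of the map of group algebras that factors out a central cyclic subgroup. -/
theorem exists_eq_one_sub_mul {G : Type v} [Group G] [Finite G] {z : G}
    (hz : z ∈ Subgroup.center G) [(Subgroup.zpowers z).Normal] {x : MonoidAlgebra K G}
    (hx : MonoidAlgebra.mapDomainAlgHom K K (QuotientGroup.mk' (Subgroup.zpowers z)) x = 0) :
    ∃ w, x = (1 - MonoidAlgebra.single z 1) * w := by
  -- Replacing each group element by the chosen representative of its coset changes x by a multiple
  -- of 1 - z; if the image of x in the quotient algebra is zero, nothing else remains.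
  let s : G ⧸ Subgroup.zpowers z → G := Quotient.out
  have key : ∀ x : MonoidAlgebra K G, ∃ w, x - MonoidAlgebra.mapDomain s
      (MonoidAlgebra.mapDomainAlgHom K K (QuotientGroup.mk' (Subgroup.zpowers z)) x) =
        (1 - MonoidAlgebra.single z 1) * w := by
    intro x
    induction x using MonoidAlgebra.induction_linear with
    | zero => exact ⟨0, by rw [map_zero, MonoidAlgebra.mapDomain_zero, sub_zero, mul_zero]⟩
    | add x y hx hy =>
      obtain ⟨v, hv⟩ := hx
      obtain ⟨w, hw⟩ := hy
      exact ⟨v + w, by rw [map_add, MonoidAlgebra.mapDomain_add, mul_add, ← hv, ← hw]; abel⟩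
    | single g a =>
      obtain ⟨h, hh⟩ := QuotientGroup.mk_out_eq_mul (Subgroup.zpowers z) g
      -- Finiteness gives a natural exponent, so that 1 - zᵏ is 1 - z times a geometric sum.
      obtain ⟨k, hk⟩ := mem_powers_iff_mem_zpowers.2 h.2
      have hcomm : g * z ^ k = z ^ k * g := Subgroup.mem_center_iff.1 (pow_mem hz k) g
      refine ⟨(∑ i ∈ Finset.range k, MonoidAlgebra.single z 1 ^ i) * MonoidAlgebra.single g a, ?_⟩
      rw [MonoidAlgebra.mapDomainAlgHom_apply, MonoidAlgebra.mapDomain_single,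
        MonoidAlgebra.mapDomain_single, ← mul_assoc, mul_neg_geom_sum, MonoidAlgebra.single_pow,
        sub_mul, one_mul, MonoidAlgebra.single_mul_single, one_pow, one_mul, ← hcomm]
      congr 2
      exact hh.trans (congrArg (g * ·) hk.symm)
  obtain ⟨w, hw⟩ := key x
  rw [hx, MonoidAlgebra.mapDomain_zero, sub_zero] at hw
  exact ⟨w, hw⟩

theorem commute_single_of_mem_center {G : Type v} [Group G] {z : G} (hz : z ∈ Subgroup.center G)
    (w : MonoidAlgebra K G) : Commute (MonoidAlgebra.single z 1) w := by
  induction w using MonoidAlgebra.induction_linear with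
  | zero => exact Commute.zero_right _
  | add x y hx hy => exact hx.add_right hy
  | single g a =>
    rw [commute_iff_eq, MonoidAlgebra.single_mul_single, MonoidAlgebra.single_mul_single,
      mul_one, one_mul, Subgroup.mem_center_iff.1 hz g]

/-- The augmentation ideal of a finite `p`-group in characteristic `p` is nil. -/
theorem isNilpotent_of_isPGroup {p : ℕ} [Fact p.Prime] [CharP K p] (n : ℕ) :
    ∀ (D : Type v) [Group D] [Finite D] (_ : IsPGroup p D) (_ : Nat.card D ≤ n)
      (x : MonoidAlgebra K D), augmentation K D x = 0 → IsNilpotent x := by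
  induction n with
  | zero => exact fun D _ _ _ h => (Nat.card_pos.ne' (Nat.le_zero.1 h)).elim
  | succ n ih =>
    intro D _ _ hD hn x hx
    rcases subsingleton_or_nontrivial D with h | h
    · rw [eq_single_of_subsingleton x, hx, MonoidAlgebra.single_zero]
      exact IsNilpotent.zero
    -- Take z ≠ 1 central. By induction the image of x for D/⟨z⟩ is nilpotent, so some power of x is
    -- a multiple of 1 - z. This element commutes with everything and is nilpotent, because (1 -
    -- z)^(pᵏ) = 1 - z^(pᵏ) = 0 for suitable k.
    have := hD.center_nontrivial
    obtain ⟨⟨z, hz⟩, hz1⟩ := exists_ne (1 : Subgroup.center D)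
    have hz1' : z ≠ 1 := fun h => hz1 (Subtype.ext h)
    have hnormal : (Subgroup.zpowers z).Normal := ⟨fun y hy g => by
      have hy' : y ∈ Subgroup.center D := Subgroup.zpowers_le.2 hz hy
      rwa [Subgroup.mem_center_iff.1 hy' g, mul_inv_cancel_right]⟩
    have hcard : Nat.card (D ⧸ Subgroup.zpowers z) < Nat.card D := by
      rw [Subgroup.card_eq_card_quotient_mul_card_subgroup (Subgroup.zpowers z)]
      refine lt_mul_of_one_lt_right Nat.card_pos ?_
      rw [Subgroup.one_lt_card_iff_ne_bot]
      exact fun h => hz1' (Subgroup.zpowers_eq_bot.1 h)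
    obtain ⟨m, hm⟩ := ih (D ⧸ Subgroup.zpowers z) (hD.to_quotient _) (by lia)
      (MonoidAlgebra.mapDomainAlgHom K K (QuotientGroup.mk' (Subgroup.zpowers z)) x)
      ((augmentation_mapDomain _ _).trans hx)
    rw [← map_pow] at hm
    obtain ⟨w, hw⟩ := exists_eq_one_sub_mul hz hm
    obtain ⟨k, hk⟩ := hD z
    have hchar : CharP (MonoidAlgebra K D) p :=
      charP_of_injective_algebraMap (algebraMap K (MonoidAlgebra K D)).injective p
    refine IsNilpotent.of_pow (m := m) ?_
    rw [hw]
    refine ((Commute.one_left w).sub_left (commute_single_of_mem_center hz w)).isNilpotent_mul_right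
      ⟨p ^ k, ?_⟩
    rw [sub_pow_char_pow_of_commute _ _ (Commute.one_left _), one_pow, MonoidAlgebra.single_pow, hk,
      one_pow, MonoidAlgebra.one_def, sub_self]

end PGroup

/-! ### The averaging idempotent of a semidirect product -/

section SemidirectProduct

variable {K : Type u} [Field K] {G : Type v} [Group G] [Finite G] (E : Subgroup G)

theorem subgroupAverage_eq [Fintype E] : subgroupAverage K E =
    (Nat.card E : K)⁻¹ • ∑ g : E, MonoidAlgebra.single (g : G) (1 : K) := by
  rw [subgroupAverage, finsum_eq_sum_of_fintype]

variable {E}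

theorem single_mul_subgroupAverage (h : E) :
    MonoidAlgebra.single (h : G) 1 * subgroupAverage K E = subgroupAverage K E := by
  have := Fintype.ofFinite E
  rw [subgroupAverage_eq, mul_smul_comm, Finset.mul_sum]
  congr 1
  refine Fintype.sum_equiv (Equiv.mulLeft h) _ _ fun g => ?_
  rw [MonoidAlgebra.single_mul_single, one_mul]
  rfl

theorem subgroupAverage_mul_single (h : E) :
    subgroupAverage K E * MonoidAlgebra.single (h : G) 1 = subgroupAverage K E := by
  have := Fintype.ofFinite E
  rw [subgroupAverage_eq, smul_mul_assoc, Finset.sum_mul]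
  congr 1
  refine Fintype.sum_equiv (Equiv.mulRight h) _ _ fun g => ?_
  rw [MonoidAlgebra.single_mul_single, one_mul]
  rfl

theorem inv_card_smul_sum [Fintype E] {M : Type*} [AddCommGroup M] [Module K M]
    (hE : (Nat.card E : K) ≠ 0) (x : M) : (Nat.card E : K)⁻¹ • ∑ _ : E, x = x := by
  rw [Finset.sum_const, Finset.card_univ, ← Nat.card_eq_fintype_card, ← Nat.cast_smul_eq_nsmul K,
    smul_smul, inv_mul_cancel₀ hE, one_smul]

theorem isIdempotentElem_subgroupAverage (hE : (Nat.card E : K) ≠ 0) :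
    IsIdempotentElem (subgroupAverage K E) := by
  have := Fintype.ofFinite E
  change subgroupAverage K E * subgroupAverage K E = subgroupAverage K E
  conv_lhs => arg 1; rw [subgroupAverage_eq]
  rw [smul_mul_assoc, Finset.sum_mul]
  simp only [single_mul_subgroupAverage]
  exact inv_card_smul_sum hE _

theorem augmentation_subgroupAverage (hE : (Nat.card E : K) ≠ 0) :
    augmentation K G (subgroupAverage K E) = 1 := by
  have := Fintype.ofFinite E
  rw [subgroupAverage_eq, map_smul, map_sum]
  simp only [augmentation_single]
  exact inv_card_smul_sum hE _

/-- Modulo left multiplication by `e`, every element of `KG` comes from `KD`. -/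
theorem exists_subgroupAverage_mul_eq {D : Subgroup G} (hED : Subgroup.IsComplement' E D)
    (x : MonoidAlgebra K G) : ∃ y : MonoidAlgebra K D, augmentation K D y = augmentation K G x ∧
      subgroupAverage K E * x =
        subgroupAverage K E * MonoidAlgebra.mapDomainAlgHom K K D.subtype y := by
  induction x using MonoidAlgebra.induction_linear with
  | zero => exact ⟨0, by rw [map_zero, map_zero], by rw [map_zero]⟩
  | add x x' hx hx' =>
    obtain ⟨y, hy, hxy⟩ := hx
    obtain ⟨y', hy', hxy'⟩ := hx'
    exact ⟨y + y', by rw [map_add, map_add, hy, hy'], by rw [map_add, mul_add, mul_add, hxy, hxy']⟩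
  | single g a =>
    obtain ⟨⟨h, d⟩, hg, -⟩ := hED.existsUnique g
    refine ⟨MonoidAlgebra.single d a, by rw [augmentation_single, augmentation_single], ?_⟩
    rw [← hg, MonoidAlgebra.mapDomainAlgHom_apply, MonoidAlgebra.mapDomain_single]
    change _ * MonoidAlgebra.single ((h : G) * (d : G)) a = _ * MonoidAlgebra.single (d : G) a
    rw [← one_mul a, ← MonoidAlgebra.single_mul_single, ← mul_assoc,
      subgroupAverage_mul_single, one_mul]

/-- Averaging an element of `KD` over the conjugation action of `E`. -/
theorem exists_subgroupAverage_conj {D : Subgroup G} [D.Normal] (hE : (Nat.card E : K) ≠ 0)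
    (y : MonoidAlgebra K D) : ∃ y' : MonoidAlgebra K D, augmentation K D y' = augmentation K D y ∧
      subgroupAverage K E * MonoidAlgebra.mapDomainAlgHom K K D.subtype y * subgroupAverage K E =
        subgroupAverage K E * MonoidAlgebra.mapDomainAlgHom K K D.subtype y' ∧
      subgroupAverage K E * MonoidAlgebra.mapDomainAlgHom K K D.subtype y * subgroupAverage K E =
        MonoidAlgebra.mapDomainAlgHom K K D.subtype y' * subgroupAverage K E := by
  induction y using MonoidAlgebra.induction_linear with
  | zero => exact ⟨0, rfl, by simp only [map_zero, mul_zero, zero_mul],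
      by simp only [map_zero, mul_zero, zero_mul]⟩
  | add x x' hx hx' =>
    obtain ⟨y, hy, h₁, h₂⟩ := hx
    obtain ⟨y', hy', h₁', h₂'⟩ := hx'
    exact ⟨y + y', by rw [map_add, map_add, hy, hy'],
      by simp only [map_add, mul_add, add_mul, h₁, h₁'],
      by simp only [map_add, mul_add, add_mul, h₂, h₂']⟩
  | single d a =>
    have := Fintype.ofFinite E
    -- Since e absorbs elements of E, e·hdh⁻¹ = e·dh⁻¹ and hdh⁻¹·e = hd·e. Averaging over h turns
    -- both into ede.
    let c (h : E) : D := MulAut.conjNormal (h : G) d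
    have hc (h : E) : MonoidAlgebra.single (c h : G) a = MonoidAlgebra.single (h : G) 1 *
        (MonoidAlgebra.single (d : G) a * MonoidAlgebra.single ((h⁻¹ : E) : G) 1) := by
      rw [MonoidAlgebra.single_mul_single, MonoidAlgebra.single_mul_single, one_mul, mul_one,
        ← mul_assoc]
      congr 1
    have hsum (z : MonoidAlgebra K G) : (Nat.card E : K)⁻¹ • ∑ h : E, z *
        MonoidAlgebra.single ((h⁻¹ : E) : G) 1 = z * subgroupAverage K E := by
      rw [subgroupAverage_eq, mul_smul_comm, Finset.mul_sum]
      congr 1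
      exact Fintype.sum_equiv (Equiv.inv E) _ _ fun _ => rfl
    have hsum' (z : MonoidAlgebra K G) : (Nat.card E : K)⁻¹ • ∑ h : E,
        MonoidAlgebra.single (h : G) 1 * z = subgroupAverage K E * z := by
      rw [subgroupAverage_eq, smul_mul_assoc, Finset.sum_mul]
    refine ⟨(Nat.card E : K)⁻¹ • ∑ h : E, MonoidAlgebra.single (c h) a, ?_, ?_, ?_⟩
    · rw [map_smul, map_sum]
      simp only [augmentation_single]
      exact inv_card_smul_sum hE _
    · simp only [map_smul, map_sum, MonoidAlgebra.mapDomainAlgHom_apply,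
        MonoidAlgebra.mapDomain_single, Subgroup.coe_subtype]
      rw [mul_smul_comm, Finset.mul_sum]
      simp only [hc]
      simp only [← mul_assoc, subgroupAverage_mul_single]
      exact (hsum _).symm
    · simp only [map_smul, map_sum, MonoidAlgebra.mapDomainAlgHom_apply,
        MonoidAlgebra.mapDomain_single, Subgroup.coe_subtype]
      rw [smul_mul_assoc, Finset.sum_mul]
      simp only [hc]
      simp only [mul_assoc, single_mul_subgroupAverage]
      exact (hsum' _).symm

/-- Here ex = ey and eye = ey' = y'e with y, y' in KD of the same augmentation as x. If that is 0,
then y' is nilpotent and ey' is a product of commuting elements: ey' commutes to y'e. -/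
theorem isLocalIdempotent_subgroupAverage {D : Subgroup G} [D.Normal]
    (hED : Subgroup.IsComplement' E D) (hE : (Nat.card E : K) ≠ 0)
    (hD : ∀ y : MonoidAlgebra K D, augmentation K D y = 0 → IsNilpotent y) :
    IsLocalIdempotent (augmentation K G) (subgroupAverage K E) where
  isIdempotentElem := isIdempotentElem_subgroupAverage hE
  map_eq_one := augmentation_subgroupAverage hE
  isNilpotent x hx := by
    obtain ⟨y, hy, hxy⟩ := exists_subgroupAverage_mul_eq hED x
    obtain ⟨y', hy', h₁, h₂⟩ := exists_subgroupAverage_conj hE y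
    rw [hxy, h₁]
    exact Commute.isNilpotent_mul_left (h₁.symm.trans h₂)
      ((hD y' (hy'.trans (hy.trans hx))).map _)

/-- If e = a + b, then ε(a) and ε(b) are 0 and 1 in some order. The summand with ε = 0 lies in eΛe,
hence is nilpotent, and a nilpotent idempotent vanishes. -/
theorem IsLocalIdempotent.isPrimitiveIdempotent {Λ : Type w} [Ring Λ] [Algebra K Λ]
    {ε : Λ →ₐ[K] K} {e : Λ} (he : IsLocalIdempotent ε e) : IsPrimitiveIdempotent e where
  isIdempotentElem := he.isIdempotentElem
  ne_zero h := by
    have := he.map_eq_one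
    rw [h, map_zero] at this
    exact zero_ne_one this
  eq_zero_or_eq_zero a b ha hb hab hba h := by
    have key : ∀ c : Λ, IsIdempotentElem c → e * c = c → c * e = c → ε c = 0 → c = 0 := by
      intro c hc h₁ h₂ h₃
      have h₄ := he.isNilpotent c h₃
      rw [h₁, h₂] at h₄
      obtain ⟨n, hn⟩ := h₄
      rw [← hc.pow_succ_eq n, pow_succ, hn, zero_mul]
    have hε := he.map_eq_one
    have hεa : IsIdempotentElem (ε a) := ha.map ε
    rw [h, map_add] at hε
    rcases IsIdempotentElem.iff_eq_zero_or_one.1 hεa with h0 | h1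
    · exact Or.inl (key a ha (by rw [h, add_mul, ha.eq, hba, add_zero])
        (by rw [h, mul_add, ha.eq, hab, add_zero]) h0)
    · replace hε : ε b = 0 := by simpa [h1] using hε
      exact Or.inr (key b hb (by rw [h, add_mul, hb.eq, hab, zero_add])
        (by rw [h, mul_add, hb.eq, hba, zero_add]) hε)

variable (K G) in
/-- The anti-automorphism of the group algebra that inverts the elements of the group, as an
algebra homomorphism to the opposite algebra. -/
noncomputable def invHom : MonoidAlgebra K G →ₐ[K] (MonoidAlgebra K G)ᵐᵒᵖ :=
  MonoidAlgebra.lift K (MonoidAlgebra K G)ᵐᵒᵖ G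
    { toFun := fun g => MulOpposite.op (MonoidAlgebra.single g⁻¹ 1)
      map_one' := by rw [inv_one]; rfl
      map_mul' := fun g h => by
        rw [← MulOpposite.op_mul, MonoidAlgebra.single_mul_single, mul_inv_rev, one_mul] }

theorem invHom_single (g : G) (a : K) :
    invHom K G (MonoidAlgebra.single g a) = MulOpposite.op (MonoidAlgebra.single g⁻¹ a) := by
  rw [invHom, MonoidAlgebra.lift_single]
  change a • MulOpposite.op (MonoidAlgebra.single g⁻¹ 1) = _
  rw [← MulOpposite.op_smul, MonoidAlgebra.smul_single, smul_eq_mul, mul_one]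

theorem invHom_unop_invHom (x : MonoidAlgebra K G) :
    (invHom K G (invHom K G x).unop).unop = x := by
  induction x using MonoidAlgebra.induction_linear with
  | zero => rw [map_zero, MulOpposite.unop_zero, map_zero, MulOpposite.unop_zero]
  | add x y hx hy => rw [map_add, MulOpposite.unop_add, map_add, MulOpposite.unop_add, hx, hy]
  | single g a => rw [invHom_single, MulOpposite.unop_op, invHom_single, MulOpposite.unop_op, inv_inv]

theorem bijective_invHom : Function.Bijective (invHom K G) :=
  ⟨fun x y h => by rw [← invHom_unop_invHom x, h, invHom_unop_invHom],
    fun y => ⟨(invHom K G y.unop).unop, MulOpposite.unop_injective (invHom_unop_invHom y.unop)⟩⟩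

theorem invHom_subgroupAverage :
    invHom K G (subgroupAverage K E) = MulOpposite.op (subgroupAverage K E) := by
  have := Fintype.ofFinite E
  rw [subgroupAverage_eq, map_smul, map_sum, MulOpposite.op_smul, Finset.op_sum]
  congr 1
  refine Fintype.sum_equiv (Equiv.inv E) _ _ fun g => ?_
  rw [invHom_single]
  rfl

variable (K G) in
/-- The involution of the group algebra given by the inversion of group elements. -/
noncomputable abbrev groupAlgebraStarRing : StarRing (MonoidAlgebra K G) where
  star x := (invHom K G x).unop
  star_involutive := invHom_unop_invHom
  star_mul x y := by rw [map_mul, MulOpposite.unop_mul]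
  star_add x y := by rw [map_add, MulOpposite.unop_add]

end SemidirectProduct

end Silting

/-! ### The theorem for KG -/

theorem theorem2p10 {K : Type*} [Field K] [IsAlgClosed K] (p : ℕ) [CharP K p]
    {G : Type*} [Group G] [Finite G] (E D : Subgroup G) [D.Normal]
    (hED : Subgroup.IsComplement' E D)
    (hE : ¬ p ∣ Nat.card E) (hD : ∃ n : ℕ, Nat.card D = p ^ n) :
    ∃ he : Silting.IsPrimitiveIdempotent (Silting.subgroupAverage K E),
      (∃ σ : MonoidAlgebra K G ≃ₐ[K] (MonoidAlgebra K G)ᵐᵒᵖ,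
        (∀ g : G, σ (MonoidAlgebra.single g 1) =
          MulOpposite.op (MonoidAlgebra.single g⁻¹ 1)) ∧
        σ (Silting.subgroupAverage K E) = MulOpposite.op (Silting.subgroupAverage K E)) ∧
      Nonempty (Silting.TMinus (Silting.idempotentModule _ he.isIdempotentElem) ≃o
        (Silting.TPlus (Silting.idempotentModule _ he.isIdempotentElem))ᵒᵈ) ∧
      #(Silting.twoSiltAlg (MonoidAlgebra K G)) =
        2 * #(Silting.TMinus (Silting.idempotentModule _ he.isIdempotentElem)) := by
  have hcard : (Nat.card E : K) ≠ 0 := fun h => hE ((CharP.cast_eq_zero_iff K p _).1 h)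
  have hnil : ∀ y : MonoidAlgebra K D, Silting.augmentation K D y = 0 → IsNilpotent y := by
    obtain ⟨n, hn⟩ := hD
    -- In characteristic zero |D| = 0ⁿ is nonzero, which forces n = 0 and D = 1; then the
    -- augmentation of KD is injective.
    rcases CharP.char_is_prime_or_zero K p with hp | rfl
    · have := Fact.mk hp
      exact Silting.isNilpotent_of_isPGroup _ D (IsPGroup.of_card hn) le_rfl
    · have h1 : Nat.card D = 1 := by
        rcases n with - | n
        · exact hn
        · exact (Nat.card_pos.ne' (hn.trans (zero_pow n.succ_ne_zero))).elim
      have := (Nat.card_eq_one_iff_unique.1 h1).1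
      intro y hy
      rw [Silting.eq_single_of_subsingleton y, hy, MonoidAlgebra.single_zero]
      exact IsNilpotent.zero
  have he := Silting.isLocalIdempotent_subgroupAverage hED hcard hnil
  refine ⟨he.isPrimitiveIdempotent,
    ⟨AlgEquiv.ofBijective (Silting.invHom K G) Silting.bijective_invHom,
      fun g => Silting.invHom_single g 1, Silting.invHom_subgroupAverage⟩, ?_⟩
  let _ := Silting.groupAlgebraStarRing K G
  exact he.nonempty_orderIso_and_mk_twoSiltAlg
    (congrArg MulOpposite.unop Silting.invHom_subgroupAverage)
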